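/- **Circuits and relations.** For $n\ge 0$ consider words in the letters $\sigma_1^{\pm1},\dots,\sigma_{n-1}^{\pm1}$. Given invertible operations $g_1,\dots,g_{n-1}$ ("gates"), such a word $C$ is read as a circuit by replacing $\sigma_i^{\pm1}$ with $g_i^{\pm1}$; it implements the product $f_C$ of its gates, and $|C|$ is its number of letters. Let $\Gamma_n$ be the set of relations of the braid group $B_n$: $\sigma_i\sigma_j=\sigma_j\sigma_i$ for $|i-j|\ge2$, $\sigma_i\sigma_{i+1}\sigma_i=\sigma_{i+1}\sigma_i\sigma_{i+1}$, and the cancellations $\sigma_i\sigma_i^{-1}=1=\sigma_i^{-1}\sigma_i$. For gates satisfying $\Gamma_n$, a map $\mathcal O$ on circuits is a *$(G,\Gamma_n)$-indistinguishability obfuscator* if (1) $f_{\mathcal O(C)}=f_C$ for every circuit $C$ (strong functional equivalence: the same transformation of the whole register, resp. exactly the same unitary); (2) there is a polynomial $p$ with $|\mathcal O(C)|\le p(|C|)$ for every $C$; (3) $\mathcal O(C_1)=\mathcal O(C_2)$ whenever $C_1$ and $C_2$ differ by a finite sequence of applications of relations in $\Gamma_n$. **Normal form.** Let $\Delta_n=(\sigma_1)(\sigma_2\sigma_1)\cdots(\sigma_{n-1}\cdots\sigma_1)$,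 let $\pi:B_n\to S_n$ be given by $\sigma_i\mapsto(i\ i{+}1)$, and for $f\in S_n$ let $\hat f$ be the simple braid with $\pi(\hat f)=f$, written as a positive word whose length is the number of inversions of $f$ (one such word is fixed for each $f$). A word is in *Garside normal form* if it is $\Delta_n^m\hat f_1\cdots\hat f_p$ with $m\in\mathbb Z$, $p\ge0$, $f_1\ne\pi(\Delta_n)$, $f_p\ne1$, and such that for all $j$ and $i$, $f_{j+1}^{-1}(i)>f_{j+1}^{-1}(i+1)$ implies $f_j(i)>f_j(i+1)$. **Gates.** *Classical:* for a finite group $G$, the gate $R_i$ acts on $G^n$ by applying $R(a,b)=(b,b^{-1}ab)$ to the wires $i,i+1$. *Quantum:* let $A=e^{-3\pi i/5}$, $\tau=2/(1+\sqrt5)$, and let $F_n$ be the complex space with orthonormal basis the strings of length $n+1$ over $\{\star,p\}$ that begin and end with $\star$ and do not contain $\star\star$. The Fibonacci gate $\rho_{\mathrm{Fib}}(\sigma_i)$ acts on the symbols $i,i+1,i+2$ by $\star pp\mapsto a\,\star pp$, $pp\star\mapsto a\,pp\star$, $\star p\star\mapsto b\,\star p\star$, $p\star p\mapsto c\,p\star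 p+d\,ppp$, $ppp\mapsto d\,p\star p+e\,ppp$, where $a=-A^4$, $b=A^8$, $c=A^8\tau^2-A^4\tau$, $d=(A^8+A^4)\tau^{3/2}$, $e=A^8\tau-A^4\tau^2$. **Theorem.** The words for the simple braids can be fixed in such a way that the following holds. For every $n$, every word $C$ represents the same element of $B_n$ as exactly one word $\mathcal O_n(C)$ in Garside normal form. A single Turing machine computes $(n,C)\mapsto(n,\mathcal O_n(C))$ in polynomial time (with $n$ and the indices of the letters written in unary), and there is a polynomial $p$ with $|\mathcal O_n(C)|\le p(n+|C|)$ for all $n$ and $C$. Moreover, for every $n$: * for every finite group $G$, the gates $R_1,\dots,R_{n-1}$ satisfy the braid relations, and $\mathcal O_n$ is an indistinguishability obfuscator with respect to $\Gamma_n$ for the circuits over $\{R_1^{\pm1},\dots,R_{n-1}^{\pm1}\}$; * the gates $\rho_{\mathrm{Fib}}(\sigma_1),\dots,\rho_{\mathrm{Fib}}(\sigma_{n-1})$ are unitary and satisfy the braid relations, and $\mathcal O_n$ is an indistinguishability obfuscator with respect to $\Gamma_n$ for the circuits over these gates and their inverses. -/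

import Mathlib

/-! ### Circuits over a set of reversible gates -/

/-- A circuit over the reversible gate set `ι`: a list of gates and inverse gates.  The letter
`(i, true)` is the gate `i`, the letter `(i, false)` is its inverse.  The number of elementary
gates of the circuit is the length of the list. -/
abbrev Circuit (ι : Type) : Type := List (ι × Bool)

/-- The transformation `f_C` implemented by a circuit when `gate i` is the transformation of the
gate `i`: the product of the gates in the order in which they are written. -/
def evalCircuit {ι : Type} {M : Type*} [Monoid M] [Inv M] (gate : ι → M) (C : Circuit ι) : M :=
  (C.map fun x => if x.2 then gate x.1 else (gate x.1)⁻¹).prod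

/-- One application of one of the relations of `Γ` inside a circuit. -/
def RelationStep {ι : Type} (Γ : Set (Circuit ι × Circuit ι)) (C₁ C₂ : Circuit ι) : Prop :=
  ∃ r ∈ Γ, ∃ u v : Circuit ι, C₁ = u ++ r.1 ++ v ∧ C₂ = u ++ r.2 ++ v

/-- `C₁` and `C₂` differ by some sequence of applications (in either direction) of the relations
of `Γ`. -/
def DifferByRelations {ι : Type} (Γ : Set (Circuit ι × Circuit ι)) (C₁ C₂ : Circuit ι) : Prop :=
  Relation.EqvGen (RelationStep Γ) C₁ C₂

/-- `O` is a `(G, Γ)`-indistinguishability obfuscator for the collection `𝒞` of circuits over the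
gate set `G`, given by `gate`.  Functional equivalence is strong equivalence: equality of the
transformations of the whole register. -/
structure IsIndistinguishabilityObfuscator {ι : Type} {M : Type*} [Monoid M] [Inv M]
    (gate : ι → M) (Γ : Set (Circuit ι × Circuit ι)) (𝒞 : Set (Circuit ι))
    (O : Circuit ι → Circuit ι) : Prop where
  relations_hold : ∀ r ∈ Γ, evalCircuit gate r.1 = evalCircuit gate r.2
  functionality : ∀ C ∈ 𝒞, evalCircuit gate (O C) = evalCircuit gate C
  polynomial_slowdown : ∃ p : Polynomial ℕ, ∀ C ∈ 𝒞, (O C).length ≤ p.eval C.length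
  indistinguishability : ∀ C₁ ∈ 𝒞, ∀ C₂ ∈ 𝒞, DifferByRelations Γ C₁ C₂ → O C₁ = O C₂

/-! ### Braids -/

/-- Words in the generators `σ₁, …, σₙ₋₁` of the braid group on `n` strands and their inverses.
The generator `σₖ₊₁` is the index `k : Fin (n - 1)`. -/
abbrev BraidWord (n : ℕ) : Type := Circuit (Fin (n - 1))

/-- The group relations of the braid group on `n` strands, as pairs of words: far commutation, the
braid relation, and the cancellation of a generator against its inverse. -/
inductive BraidRelation (n : ℕ) : BraidWord n → BraidWord n → Prop
  | comm (i j : Fin (n - 1)) (h : i.val + 2 ≤ j.val ∨ j.val + 2 ≤ i.val) :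
      BraidRelation n [(i, true), (j, true)] [(j, true), (i, true)]
  | braid (i j : Fin (n - 1)) (h : j.val = i.val + 1) :
      BraidRelation n [(i, true), (j, true), (i, true)] [(j, true), (i, true), (j, true)]
  | cancel (i : Fin (n - 1)) (b : Bool) : BraidRelation n [(i, b), (i, !b)] []

/-- The set `Γ` of relations of the braid group on `n` strands. -/
def braidRelations (n : ℕ) : Set (BraidWord n × BraidWord n) :=
  {r | BraidRelation n r.1 r.2}

/-- The braid group `Bₙ`, by its presentation. -/
abbrev BraidGroup (n : ℕ) : Type :=
  PresentedGroup {x : FreeGroup (Fin (n - 1)) |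
    ∃ r ∈ braidRelations n, x = FreeGroup.mk r.1 * (FreeGroup.mk r.2)⁻¹}

/-- The braid represented by a word. -/
def toBraid {n : ℕ} (w : BraidWord n) : BraidGroup n :=
  PresentedGroup.mk _ (FreeGroup.mk w)

/-- The transformations `g 0, …, g (n - 2)` satisfy the braid relations. -/
def SatisfiesBraidRelations {n : ℕ} {M : Type*} [Monoid M] (g : Fin (n - 1) → M) : Prop :=
  (∀ i j : Fin (n - 1), i.val + 2 ≤ j.val ∨ j.val + 2 ≤ i.val → g i * g j = g j * g i) ∧
  (∀ i j : Fin (n - 1), j.val = i.val + 1 → g i * g j * g i = g j * g i * g j)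

/-! ### The Garside normal form -/

/-- A positive word, read as a braid word. -/
def positiveWord {n : ℕ} (u : List (Fin (n - 1))) : BraidWord n :=
  u.map fun i => (i, true)

/-- The inverse of a positive word. -/
def inverseWord {n : ℕ} (u : List (Fin (n - 1))) : BraidWord n :=
  (u.map fun i => (i, false)).reverse

/-- The permutation `π(σ_{i_1} ⋯ σ_{i_l})` of a positive word, where `π(σᵢ) = (i i+1)`. -/
def permOfPositive {n : ℕ} (u : List (Fin (n - 1))) : Equiv.Perm (Fin n) :=
  (u.map fun i => Equiv.swap (⟨i.val, by omega⟩ : Fin n) ⟨i.val + 1, by omega⟩).prod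

/-- The number of inversions of a permutation. -/
def inversions {n : ℕ} (f : Equiv.Perm (Fin n)) : ℕ :=
  (Finset.univ.filter fun x : Fin n × Fin n => x.1 < x.2 ∧ f x.2 < f x.1).card

/-- `s` writes, for every permutation `f`, the simple braid of `f` as a positive word: the word has
permutation `f` and any two strands cross at most once, that is, the number of crossings is the
number of inversions of `f`. -/
def IsSimpleSpelling {n : ℕ} (s : Equiv.Perm (Fin n) → List (Fin (n - 1))) : Prop :=
  ∀ f, permOfPositive (s f) = f ∧ (s f).length = inversions f

/-- The word `Δₙ = Δₙ₋₁ σₙ₋₁ σₙ₋₂ ⋯ σ₁ = (σ₁) (σ₂ σ₁) ⋯ (σₙ₋₁ ⋯ σ₁)`. -/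
def deltaWord (n : ℕ) : List (Fin (n - 1)) :=
  (List.finRange (n - 1)).flatMap fun k => ((List.finRange (n - 1)).filter (· ≤ k)).reverse

/-- The word `Δₙᵐ`, for an integer `m`. -/
def deltaPower (n : ℕ) : ℤ → BraidWord n
  | Int.ofNat k => (List.replicate k (positiveWord (deltaWord n))).flatten
  | Int.negSucc k => (List.replicate (k + 1) (inverseWord (deltaWord n))).flatten

/-- Two consecutive permutations `f, g` of a normal sequence: `g⁻¹(i) > g⁻¹(i+1)` implies
`f(i) > f(i+1)`. -/
def NormalPair {n : ℕ} (f g : Equiv.Perm (Fin n)) : Prop :=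
  ∀ i j : Fin n, j.val = i.val + 1 → g⁻¹ j < g⁻¹ i → f j < f i

/-- `w` is a Garside normal form word: `w = Δₙᵐ f̂₁ ⋯ f̂ₚ` with `(f₁, …, fₚ)` a normal sequence of
permutations, `f₁ ≠ π(Δₙ)` and `fₚ ≠ 1`, where the simple braid `f̂` is spelled `s f`. -/
def IsGarsideNormalForm {n : ℕ} (s : Equiv.Perm (Fin n) → List (Fin (n - 1)))
    (w : BraidWord n) : Prop :=
  ∃ (m : ℤ) (fs : List (Equiv.Perm (Fin n))),
    fs.IsChain NormalPair ∧
    fs.head? ≠ some (permOfPositive (deltaWord n)) ∧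
    fs.getLast? ≠ some 1 ∧
    w = deltaPower n m ++ fs.flatMap fun f => positiveWord (s f)

/-! ### Circuits as input and output of an algorithm -/

/-- The alphabet in which circuits are written. -/
inductive CircuitSymbol
  | tick
  | pos
  | neg
  deriving DecidableEq

instance : Fintype CircuitSymbol :=
  ⟨{.tick, .pos, .neg}, fun x => by cases x <;> decide⟩

/-- The code of one letter: its sign, and its index in unary. -/
def encodeLetter {n : ℕ} (x : Fin (n - 1) × Bool) : List CircuitSymbol :=
  (if x.2 then CircuitSymbol.pos else CircuitSymbol.neg) ::
    List.replicate x.1.val CircuitSymbol.tick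

/-- The code of a circuit on `n` wires: `n` in unary, followed by the codes of the letters. -/
def encodeCircuit (C : Σ n : ℕ, BraidWord n) : List CircuitSymbol :=
  List.replicate C.1 CircuitSymbol.tick ++ C.2.flatMap encodeLetter

theorem replicate_tick_append_inj (a b : ℕ) (x y : List CircuitSymbol)
    (hx : x.head? ≠ some .tick) (hy : y.head? ≠ some .tick)
    (h : List.replicate a CircuitSymbol.tick ++ x = List.replicate b CircuitSymbol.tick ++ y) :
    a = b ∧ x = y := by
  induction a generalizing b with
  | zero => cases b with
    | zero => simpa using h
    | succ b => simp [List.replicate_succ] at h; simp [h] at hx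
  | succ a ih => cases b with
    | zero => simp [List.replicate_succ] at h; simp [← h] at hy
    | succ b =>
      simp only [List.replicate_succ, List.cons_append, List.cons.injEq, true_and] at h
      simpa using ih b h

theorem head?_encodeLetters {n : ℕ} (w : BraidWord n) :
    (w.flatMap encodeLetter).head? ≠ some .tick := by
  cases w with
  | nil => simp
  | cons x w => obtain ⟨i, b⟩ := x; cases b <;> simp [encodeLetter]

/-- Different circuits have different codes. -/
theorem encodeCircuit_injective : Function.Injective encodeCircuit := by
  rintro ⟨n, w⟩ ⟨m, v⟩ h
  obtain ⟨hn, hw⟩ := replicate_tick_append_inj _ _ _ _ (head?_encodeLetters w)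
    (head?_encodeLetters v) h
  change n = m at hn
  subst hn
  clear h
  congr 1
  change w.flatMap encodeLetter = v.flatMap encodeLetter at hw
  induction w generalizing v with
  | nil => cases v with
    | nil => rfl
    | cons y v => simp [encodeLetter] at hw
  | cons x w ih => cases v with
    | nil => simp [encodeLetter] at hw
    | cons y v =>
      simp only [List.flatMap_cons, encodeLetter, List.cons_append, List.cons.injEq] at hw
      obtain ⟨h₁, h₂⟩ := hw
      obtain ⟨h₃, h₄⟩ := replicate_tick_append_inj _ _ _ _ (head?_encodeLetters w)
        (head?_encodeLetters v) h₂
      obtain ⟨i, b⟩ := x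
      obtain ⟨j, c⟩ := y
      obtain rfl : i = j := Fin.ext h₃
      obtain rfl : b = c := by cases b <;> cases c <;> simp_all
      rw [ih v h₄]

/-! ### The classical gates -/

/-- The gate `R(a, b) = (b, b⁻¹ a b)` on pairs of elements of a group. -/
def conjGate (G : Type*) [Group G] : Equiv.Perm (G × G) where
  toFun x := (x.2, x.2⁻¹ * x.1 * x.2)
  invFun x := (x.1 * x.2 * x.1⁻¹, x.1)
  left_inv x := by ext <;> simp [mul_assoc]
  right_inv x := by ext <;> simp [mul_assoc]

/-- Apply a transformation of pairs to the wires `i` and `i + 1` of a register of `n` wires, and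
leave the other wires alone. -/
def applyOnWires {G : Type*} {n : ℕ} (R : G × G → G × G) (i : Fin (n - 1)) (x : Fin n → G) :
    Fin n → G := fun k =>
  if k.val = i.val then (R (x ⟨i.val, by omega⟩, x ⟨i.val + 1, by omega⟩)).1
  else if k.val = i.val + 1 then (R (x ⟨i.val, by omega⟩, x ⟨i.val + 1, by omega⟩)).2
  else x k

theorem applyOnWires_comp {G : Type*} {n : ℕ} (R S : G × G → G × G) (h : ∀ p, S (R p) = p)
    (i : Fin (n - 1)) (x : Fin n → G) : applyOnWires S i (applyOnWires R i x) = x := by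
  funext k
  by_cases h₁ : k.val = i.val
  · have hk : (⟨i.val, by omega⟩ : Fin n) = k := Fin.ext h₁.symm
    simp [applyOnWires, h, h₁, hk]
  · by_cases h₂ : k.val = i.val + 1
    · have hk : (⟨i.val + 1, by omega⟩ : Fin n) = k := Fin.ext h₂.symm
      simp [applyOnWires, h, h₂, hk]
    · simp [applyOnWires, h₁, h₂]

/-- The gate `Rᵢ`: the gate `R` acting on the wires `i` and `i + 1` of a register of `n` wires, as
a permutation of all states of the register. -/
def classicalGate (G : Type*) [Group G] (n : ℕ) (i : Fin (n - 1)) : Equiv.Perm (Fin n → G) where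
  toFun := applyOnWires (conjGate G) i
  invFun := applyOnWires (conjGate G).symm i
  left_inv := applyOnWires_comp _ _ (conjGate G).symm_apply_apply i
  right_inv := applyOnWires_comp _ _ (conjGate G).apply_symm_apply i

/-! ### The Fibonacci gates -/

/-- The two symbols of the basis strings of the Fibonacci representation. -/
inductive FibSymbol
  | star
  | p
  deriving DecidableEq

instance : Fintype FibSymbol :=
  ⟨{.star, .p}, fun x => by cases x <;> decide⟩

/-- The basis strings of the Fibonacci representation of `Bₙ`: strings of length `n + 1` that begin
and end with `⋆` and do not contain `⋆⋆`.  (The final `⋆` may be left implicit; the strings are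
then those of length `n` that begin with `⋆`, end with `p` and do not contain `⋆⋆`.) -/
abbrev FibString (n : ℕ) : Type :=
  {s : Fin (n + 1) → FibSymbol //
    s 0 = FibSymbol.star ∧ s (Fin.last n) = FibSymbol.star ∧
    ∀ i : Fin n, ¬ (s i.castSucc = FibSymbol.star ∧ s i.succ = FibSymbol.star)}

/-- The constant `A = exp(-3πi/5)`. -/
noncomputable def fibA : ℂ := Complex.exp (-(3 * Real.pi * Complex.I / 5))

/-- The constant `τ = 2 / (1 + √5)`. -/
noncomputable def fibTau : ℝ := 2 / (1 + Real.sqrt 5)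

/-- The coefficient of `l y r` in the image of `l x r`, where `l x r` is a triple of neighbouring
symbols: with `a = -A⁴`, `b = A⁸`, `c = A⁸τ² - A⁴τ`, `d = (A⁸ + A⁴) τ^{3/2}`, `e = A⁸τ - A⁴τ²`,
`⋆pp ↦ a ⋆pp`, `pp⋆ ↦ a pp⋆`, `⋆p⋆ ↦ b ⋆p⋆`, `p⋆p ↦ c p⋆p + d ppp`, `ppp ↦ d p⋆p + e ppp`.
Triples that contain `⋆⋆` do not occur. -/
noncomputable def fibCoeff : FibSymbol → FibSymbol → FibSymbol → FibSymbol → ℂ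
  | .star, .p, .p, .p => -fibA ^ 4
  | .p, .p, .p, .star => -fibA ^ 4
  | .star, .p, .p, .star => fibA ^ 8
  | .p, .star, .star, .p => fibA ^ 8 * fibTau ^ 2 - fibA ^ 4 * fibTau
  | .p, .star, .p, .p => (fibA ^ 8 + fibA ^ 4) * (fibTau * Real.sqrt fibTau : ℝ)
  | .p, .p, .star, .p => (fibA ^ 8 + fibA ^ 4) * (fibTau * Real.sqrt fibTau : ℝ)
  | .p, .p, .p, .p => fibA ^ 8 * fibTau - fibA ^ 4 * fibTau ^ 2
  | _, _, _, _ => 0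

/-- The gate `ρ_Fib(σᵢ)`: it acts on the symbols number `i`, `i + 1`, `i + 2` of a basis string by
`fibCoeff l x y r`, where `l x r` are these symbols of the input string `t`, and `y` is the middle
one in the output string `t'`; it leaves all other symbols alone. -/
noncomputable def fibGate (n : ℕ) (i : Fin (n - 1)) :
    Matrix (FibString n) (FibString n) ℂ := fun t' t =>
  if ∀ k : Fin (n + 1), k.val ≠ i.val + 1 → t'.1 k = t.1 k then
    fibCoeff (t.1 ⟨i.val, by omega⟩) (t.1 ⟨i.val + 1, by omega⟩) (t'.1 ⟨i.val + 1, by omega⟩)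
      (t.1 ⟨i.val + 2, by omega⟩)
  else 0

/-! The obfuscator is Garside's normal form. Once every circuit is known to have exactly one normal
form word for its braid, computable in polynomial time, the rest is formal: gates that satisfy the
braid relations define a representation of the braid group, so the normal form implements the same
transformation, and circuits related by `braidRelations` have the same braid, hence the same normal
form.

Existence. By `posBraid_eq`, reduced positive words of one permutation represent one braid, so
permutations give well-defined simple braids. Since Δ² commutes with every letter and σᵢ⁻¹ = Δ⁻² · Δ
· (Δσᵢ⁻¹), a circuit equals a power of Δ⁻² times a product of simple braids. Letters are moved from
each factor to its left neighbour as long as that neighbour stays simple. Each move lowers the sum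
of the positions of the letters, so polynomially many sweeps lead to a normal sequence
(`iterate_sweep_spec`). There the factors Δ come first and the trivial ones last, and both are
absorbed (`simpleProd_eq_core`).

Uniqueness. It suffices that a positive braid determines the first term of a normal sequence for it;
then one cancels in the group and inducts (`eq_of_simpleProd_eq`). As in Krammer's work on
linearity, the Lawrence–Krammer operators supply an invariant. They represent the braid group over
the rational functions in t, but for positive words they are polynomial in t, so equal braids still
give equal operators at t = 0 (`krammerWord_eq`). At t = 0 and q = 1/2 all coefficients are
nonnegative, and the zeros of the image of the constant function 1 evolve by the combinatorial rule
`crossStep`. For a normal sequence, the greatest crossing set inside this zero set is the set of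
crossings of the first term (`isGreatestCrossing_crossWord`), and a permutation is determined by its
crossings.

Complexity. Structured stack programs are compiled to Turing machines, with continuations as labels.
Data are binary trees in prefix code, and `PolyTime` is closed under composition, pairing, case
distinction and folds whose states stay polynomially bounded. The algorithm handles simple braids as
reduced words of numbers: deleting a crossing of two given strands (`track`) both decides and splits
off descents, so permutations are never represented.

Gates. The classical braid relation is an identity in the group on each wire. A Fibonacci gate is
-A⁴ + (A⁸ + A⁴)P with self-adjoint projections P that satisfy the Temperley–Lieb relations with
constant τ²; the braid relation then reduces to `fibA_relation`, and unitarity to |A| = 1. -/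

/-! ### Structured programs on stacks -/

/-- The stacks of the machines built below: two persistent stacks `main` and `ret`, three auxiliary
stacks that are empty between operations, and the output. -/
inductive Stk
  | main
  | ret
  | auxA
  | auxB
  | cnt
  | out
  deriving DecidableEq

instance : Fintype Stk :=
  ⟨{.main, .ret, .auxA, .auxB, .cnt, .out}, fun x => by cases x <;> decide⟩

/-- Structured programs on stacks with one register. -/
inductive Prog
  | push (k : Stk) (a : CircuitSymbol)
  | put (k : Stk)
  | pop (k : Stk)
  | seq (P Q : Prog)
  | ite (c : Option CircuitSymbol → Bool) (P Q : Prog)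
  | loop (c : Option CircuitSymbol → Bool) (P : Prog)

namespace Prog

infixr:60 " ;; " => Prog.seq

/-- The contents of the stacks. -/
abbrev Mem : Type := Stk → List CircuitSymbol

/-- `Exec P v S t v' S'`: the program `P`, started with the register `v` and the stacks `S`, stops
after `t` steps with the register `v'` and the stacks `S'`. -/
inductive Exec : Prog → Option CircuitSymbol → Mem → ℕ → Option CircuitSymbol → Mem → Prop
  | push (k a v S) : Exec (push k a) v S 1 v (Function.update S k (a :: S k))
  | put (k v S) : Exec (put k) v S 1 v (Function.update S k (v.getD .tick :: S k))
  | pop (k v S) : Exec (pop k) v S 1 (S k).head? (Function.update S k (S k).tail)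
  | seq {P Q v S t v' S' t' v'' S''} : Exec P v S t v' S' → Exec Q v' S' t' v'' S'' →
      Exec (P ;; Q) v S (1 + t + t') v'' S''
  | ite_true {c P Q v S t v' S'} : c v = true → Exec P v S t v' S' →
      Exec (ite c P Q) v S (1 + t) v' S'
  | ite_false {c P Q v S t v' S'} : c v = false → Exec Q v S t v' S' →
      Exec (ite c P Q) v S (1 + t) v' S'
  | loop_true {c P v S t v' S' t' v'' S''} : c v = true → Exec P v S t v' S' →
      Exec (loop c P) v' S' t' v'' S'' → Exec (loop c P) v S (1 + t + t') v'' S''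
  | loop_false {c P v S} : c v = false → Exec (loop c P) v S 1 v S

/-! ### Compilation of programs to stack machines -/

/-- The continuations that occur while `P` is executed before the continuation `r`. -/
def conts : Prog → List Prog → Set (List Prog)
  | push k a, r => {push k a :: r}
  | put k, r => {put k :: r}
  | pop k, r => {pop k :: r}
  | seq P Q, r => insert (seq P Q :: r) (conts P (Q :: r) ∪ conts Q r)
  | ite c P Q, r => insert (ite c P Q :: r) (conts P r ∪ conts Q r)
  -- The body returns to the loop itself, so iterating creates no new continuation and the set stays
  -- finite.
  | loop c P, r => insert (loop c P :: r) (conts P (loop c P :: r))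

theorem conts_finite (P : Prog) (r : List Prog) : (conts P r).Finite := by
  induction P generalizing r with
  | push | put | pop => exact Set.finite_singleton _
  | seq P Q hP hQ => exact ((hP _).union (hQ _)).insert _
  | ite c P Q hP hQ => exact ((hP _).union (hQ _)).insert _
  | loop c P hP => exact (hP _).insert _

theorem mem_conts (P : Prog) (r : List Prog) : P :: r ∈ conts P r := by
  cases P <;> simp [conts]

/-- The labels of the machine that executes `P`. -/
abbrev Label (P : Prog) : Type := ↥(insert [] (conts P []))

noncomputable instance (P : Prog) : Fintype (Label P) :=
  ((conts_finite P []).insert _).fintype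

open Classical in
/-- A continuation as a label. -/
noncomputable def toLabel (P : Prog) (l : List Prog) : Label P :=
  -- The default label is never used in an execution: `Exec.stepsTo` keeps all continuations inside
  -- the label set.
  if h : l ∈ insert [] (conts P []) then ⟨l, h⟩ else ⟨[], Set.mem_insert _ _⟩

/-- The statement that executes the first instruction of a continuation. -/
noncomputable def stmt (P : Prog) :
    List Prog → Turing.TM2.Stmt (fun _ : Stk => CircuitSymbol) (Label P) (Option CircuitSymbol)
  -- The register is reset because `Turing.haltList` expects the initial state in it.
  | [] => .load (fun _ => none) .halt
  | push k a :: r => .push k (fun _ => a) (.goto fun _ => toLabel P r)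
  | put k :: r => .push k (fun v => v.getD .tick) (.goto fun _ => toLabel P r)
  | pop k :: r => .pop k (fun _ o => o) (.goto fun _ => toLabel P r)
  | seq Q R :: r => .goto fun _ => toLabel P (Q :: R :: r)
  | ite c Q R :: r => .branch c (.goto fun _ => toLabel P (Q :: r)) (.goto fun _ => toLabel P (R :: r))
  | loop c Q :: r =>
    .branch c (.goto fun _ => toLabel P (Q :: loop c Q :: r)) (.goto fun _ => toLabel P r)

/-- The machine that executes `P`. -/
noncomputable def machine (P : Prog) : Turing.FinTM2 where
  K := Stk
  k₀ := .ret
  k₁ := .out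
  Γ := fun _ => CircuitSymbol
  Λ := Label P
  main := toLabel P [P]
  σ := Option CircuitSymbol
  initialState := none
  Γk₀Fin := inferInstanceAs (Fintype CircuitSymbol)
  m := fun l => stmt P l.1

/-- The configuration of the machine at a continuation. -/
noncomputable def cfg (P : Prog) (l : List Prog) (v : Option CircuitSymbol) (S : Mem) :
    (machine P).Cfg :=
  (⟨some (toLabel P l), v, S⟩ : Turing.TM2.Cfg (fun _ : Stk => CircuitSymbol) (Label P) _)

theorem toLabel_val {P : Prog} {l : List Prog} (h : l ∈ insert [] (conts P [])) :
    (toLabel P l).1 = l := by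
  unfold toLabel; rw [dif_pos h]

theorem step_cfg {P : Prog} {l : List Prog} (h : l ∈ insert [] (conts P []))
    (v : Option CircuitSymbol) (S : Mem) :
    (machine P).step (cfg P l v S) =
      some (Turing.TM2.stepAux (K := Stk) (stmt P l) v S) := by
  have : (machine P).step (cfg P l v S) =
      some (Turing.TM2.stepAux (K := Stk) (stmt P (toLabel P l).1) v S) := rfl
  rw [this, toLabel_val h]

/-- The machine goes from one configuration to another in `t` steps. -/
def StepsTo {α : Type*} (f : α → Option α) (a : α) (t : ℕ) (b : α) : Prop :=
  (flip bind f)^[t] (some a) = some b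

theorem StepsTo.one {α : Type*} {f : α → Option α} {a b : α} (h : f a = some b) :
    StepsTo f a 1 b := by
  simpa [StepsTo, flip] using h

theorem StepsTo.trans {α : Type*} {f : α → Option α} {a b c : α} {s t : ℕ}
    (h₁ : StepsTo f a s b) (h₂ : StepsTo f b t c) : StepsTo f a (s + t) c := by
  unfold StepsTo at *
  rw [Nat.add_comm, Function.iterate_add_apply, h₁, h₂]

/-- Induction on the execution; `hQ` guarantees that every continuation met on the way is a label.
The costs in `Exec` are chosen to be exactly the numbers of machine steps. -/
theorem Exec.stepsTo {Q : Prog} {v : Option CircuitSymbol} {S : Mem} {t : ℕ}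
    {v' : Option CircuitSymbol} {S' : Mem} (h : Exec Q v S t v' S') (P : Prog) (r : List Prog)
    (hr : r ∈ insert [] (conts P [])) (hQ : conts Q r ⊆ insert [] (conts P [])) :
    StepsTo (machine P).step (cfg P (Q :: r) v S) t (cfg P r v' S') := by
  induction h generalizing r with
  | push k a v S => exact .one (step_cfg (hQ (mem_conts _ _)) _ _)
  | put k v S => exact .one (step_cfg (hQ (mem_conts _ _)) _ _)
  | pop k v S => exact .one (step_cfg (hQ (mem_conts _ _)) _ _)
  | seq _ _ ih₁ ih₂ =>
    have h₁ := step_cfg (hQ (mem_conts _ _))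
    simp only [conts, Set.insert_subset_iff, Set.union_subset_iff] at hQ
    exact ((StepsTo.one (h₁ _ _)).trans
      (ih₁ _ (hQ.2.2 (mem_conts _ _)) hQ.2.1)).trans (ih₂ _ hr hQ.2.2)
  | ite_true hc _ ih =>
    have h₁ := step_cfg (hQ (mem_conts _ _))
    simp only [conts, Set.insert_subset_iff, Set.union_subset_iff] at hQ
    refine (StepsTo.one ((h₁ _ _).trans ?_)).trans (ih _ hr hQ.2.1)
    simp only [stmt, Turing.TM2.stepAux, hc]; rfl
  | ite_false hc _ ih =>
    have h₁ := step_cfg (hQ (mem_conts _ _))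
    simp only [conts, Set.insert_subset_iff, Set.union_subset_iff] at hQ
    refine (StepsTo.one ((h₁ _ _).trans ?_)).trans (ih _ hr hQ.2.2)
    simp only [stmt, Turing.TM2.stepAux, hc]; rfl
  | loop_true hc _ _ ih₁ ih₂ =>
    have h₁ := step_cfg (hQ (mem_conts _ _))
    have h₂ := ih₂ _ hr hQ
    simp only [conts, Set.insert_subset_iff] at hQ
    refine ((StepsTo.one ((h₁ _ _).trans ?_)).trans (ih₁ _ hQ.1 hQ.2)).trans h₂
    simp only [stmt, Turing.TM2.stepAux, hc]; rfl
  | loop_false hc =>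
    refine StepsTo.one ((step_cfg (hQ (mem_conts _ _)) _ _).trans ?_)
    simp only [stmt, Turing.TM2.stepAux, hc]; rfl

/-- A step pushes at most one symbol. This turns time bounds into size bounds for results. -/
theorem Exec.length_le {Q : Prog} {v : Option CircuitSymbol} {S : Mem} {t : ℕ}
    {v' : Option CircuitSymbol} {S' : Mem} (h : Exec Q v S t v' S') (k : Stk) :
    (S' k).length ≤ (S k).length + t := by
  induction h with
  | push j a v S | put j v S | pop j v S =>
    by_cases hk : k = j
    · subst hk; simp; try omega
    · simp [hk]
  | seq _ _ ih₁ ih₂ => omega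
  | ite_true _ _ ih => omega
  | ite_false _ _ ih => omega
  | loop_true _ _ _ ih₁ ih₂ => omega
  | loop_false _ => omega

/-- `P` leads from the stacks `S` to the stacks `S'` within `b` steps, whatever the register. -/
def Runs (P : Prog) (S : Mem) (b : ℕ) (S' : Mem) : Prop :=
  ∀ v, ∃ t ≤ b, ∃ v', Exec P v S t v' S'

theorem Runs.mono {P : Prog} {S S' : Mem} {b c : ℕ} (h : Runs P S b S') (hc : b ≤ c) :
    Runs P S c S' := fun v => by
  obtain ⟨t, ht, v', h'⟩ := h v
  exact ⟨t, ht.trans hc, v', h'⟩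

theorem Runs.seq {P Q : Prog} {S S' S'' : Mem} {b c : ℕ} (h₁ : Runs P S b S')
    (h₂ : Runs Q S' c S'') : Runs (P ;; Q) S (1 + b + c) S'' := fun v => by
  obtain ⟨t, ht, v', h'⟩ := h₁ v
  obtain ⟨t', ht', v'', h''⟩ := h₂ v'
  exact ⟨1 + t + t', by omega, v'', h'.seq h''⟩

theorem Runs.push (k : Stk) (a : CircuitSymbol) (S : Mem) :
    Runs (push k a) S 1 (Function.update S k (a :: S k)) := fun v => ⟨1, le_rfl, v, .push ..⟩

/-- A program that stops with all stacks empty but the output stack makes its function computable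
by a machine in polynomial time. -/
theorem computableInPolyTime {α β : Type} (ea : α → List CircuitSymbol) (eb : β → List CircuitSymbol)
    (f : α → β) (P : Prog) (p : Polynomial ℕ)
    (h : ∀ a, Runs P (Function.update (fun _ => []) .ret (ea a)) (p.eval (ea a).length)
      (Function.update (fun _ => []) .out (eb (f a)))) :
    Nonempty (Turing.TM2ComputableInPolyTime ea eb f) := by
  -- The additional step is the one that halts.
  have key : ∀ a, ∃ t ≤ (p + 1).eval (ea a).length,
      StepsTo (machine P).step (Turing.initList (machine P) (ea a)) t
        (Turing.haltList (machine P) (eb (f a))) := by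
    intro a
    obtain ⟨t, ht, v', h'⟩ := h a none
    refine ⟨t + 1, by simpa using ht, ?_⟩
    have h₁ := h'.stepsTo P [] (Set.mem_insert _ _) (Set.subset_insert _ _)
    have h₂ : StepsTo (machine P).step
        (cfg P [] v' (Function.update (fun _ => []) .out (eb (f a)))) 1
        (Turing.haltList (machine P) (eb (f a))) := by
      refine StepsTo.one ((step_cfg (Set.mem_insert _ _) _ _).trans ?_)
      simp only [stmt, Turing.TM2.stepAux, Turing.haltList]
      congr 2
      funext k
      cases k <;> rfl
    have h₃ : Turing.initList (machine P) (ea a) =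
        cfg P [P] none (Function.update (fun _ => []) .ret (ea a)) := by
      simp only [Turing.initList, cfg]
      congr 1
      funext k
      cases k <;> rfl
    rw [h₃]
    exact h₁.trans h₂
  choose t ht h' using key
  exact ⟨{
    tm := machine P
    inputAlphabet := Equiv.refl _
    outputAlphabet := Equiv.refl _
    time := p + 1
    outputsFun := fun a =>
      { steps := t a
        evals_in_steps := by
          have := h' a
          unfold StepsTo at this
          have hid : ∀ l : List CircuitSymbol,
              List.map (Equiv.refl CircuitSymbol).invFun l = l := fun l => List.map_id l
          exact (congrArg₂ (fun x y => (flip bind (machine P).step)^[t a]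
            (some (Turing.initList (machine P) x)) = some (Turing.haltList (machine P) y))
            (hid (ea a)) (hid (eb (f a)))).mpr this
        steps_le_m := ht a } }⟩

end Prog

/-! ### Binary trees on stacks -/

/-- Binary trees, the data of the programs built below. -/
inductive BTree
  | nil
  | node (a b : BTree)

/-- The prefix code of a tree. -/
def BTree.tok : BTree → List CircuitSymbol
  | nil => [.tick]
  | node a b => .pos :: (a.tok ++ b.tok)

theorem BTree.tok_length_pos (t : BTree) : 0 < t.tok.length := by
  cases t <;> simp [tok]

namespace Prog

open CircuitSymbol

/-- Execution within a bounded number of steps. -/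
def ExecLe (P : Prog) (v : Option CircuitSymbol) (S : Mem) (b : ℕ) (v' : Option CircuitSymbol)
    (S' : Mem) : Prop := ∃ t ≤ b, Exec P v S t v' S'

theorem ExecLe.mono {P v S b v' S' c} (h : ExecLe P v S b v' S') (hc : b ≤ c) :
    ExecLe P v S c v' S' := by
  obtain ⟨t, ht, h'⟩ := h
  exact ⟨t, ht.trans hc, h'⟩

theorem ExecLe.seq {P Q v S b v' S' c v'' S''} (h₁ : ExecLe P v S b v' S')
    (h₂ : ExecLe Q v' S' c v'' S'') : ExecLe (P ;; Q) v S (1 + b + c) v'' S'' := by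
  obtain ⟨t, ht, h₁⟩ := h₁
  obtain ⟨t', ht', h₂⟩ := h₂
  exact ⟨1 + t + t', by omega, h₁.seq h₂⟩

theorem ExecLe.loop_true {c P v S b v' S' d v'' S''} (hc : c v = true)
    (h₁ : ExecLe P v S b v' S') (h₂ : ExecLe (loop c P) v' S' d v'' S'') :
    ExecLe (loop c P) v S (1 + b + d) v'' S'' := by
  obtain ⟨t, ht, h₁⟩ := h₁
  obtain ⟨t', ht', h₂⟩ := h₂
  exact ⟨1 + t + t', by omega, .loop_true hc h₁ h₂⟩

theorem ExecLe.loop_false {c P v S} (hc : c v = false) : ExecLe (loop c P) v S 1 v S :=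
  ⟨1, le_rfl, .loop_false hc⟩

/-- The effect of a program without loops. -/
def eval : Prog → Option CircuitSymbol × Mem → Option CircuitSymbol × Mem
  | .push k a, x => (x.1, Function.update x.2 k (a :: x.2 k))
  | .put k, x => (x.1, Function.update x.2 k (x.1.getD .tick :: x.2 k))
  | .pop k, x => ((x.2 k).head?, Function.update x.2 k (x.2 k).tail)
  | .seq P Q, x => eval Q (eval P x)
  | .ite c P Q, x => bif c x.1 then eval P x else eval Q x
  | .loop _ _, x => x

/-- A bound for the number of steps of a program without loops. -/
def cost : Prog → ℕ
  | .push _ _ | .put _ | .pop _ => 1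
  | .seq P Q => 1 + cost P + cost Q
  | .ite _ P Q => 1 + (cost P + cost Q)
  | .loop _ _ => 0

/-- The program contains no loop. -/
def LoopFree : Prog → Prop
  | .push _ _ | .put _ | .pop _ => True
  | .seq P Q | .ite _ P Q => LoopFree P ∧ LoopFree Q
  | .loop _ _ => False

/-- Programs without loops are executed by evaluation, so that `simp` can verify their effect. -/
theorem LoopFree.execLe {P : Prog} (h : LoopFree P) (v : Option CircuitSymbol) (S : Mem) :
    ExecLe P v S (cost P) (eval P (v, S)).1 (eval P (v, S)).2 := by
  induction P generalizing v S with
  | push k a => exact ⟨1, le_rfl, .push ..⟩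
  | put k => exact ⟨1, le_rfl, .put ..⟩
  | pop k => exact ⟨1, le_rfl, .pop ..⟩
  | seq P Q hP hQ => exact (hP h.1 _ _).seq (hQ h.2 _ _)
  | ite c P Q hP hQ =>
    cases hc : c v
    · obtain ⟨t, ht, h'⟩ := hQ h.2 v S
      refine ⟨1 + t, by simp [cost]; omega, ?_⟩
      simpa [eval, hc] using Exec.ite_false hc h'
    · obtain ⟨t, ht, h'⟩ := hP h.1 v S
      refine ⟨1 + t, by simp [cost]; omega, ?_⟩
      simpa [eval, hc] using Exec.ite_true hc h'
  | loop c P hP => exact h.elim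

/-- Run one round of a loop, the body of which has no loop. -/
theorem LoopFree.loop_execLe {c : Option CircuitSymbol → Bool} {P : Prog} (h : LoopFree P)
    {v : Option CircuitSymbol} {S : Mem} {w : Option CircuitSymbol} {S₁ : Mem}
    {d : ℕ} {v' : Option CircuitSymbol} {S' : Mem} (hc : c v = true)
    (hP : eval P (v, S) = (w, S₁)) (h' : ExecLe (loop c P) w S₁ d v' S') :
    ExecLe (loop c P) v S (1 + cost P + d) v' S' := by
  have := h.execLe v S
  rw [hP] at this
  exact this.loop_true hc h'

theorem ExecLe.cast {P v S b v' S' v'' S''} (h : ExecLe P v S b v' S') (hv : v' = v'')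
    (hS : S' = S'') : ExecLe P v S b v'' S'' := hv ▸ hS ▸ h

theorem tick_beq_pos : (tick == pos) = false := by decide

/-- The body of the loop of `moveTree`. -/
def moveTreeBody (A B : Stk) : Prog :=
  -- One tree is pending for a nonempty register and one for every tick on `cnt`. A node turns one
  -- pending tree into two, a leaf finishes one, and popping the empty `cnt` ends the loop.
  pop A ;; put B ;; ite (· == some pos) (push .cnt tick ;; push .cnt tick ;; pop .cnt) (pop .cnt)

/-- Move the tree on the top of the stack `A` to the stack `B`, in reversed order. -/
def moveTree (A B : Stk) : Prog :=
  push .cnt tick ;; pop .cnt ;; loop (·.isSome) (moveTreeBody A B)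

/-- The premise is the run of the loop that remains after this tree has been moved. In this
continuation style the run for the right subtree serves as the remainder for the left one, with one
more tick on `cnt`. -/
theorem moveTree_loop {A B : Stk} (hAB : A ≠ B) (hA : A ≠ .cnt) (hB : B ≠ .cnt) (t : BTree) :
    ∀ (k : ℕ) (S : Mem) (rest : List CircuitSymbol) (T : ℕ) (v' : Option CircuitSymbol) (S' : Mem),
      S A = t.tok ++ rest → S .cnt = List.replicate k tick →
      ExecLe (loop (·.isSome) (moveTreeBody A B)) (List.replicate k tick).head?
        (Function.update (Function.update (Function.update S A rest) B (t.tok.reverse ++ S B))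
          .cnt (List.replicate k tick).tail) T v' S' →
      ExecLe (loop (·.isSome) (moveTreeBody A B)) (some tick) S (T + 12 * t.tok.length) v' S' := by
  induction t with
  | nil =>
    intro k S rest T v' S' h₁ h₂ h₃
    refine (LoopFree.loop_execLe (P := moveTreeBody A B) (by simp [moveTreeBody, LoopFree]) (by rfl)
      (Prod.ext ?_ ?_) h₃).mono (by simp [BTree.tok, moveTreeBody, cost]; omega)
    all_goals simp [moveTreeBody, eval, h₁, h₂, BTree.tok, hAB.symm, hA.symm, hB.symm, tick_beq_pos]
  | node a b iha ihb =>
    intro k S rest T v' S' h₁ h₂ h₃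
    have h₄ := iha (k + 1) (Function.update (Function.update (Function.update S A
      (a.tok ++ (b.tok ++ rest))) B (pos :: S B)) .cnt (List.replicate (k + 1) tick))
      (b.tok ++ rest) (T + 12 * b.tok.length) v' S' (by simp [hAB, hA]) (by simp) ?_
    · refine (LoopFree.loop_execLe (P := moveTreeBody A B) (by simp [moveTreeBody, LoopFree])
        (by rfl) (Prod.ext ?_ ?_) h₄).mono (by simp [BTree.tok, moveTreeBody, cost]; omega)
      · simp [moveTreeBody, eval, h₁, h₂, BTree.tok, hAB.symm, hA.symm, hB.symm]
      · simp [moveTreeBody, eval, h₁, h₂, BTree.tok, hAB.symm, hA.symm, hB.symm,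
          List.replicate_succ]
    · refine ihb k _ rest T v' S' (by simp [hAB, hA]) (by simp) ?_
      convert h₃ using 1
      funext j
      by_cases h₁ : j = A <;> by_cases h₂ : j = B <;> by_cases h₃ : j = .cnt <;>
        simp_all [Function.update_apply, BTree.tok]

/-- The contents of the stacks, stack by stack. -/
def mem (m r x y z o : List CircuitSymbol) : Mem
  | .main => m
  | .ret => r
  | .auxA => x
  | .auxB => y
  | .cnt => z
  | .out => o

section
variable (m r x y z o l : List CircuitSymbol)
@[simp] theorem mem_main : mem m r x y z o .main = m := rfl
@[simp] theorem mem_ret : mem m r x y z o .ret = r := rfl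
@[simp] theorem mem_auxA : mem m r x y z o .auxA = x := rfl
@[simp] theorem mem_auxB : mem m r x y z o .auxB = y := rfl
@[simp] theorem mem_cnt : mem m r x y z o .cnt = z := rfl
@[simp] theorem mem_out : mem m r x y z o .out = o := rfl
@[simp] theorem update_mem_main : Function.update (mem m r x y z o) .main l = mem l r x y z o := by
  funext k; cases k <;> rfl
@[simp] theorem update_mem_ret : Function.update (mem m r x y z o) .ret l = mem m l x y z o := by
  funext k; cases k <;> rfl
@[simp] theorem update_mem_auxA : Function.update (mem m r x y z o) .auxA l = mem m r l y z o := by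
  funext k; cases k <;> rfl
@[simp] theorem update_mem_auxB : Function.update (mem m r x y z o) .auxB l = mem m r x l z o := by
  funext k; cases k <;> rfl
@[simp] theorem update_mem_cnt : Function.update (mem m r x y z o) .cnt l = mem m r x y l o := by
  funext k; cases k <;> rfl
@[simp] theorem update_mem_out : Function.update (mem m r x y z o) .out l = mem m r x y z l := by
  funext k; cases k <;> rfl
end

theorem runs_moveTree {A B : Stk} (hAB : A ≠ B) (hA : A ≠ .cnt) (hB : B ≠ .cnt) (t : BTree)
    (S : Mem) (rest : List CircuitSymbol) (h₁ : S A = t.tok ++ rest) (h₂ : S .cnt = []) :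
    Runs (moveTree A B) S (17 * t.tok.length)
      (Function.update (Function.update S A rest) B (t.tok.reverse ++ S B)) := fun v => by
  have h₂' : ∀ S' : Mem, S' .cnt = [] → Function.update S' .cnt [] = S' := fun S' h => by
    rw [← h, Function.update_eq_self]
  have h₃ := moveTree_loop hAB hA hB t 0 S rest 1 none
    (Function.update (Function.update S A rest) B (t.tok.reverse ++ S B)) h₁ (by simpa using h₂) <| by
      rw [List.replicate_zero, List.tail_nil, h₂' _ (by simp [hA.symm, hB.symm, h₂])]
      exact ExecLe.loop_false (by rfl)
  have h₄ := ((LoopFree.execLe (P := push .cnt tick) trivial v S).seq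
    (((LoopFree.execLe (P := pop .cnt) trivial _ _).seq (h₃.cast rfl rfl |> fun h => by
      simpa [eval, h₂, h₂' S h₂] using h))))
  obtain ⟨t', ht, h'⟩ := h₄
  have := t.tok_length_pos
  simp only [cost] at ht
  exact ⟨t', by omega, _, h'⟩

/-- Run `Q` for every element of the stack `A`, held in the register. -/
def drain (A : Stk) (Q : Prog) : Prog := pop A ;; loop (·.isSome) (Q ;; pop A)

theorem foldl_update {A : Stk} {f : CircuitSymbol → Mem → Mem}
    (hc : ∀ a S l, f a (Function.update S A l) = Function.update (f a S) A l)
    (l : List CircuitSymbol) (S : Mem) (l' l'' : List CircuitSymbol) :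
    Function.update (l.foldl (fun S a => f a S) (Function.update S A l')) A l'' =
      Function.update (l.foldl (fun S a => f a S) S) A l'' := by
  induction l generalizing S l' with
  | nil => simp
  | cons b l ih => simp [hc, ih]

/-- The body neither changes nor inspects `A`, so popping commutes with it and the result is a fold
over the original contents. -/
theorem runs_drain {A : Stk} {Q : Prog} (hQ : LoopFree Q) (f : CircuitSymbol → Mem → Mem)
    (hf : ∀ a S, (eval Q (some a, S)).2 = f a S) (hA : ∀ a S, f a S A = S A)
    (hc : ∀ a S l, f a (Function.update S A l) = Function.update (f a S) A l) (S : Mem) :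
    Runs (drain A Q) S (3 + (cost Q + 3) * (S A).length)
      (Function.update ((S A).foldl (fun S a => f a S) S) A []) := by
  have key : ∀ (l : List CircuitSymbol) (S : Mem), S A = l.tail →
      ExecLe (loop (·.isSome) (Q ;; pop A)) l.head? S (1 + (cost Q + 3) * l.length) none
        (Function.update (l.foldl (fun S a => f a S) S) A []) := by
    intro l
    induction l with
    | nil =>
      intro S h
      refine (ExecLe.loop_false (by rfl)).cast rfl ?_
      have : S A = [] := h
      simp only [List.foldl_nil]
      rw [← this, Function.update_eq_self]
    | cons a l ih =>
      intro S h
      have hS : S A = l := h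
      have h₁ := ih (Function.update (f a S) A l.tail) (by simp)
      rw [foldl_update hc] at h₁
      refine (LoopFree.loop_execLe (P := Q ;; pop A) ⟨hQ, trivial⟩ (by rfl)
        (Prod.ext ?_ ?_) h₁).mono ?_
      · simp [eval, hf, hA, hS]
      · simp [eval, hf, hA, hS]
      · simp only [cost, List.length_cons]
        ring_nf; omega
  intro v
  have h₁ := key (S A) (Function.update S A (S A).tail) (by simp)
  obtain ⟨t, ht, h'⟩ := (LoopFree.execLe (P := pop A) trivial v S).seq h₁
  rw [foldl_update hc] at h'
  simp only [cost] at ht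
  exact ⟨t, by omega, _, h'⟩

/-- Move the stack `A` to the stack `B`, in reversed order. -/
def pour (A B : Stk) : Prog := drain A (put B)

theorem runs_pour {A B : Stk} (h : A ≠ B) (S : Mem) :
    Runs (pour A B) S (3 + 4 * (S A).length)
      (Function.update (Function.update S B ((S A).reverse ++ S B)) A []) := by
  have := runs_drain (A := A) (Q := put B) trivial (fun a S => Function.update S B (a :: S B))
    (fun a S => rfl) (fun a S => by simp [h]) (fun a S l => by
      rw [Function.update_comm h]; simp [h.symm]) S
  have h₂ : ∀ (l : List CircuitSymbol) (S : Mem),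
      l.foldl (fun S a => Function.update S B (a :: S B)) S =
        Function.update S B (l.reverse ++ S B) := by
    intro l
    induction l with
    | nil => simp
    | cons a l ih => intro S; rw [List.foldl_cons, ih]; simp
  rw [h₂] at this
  exact this

/-- Empty the stack `A`. -/
def discard (A : Stk) : Prog := drain A (push A .tick ;; pop A)

theorem runs_discard (A : Stk) (S : Mem) :
    Runs (discard A) S (3 + 6 * (S A).length) (Function.update S A []) := by
  have := runs_drain (A := A) (Q := push A .tick ;; pop A) ⟨trivial, trivial⟩ (fun _ S => S)
    (fun a S => by simp [eval]) (fun a S => rfl) (fun _ _ _ => rfl) S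
  rw [show (S A).foldl (fun S _ => S) S = S by
    generalize S A = l; induction l <;> simp_all] at this
  exact this

/-- Move the stack `A` to the stacks `B` and `C`, in reversed order. -/
def pourTwo (A B C : Stk) : Prog := drain A (put B ;; put C)

theorem runs_pourTwo {A B C : Stk} (h : A ≠ B) (h' : A ≠ C) (h'' : B ≠ C) (S : Mem) :
    Runs (pourTwo A B C) S (3 + 6 * (S A).length)
      (Function.update (Function.update (Function.update S B ((S A).reverse ++ S B))
        C ((S A).reverse ++ S C)) A []) := by
  have := runs_drain (A := A) (Q := put B ;; put C) ⟨trivial, trivial⟩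
    (fun a S => Function.update (Function.update S B (a :: S B)) C (a :: S C))
    (fun a S => by simp [eval, h''.symm]) (fun a S => by simp [h, h']) (fun a S l => by
      simp only [Function.update_of_ne h.symm, Function.update_of_ne h'.symm]
      rw [Function.update_comm h, Function.update_comm h']) S
  have h₂ : ∀ (l : List CircuitSymbol) (S : Mem),
      l.foldl (fun S a => Function.update (Function.update S B (a :: S B)) C (a :: S C)) S =
        Function.update (Function.update S B (l.reverse ++ S B)) C (l.reverse ++ S C) := by
    intro l
    induction l with
    | nil => simp
    | cons a l ih =>
      intro S
      rw [List.foldl_cons, ih]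
      simp only [Function.update_self, Function.update_of_ne h'',
        Function.update_comm h'', Function.update_idem, List.reverse_cons, List.append_assoc,
        List.singleton_append]
  rw [h₂] at this
  exact this

/-! ### Stack operations on whole trees -/

/-- The stacks between operations. -/
abbrev std (m r : List CircuitSymbol) : Mem := mem m r [] [] [] []

/-- Remove the tree on the top of the main stack. -/
def drop : Prog := moveTree .main .auxA ;; discard .auxA

/-- Duplicate the tree on the top of the main stack. -/
def dup : Prog :=
  -- Every transfer reverses the word: one copy is moved twice, the other four times.
  moveTree .main .auxA ;; pourTwo .auxA .main .auxB ;; pour .auxB .auxA ;; pour .auxA .main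

/-- Exchange the two trees on the top of the main stack. -/
def swap : Prog :=
  moveTree .main .auxA ;; moveTree .main .auxB ;; pour .auxA .main ;; pour .auxB .main

/-- Move the tree on the top of the main stack to the return stack. -/
def toRet : Prog := moveTree .main .auxA ;; pour .auxA .ret

/-- Move the tree on the top of the return stack to the main stack. -/
def fromRet : Prog := moveTree .ret .auxA ;; pour .auxA .main

theorem runs_moveTree_main_auxA (t : BTree) (m r x y o : List CircuitSymbol) :
    Runs (moveTree .main .auxA) (mem (t.tok ++ m) r x y [] o) (17 * t.tok.length)
      (mem m r (t.tok.reverse ++ x) y [] o) := by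
  simpa using runs_moveTree (A := .main) (B := .auxA) (by decide) (by decide) (by decide) t
    (mem (t.tok ++ m) r x y [] o) m rfl rfl

theorem runs_drop (t : BTree) (m r : List CircuitSymbol) :
    Runs drop (std (t.tok ++ m) r) (30 * t.tok.length) (std m r) := by
  have h₁ := runs_moveTree_main_auxA t m r [] [] []
  have h₂ := runs_discard .auxA (mem m r (t.tok.reverse ++ []) [] [] [])
  simp only [update_mem_auxA] at h₂
  refine (h₁.seq h₂).mono ?_
  have := t.tok_length_pos
  simp; omega

theorem runs_dup (t : BTree) (m r : List CircuitSymbol) :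
    Runs dup (std (t.tok ++ m) r) (50 * t.tok.length) (std (t.tok ++ (t.tok ++ m)) r) := by
  have h₁ := runs_moveTree_main_auxA t m r [] [] []
  have h₂ := runs_pourTwo (A := .auxA) (B := .main) (C := .auxB) (by decide) (by decide)
    (by decide) (mem m r (t.tok.reverse ++ []) [] [] [])
  simp at h₂
  have h₃ := runs_pour (A := .auxB) (B := .auxA) (by decide) (mem (t.tok ++ m) r [] t.tok [] [])
  simp at h₃
  have h₄ := runs_pour (A := .auxA) (B := .main) (by decide)
    (mem (t.tok ++ m) r t.tok.reverse [] [] [])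
  simp at h₄
  rw [List.append_nil] at *
  refine (h₁.seq (h₂.seq (h₃.seq h₄))).mono ?_
  have := t.tok_length_pos
  omega

theorem runs_swap (t u : BTree) (m r : List CircuitSymbol) :
    Runs swap (std (t.tok ++ (u.tok ++ m)) r) (40 * (t.tok.length + u.tok.length))
      (std (u.tok ++ (t.tok ++ m)) r) := by
  have h₁ := runs_moveTree_main_auxA t (u.tok ++ m) r [] [] []
  have h₂ := runs_moveTree (A := .main) (B := .auxB) (by decide) (by decide) (by decide) u
    (mem (u.tok ++ m) r (t.tok.reverse ++ []) [] [] []) m rfl rfl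
  simp at h₂
  have h₃ := runs_pour (A := .auxA) (B := .main) (by decide)
    (mem m r t.tok.reverse u.tok.reverse [] [])
  simp at h₃
  have h₄ := runs_pour (A := .auxB) (B := .main) (by decide)
    (mem (t.tok ++ m) r [] u.tok.reverse [] [])
  simp at h₄
  rw [List.append_nil] at *
  refine (h₁.seq (h₂.seq (h₃.seq h₄))).mono ?_
  have := t.tok_length_pos
  have := u.tok_length_pos
  omega

theorem runs_toRet (t : BTree) (m r : List CircuitSymbol) :
    Runs toRet (std (t.tok ++ m) r) (30 * t.tok.length) (std m (t.tok ++ r)) := by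
  have h₁ := runs_moveTree_main_auxA t m r [] [] []
  have h₂ := runs_pour (A := .auxA) (B := .ret) (by decide) (mem m r t.tok.reverse [] [] [])
  simp at h₂
  rw [List.append_nil] at *
  refine (h₁.seq h₂).mono ?_
  have := t.tok_length_pos
  omega

theorem runs_fromRet (t : BTree) (m r : List CircuitSymbol) :
    Runs fromRet (std m (t.tok ++ r)) (30 * t.tok.length) (std (t.tok ++ m) r) := by
  have h₁ := runs_moveTree (A := .ret) (B := .auxA) (by decide) (by decide) (by decide) t
    (mem m (t.tok ++ r) [] [] [] []) r rfl rfl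
  have h₂ := runs_pour (A := .auxA) (B := .main) (by decide) (mem m r t.tok.reverse [] [] [])
  simp at h₁ h₂
  refine (h₁.seq h₂).mono ?_
  have := t.tok_length_pos
  omega

end Prog

/-! ### Functions computable in polynomial time -/

/-- Types of finite data, coded by trees. -/
class Code (α : Type) where
  /-- The tree that codes a datum. -/
  code : α → BTree

namespace Code

instance : Code Unit := ⟨fun _ => .nil⟩

instance : Code Bool := ⟨fun b => if b then .node .nil .nil else .nil⟩

instance {α β : Type} [Code α] [Code β] : Code (α × β) := ⟨fun x => .node (code x.1) (code x.2)⟩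

instance {α : Type} [Code α] : Code (List α) := ⟨fun l => l.foldr (fun a t => .node (code a) t) .nil⟩

instance : Code ℕ := ⟨fun n => Nat.rec .nil (fun _ t => .node .nil t) n⟩

instance : Code CircuitSymbol :=
  ⟨fun a => match a with
    | .tick => .nil
    | .pos => .node .nil .nil
    | .neg => .node (.node .nil .nil) .nil⟩

/-- The word that codes a datum. -/
def tk {α : Type} [Code α] (a : α) : List CircuitSymbol := (code a).tok

/-- The length of the code of a datum. -/
def size {α : Type} [Code α] (a : α) : ℕ := (tk a).length

variable {α β : Type} [Code α] [Code β]

theorem size_pos (a : α) : 0 < size a := BTree.tok_length_pos _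

theorem tk_pair (x : α × β) : tk x = .pos :: (tk x.1 ++ tk x.2) := rfl

theorem tk_nil : tk ([] : List α) = [.tick] := rfl

theorem tk_cons (a : α) (l : List α) : tk (a :: l) = .pos :: (tk a ++ tk l) := rfl

theorem size_pair (a : α) (b : β) : size (a, b) = size a + size b + 1 := by
  simp [size, tk_pair]

@[simp] theorem size_nil : size ([] : List α) = 1 := rfl

theorem size_cons (a : α) (l : List α) : size (a :: l) = size a + size l + 1 := by
  simp [size, tk_cons]

theorem size_bool (b : Bool) : size b ≤ 3 := by cases b <;> decide

theorem size_nat (n : ℕ) : size n = 2 * n + 1 := by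
  induction n with
  | zero => rfl
  | succ n ih =>
    have : size (n + 1) = size () + size n + 1 := by
      simp [size, tk, code, BTree.tok]; omega
    rw [this, ih, show size () = 1 from rfl]; ring

theorem size_mem {a : α} {l : List α} (h : a ∈ l) : size a + 1 ≤ size l := by
  induction l with
  | nil => simp at h
  | cons b l ih =>
    rw [size_cons]
    rcases List.mem_cons.1 h with rfl | h
    · omega
    · have := ih h; omega

theorem length_lt_size (l : List α) : l.length < size l := by
  induction l with
  | nil => simp
  | cons b l ih => rw [size_cons, List.length_cons]; omega

theorem size_append (l l' : List α) : size (l ++ l') + 1 = size l + size l' := by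
  induction l with
  | nil => simp; omega
  | cons b l ih => rw [List.cons_append, size_cons, size_cons]; omega

end Code

open Code Prog

theorem Polynomial.eval_mono_nat (p : Polynomial ℕ) : Monotone fun n => p.eval n := by
  intro m n h
  simp only [Polynomial.eval_eq_sum_range]
  exact Finset.sum_le_sum fun i _ => Nat.mul_le_mul_left _ (Nat.pow_le_pow_left h i)

/-- `f` is computed by a program in polynomial time, on the top of the main stack. -/
def PolyTime {α β : Type} [Code α] [Code β] (f : α → β) : Prop :=
  -- The words `m` and `r` below the argument are arbitrary and preserved, so programs can run on
  -- top of saved data.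
  ∃ (P : Prog) (p : Polynomial ℕ), ∀ (a : α) (m r : List CircuitSymbol),
    Runs P (std (tk a ++ m) r) (p.eval (size a)) (std (tk (f a) ++ m) r)

/-! ### Basic functions, composition, case distinction and folds -/

namespace PolyTime

variable {α β γ δ σ : Type} [Code α] [Code β] [Code γ] [Code δ] [Code σ]

/-- A program cannot write more symbols than it makes steps. This is what keeps compositions
polynomial. -/
theorem size_le {f : α → β} (h : PolyTime f) :
    ∃ p : Polynomial ℕ, ∀ a, size (f a) ≤ p.eval (size a) := by
  obtain ⟨P, p, h⟩ := h
  refine ⟨.X + p, fun a => ?_⟩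
  obtain ⟨t, ht, v', h'⟩ := h a [] [] none
  have := h'.length_le .main
  simp only [std, mem_main, List.append_nil] at this
  simp only [Polynomial.eval_add, Polynomial.eval_X]
  unfold size at *
  omega

/-- Codes of different types may coincide: a number is coded like a list of units, a nonempty list
like a pair. Such changes of type need no computation; the program only pops the empty stack `cnt`.
-/
theorem of_code_eq {f : α → β} (h : ∀ a, code (f a) = code a) : PolyTime f := by
  refine ⟨.pop .cnt, 1, fun a m r v => ⟨1, by simp, none, ?_⟩⟩
  have := Exec.pop .cnt v (std (tk a ++ m) r)
  have e : tk (f a) = tk a := congrArg BTree.tok (h a)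
  simpa [e] using this

theorem id : PolyTime fun a : α => a := of_code_eq fun _ => rfl

theorem comp {g : β → γ} {f : α → β} (hg : PolyTime g) (hf : PolyTime f) :
    PolyTime fun a => g (f a) := by
  obtain ⟨s, hs⟩ := hf.size_le
  obtain ⟨P, p, hP⟩ := hf
  obtain ⟨Q, q, hQ⟩ := hg
  refine ⟨P ;; Q, 1 + p + q.comp s, fun a m r => ((hP a m r).seq (hQ (f a) m r)).mono ?_⟩
  simp only [Polynomial.eval_add, Polynomial.eval_one, Polynomial.eval_comp]
  have := q.eval_mono_nat (hs a)
  dsimp only at this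
  omega

/-- `g` is evaluated on a copy of the argument, then `f` on the original after an exchange; the mark
`.pos` joins the two results to a pair. -/
theorem pair {f : α → β} {g : α → γ} (hf : PolyTime f) (hg : PolyTime g) :
    PolyTime fun a => (f a, g a) := by
  obtain ⟨s, hs⟩ := hg.size_le
  obtain ⟨P, p, hP⟩ := hf
  obtain ⟨Q, q, hQ⟩ := hg
  refine ⟨dup ;; Q ;; swap ;; P ;; push .main .pos, 5 + 90 * .X + q + 40 * s + p,
    fun a m r => ?_⟩
  have h₁ : Runs dup (std (tk a ++ m) r) (50 * size a) (std (tk a ++ (tk a ++ m)) r) :=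
    runs_dup (code a) m r
  have h₂ := hQ a (tk a ++ m) r
  have h₃ := runs_swap (code (g a)) (code a) m r
  have h₄ := hP a (tk (g a) ++ m) r
  have h₅ := Runs.push .main .pos (std (tk (f a) ++ (tk (g a) ++ m)) r)
  have := (h₁.seq (h₂.seq (h₃.seq (h₄.seq h₅)))).mono (c := (5 + 90 * .X + q + 40 * s + p).eval
    (size a)) (by
      have := hs a
      simp only [Polynomial.eval_add, Polynomial.eval_mul, Polynomial.eval_ofNat,
        Polynomial.eval_X]
      unfold size tk at *
      omega)
  simpa [std, tk_pair] using this

/-- Push a word on the main stack. -/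
def pushes : List CircuitSymbol → Prog
  | [] => .pop .cnt
  | a :: l => pushes l ;; push .main a

theorem runs_pushes (l m r : List CircuitSymbol) :
    Runs (pushes l) (std m r) (1 + 2 * l.length) (std (l ++ m) r) := by
  induction l with
  | nil => exact fun v => ⟨1, by simp, _, by simpa [std, pushes] using Exec.pop .cnt v (std m r)⟩
  | cons a l ih =>
    have := (ih.seq (Runs.push .main a _)).mono (c := 1 + 2 * (a :: l).length) (by
      simp only [List.length_cons]; omega)
    simpa [std, pushes] using this

theorem const (b : β) : PolyTime fun _ : α => b := by
  refine ⟨drop ;; pushes (tk b), 30 * .X + (2 + 2 * .C (size b)), fun a m r => ?_⟩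
  refine ((runs_drop (code a) m r).seq (runs_pushes (tk b) m r)).mono ?_
  simp [size, tk]
  omega

theorem fst : PolyTime fun x : α × β => x.1 := by
  refine ⟨.pop .main ;; swap ;; drop, 70 * .X + 3, fun a m r => ?_⟩
  have h₁ : Runs (.pop .main) (std (tk a ++ m) r) 1 (std (tk a.1 ++ (tk a.2 ++ m)) r) := fun v =>
    ⟨1, le_rfl, _, by simpa [tk_pair] using Exec.pop .main v (std (tk a ++ m) r)⟩
  refine (h₁.seq ((runs_swap (code a.1) (code a.2) m r).seq
    (runs_drop (code a.2) (tk a.1 ++ m) r))).mono ?_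
  have := size_pair a.1 a.2
  simp [size, tk] at *
  omega

theorem snd : PolyTime fun x : α × β => x.2 := by
  refine ⟨.pop .main ;; drop, 70 * .X + 3, fun a m r => ?_⟩
  have h₁ : Runs (.pop .main) (std (tk a ++ m) r) 1 (std (tk a.1 ++ (tk a.2 ++ m)) r) := fun v =>
    ⟨1, le_rfl, _, by simpa [tk_pair] using Exec.pop .main v (std (tk a ++ m) r)⟩
  refine (h₁.seq (runs_drop (code a.1) (tk a.2 ++ m) r)).mono ?_
  have := size_pair a.1 a.2
  simp [size, tk] at *
  omega

theorem runs_branch {P Q : Prog} {m m' r r' : List CircuitSymbol} {a : CircuitSymbol} {b : ℕ}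
    (h : Runs (if a = .pos then P else Q) (std m r) b (std m' r')) :
    Runs (.pop .main ;; .ite (· == some .pos) P Q) (std (a :: m) r) (3 + b) (std m' r') := by
  intro v
  obtain ⟨t, ht, v', h'⟩ := h (some a)
  refine ⟨1 + 1 + (1 + t), by omega, v', ?_⟩
  have h₁ : Exec (.pop .main) v (std (a :: m) r) 1 (some a) (std m r) := by
    simpa using Exec.pop .main v (std (a :: m) r)
  refine h₁.seq ?_
  by_cases ha : a = .pos
  · rw [if_pos ha] at h'
    exact .ite_true (by simp [ha]) h'
  · rw [if_neg ha] at h'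
    exact .ite_false (by simpa using ha) h'

theorem runs_pop (a : CircuitSymbol) (m r : List CircuitSymbol) :
    Runs (.pop .main) (std (a :: m) r) 1 (std m r) := fun v =>
  ⟨1, le_rfl, _, by simpa using Exec.pop .main v (std (a :: m) r)⟩

theorem runs_push (a : CircuitSymbol) (m r : List CircuitSymbol) :
    Runs (.push .main a) (std m r) 1 (std (a :: m) r) := by
  simpa [std] using Runs.push .main a (std m r)

theorem ite {c : α → Bool} {f g : α → β} (hc : PolyTime c) (hf : PolyTime f) (hg : PolyTime g) :
    PolyTime fun a => if c a then f a else g a := by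
  obtain ⟨R, u, hR⟩ := hc
  obtain ⟨P, p, hP⟩ := hf
  obtain ⟨Q, q, hQ⟩ := hg
  -- The code of `true` is a node with two leaves, which are removed before `P`; the code of `false`
  -- is the single symbol already popped.
  refine ⟨dup ;; R ;; .pop .main ;; .ite (· == some .pos) (.pop .main ;; .pop .main ;; P) Q,
    50 * .X + u + p + q + 9, fun a m r => ?_⟩
  have h₁ : Runs dup (std (tk a ++ m) r) (50 * size a) (std (tk a ++ (tk a ++ m)) r) :=
    runs_dup (code a) m r
  have h₂ := hR a (tk a ++ m) r
  have h₃ : Runs (.pop .main ;; .ite (· == some .pos) (.pop .main ;; .pop .main ;; P) Q)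
      (std (tk (c a) ++ (tk a ++ m)) r) (3 + (4 + p.eval (size a) + q.eval (size a)))
      (std (tk (if c a then f a else g a) ++ m) r) := by
    cases hca : c a
    · refine runs_branch ?_
      simpa using (hQ a m r).mono (by omega)
    · refine runs_branch (a := .pos) ?_
      simpa [BTree.tok] using ((runs_pop .tick _ r).seq ((runs_pop .tick _ r).seq (hP a m r))).mono
        (by omega)
  refine (h₁.seq (h₂.seq h₃)).mono ?_
  simp [size, tk]
  omega

/-- A nonempty list has the code of the pair of its head and tail, so after the test the second
branch only has to restore the two marks that were popped. -/
theorem list_cases_aux {f : γ → δ} {g : (α × List α) × γ → δ} (hf : PolyTime f) (hg : PolyTime g) :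
    PolyTime fun x : List α × γ => List.casesOn (motive := fun _ => δ) x.1 (f x.2)
      (fun a l => g ((a, l), x.2)) := by
  obtain ⟨P, p, hP⟩ := hf
  obtain ⟨Q, q, hQ⟩ := hg
  refine ⟨.pop .main ;; .pop .main ;; .ite (· == some .pos)
    (push .main .pos ;; push .main .pos ;; Q) P, p + q.comp (.X + 1) + 20, fun a m r => ?_⟩
  obtain ⟨l, c⟩ := a
  have h₁ := runs_pop .pos (tk l ++ (tk c ++ m)) r
  cases l with
  | nil =>
    have h₂ := runs_branch (a := .tick) (P := push .main .pos ;; push .main .pos ;; Q) (Q := P)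
      (b := p.eval (size c)) (by simpa using hP c m r)
    have := (h₁.seq h₂).mono (c := (p + q.comp (.X + 1) + 20).eval (size (([] : List α), c))) (by
      have := p.eval_mono_nat (show size c ≤ size (([] : List α), c) by rw [size_pair]; omega)
      dsimp only at this
      simp; omega)
    simpa [tk_pair] using this
  | cons b l =>
    have h₂ := hQ ((b, l), c) m r
    simp only [tk_pair, List.cons_append, List.append_assoc] at h₂
    have h₃ := (runs_push .pos (tk b ++ (tk l ++ (tk c ++ m))) r).seq
      ((runs_push .pos (.pos :: (tk b ++ (tk l ++ (tk c ++ m)))) r).seq h₂)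
    have h₄ := runs_branch (a := .pos) (P := push .main .pos ;; push .main .pos ;; Q) (Q := P)
      (by rw [if_pos rfl]; exact h₃)
    rw [tk_cons, List.cons_append, List.append_assoc] at h₁
    have := (h₁.seq h₄).mono (c := (p + q.comp (.X + 1) + 20).eval (size (b :: l, c))) (by
      have e : size ((b, l), c) = size (b :: l, c) := by simp [size_pair, size_cons]
      have := q.eval_mono_nat (show size ((b, l), c) ≤ size (b :: l, c) + 1 by omega)
      dsimp only at this
      simp; omega)
    simpa [tk_pair, tk_cons] using this

/-- The loop of `fold`. -/
def foldBody (P : Prog) : Prog := fromRet ;; push .main .pos ;; P ;; .pop .ret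

/-- Fold the list on the top of the return stack. -/
def fold (P : Prog) : Prog := .pop .ret ;; .loop (· == some .pos) (foldBody P)

/-- Invariant: the state is on the main stack, the unread part of the list on the return stack,
except for its first symbol, which is in the register and tells whether an element follows. The time
bound `T` is demanded only at the states that actually occur. -/
theorem fold_loop {P : Prog} {h : β → σ → σ} (T : ℕ) (l : List β) :
    ∀ (s : σ) (m r : List CircuitSymbol), (∀ l₁ b l₂, l = l₁ ++ b :: l₂ → ∀ m r,
      Runs P (std (tk (b, l₁.foldl (fun s b => h b s) s) ++ m) r) T
        (std (tk (h b (l₁.foldl (fun s b => h b s) s)) ++ m) r)) →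
    ∃ v, ExecLe (.loop (· == some .pos) (foldBody P)) (tk l).head?
      (std (tk s ++ m) ((tk l).tail ++ r)) (1 + l.length * (T + 6) + 30 * size l) v
      (std (tk (l.foldl (fun s b => h b s) s) ++ m) r) := by
  induction l with
  | nil => exact fun s m r _ => ⟨_, (ExecLe.loop_false (by rfl)).mono (by simp)⟩
  | cons b l ih =>
    intro s m r hP
    obtain ⟨v, hv⟩ := ih (h b s) m r fun l₁ b' l₂ e => hP (b :: l₁) b' l₂ (by simp [e])
    refine ⟨v, ?_⟩
    have h₁ := runs_fromRet (code b) (tk s ++ m) (tk l ++ r)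
    have h₂ := Runs.push .main .pos (std (tk b ++ (tk s ++ m)) (tk l ++ r))
    have h₃ := hP [] b l rfl m (tk l ++ r)
    simp only [tk_pair, List.foldl_nil] at h₃
    obtain ⟨t₁, ht₁, v₁, e₁⟩ := h₁ (tk (b :: l)).head?
    obtain ⟨t₂, ht₂, v₂, e₂⟩ := h₂ v₁
    obtain ⟨t₃, ht₃, v₃, e₃⟩ := h₃ v₂
    have e₄ := Exec.pop .ret v₃ (std (tk (h b s) ++ m) (tk l ++ r))
    have e₂' : Exec (push .main .pos) v₁ (std (tk b ++ (tk s ++ m)) (tk l ++ r)) t₂ v₂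
        (std (.pos :: (tk b ++ tk s) ++ m) (tk l ++ r)) := by simpa using e₂
    have hl : ∃ a l', tk l = a :: l' := by
      cases l with
      | nil => exact ⟨_, _, rfl⟩
      | cons _ _ => exact ⟨_, _, rfl⟩
    obtain ⟨a, l', hl⟩ := hl
    have e₄' : Exec (.pop .ret) v₃ (std (tk (h b s) ++ m) (tk l ++ r)) 1 (tk l).head?
        (std (tk (h b s) ++ m) ((tk l).tail ++ r)) := by simpa [hl] using e₄
    have e₅ := e₁.seq (e₂'.seq (e₃.seq e₄'))
    have h₅ : ExecLe (foldBody P) (tk (b :: l)).head? (std (tk s ++ m) ((tk (b :: l)).tail ++ r))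
        (5 + T + 30 * size b) (tk l).head? (std (tk (h b s) ++ m) ((tk l).tail ++ r)) := by
      rw [tk_cons, List.tail_cons, List.append_assoc]
      refine ⟨_, ?_, e₅⟩
      unfold size
      unfold tk at *
      omega
    refine (h₅.loop_true (by rfl) hv).mono ?_
    rw [size_cons, List.length_cons]
    ring_nf
    omega

/-- Folding a polynomial-time step can produce exponentially large states, hence the hypothesis on
sizes. It concerns prefixes of the list, that is, exactly the intermediate states. -/
theorem foldl_aux {h : β × σ → σ} (hh : PolyTime h) {α : Type} [Code α] {f : α → σ × List β}
    (hf : PolyTime f) (hB : ∃ p : Polynomial ℕ, ∀ a, ∀ l, l <+: (f a).2 →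
      size (l.foldl (fun s b => h (b, s)) (f a).1) ≤ p.eval (size a)) :
    PolyTime fun a => (f a).2.foldl (fun s b => h (b, s)) (f a).1 := by
  obtain ⟨B, hB⟩ := hB
  obtain ⟨q, hq⟩ := hf.size_le
  obtain ⟨P, p, hP⟩ := hh
  obtain ⟨Q, u, hQ⟩ := hf
  refine ⟨Q ;; .pop .main ;; swap ;; toRet ;; fold P,
    u + 10 + 40 * q + 30 * q + (q * (p.comp (q + B + 1) + 6) + 30 * q), fun a m r => ?_⟩
  have h₁ := hQ a m r
  have h₂ := runs_pop .pos (tk (f a).1 ++ (tk (f a).2 ++ m)) r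
  have h₃ := runs_swap (code (f a).1) (code (f a).2) m r
  have h₄ := runs_toRet (code (f a).2) (tk (f a).1 ++ m) r
  have hs : size (f a) = size (f a).1 + size (f a).2 + 1 := size_pair _ _
  have hs' := hq a
  have h₅ := fold_loop (P := P) (h := fun b s => h (b, s)) (p.eval (q.eval (size a) +
    B.eval (size a) + 1)) (f a).2 (f a).1 m r fun l₁ b l₂ e m r => by
      refine (hP (b, _) m r).mono (p.eval_mono_nat ?_)
      rw [size_pair]
      have h₆ := hB a l₁ ⟨_, e.symm⟩
      have h₇ : size b + 1 ≤ size (f a).2 := size_mem (by rw [e]; simp)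
      omega
  obtain ⟨v, t, ht, h₅⟩ := h₅
  have hl : ∃ x l', tk (f a).2 = x :: l' := by
    cases (f a).2 with
    | nil => exact ⟨_, _, rfl⟩
    | cons _ _ => exact ⟨_, _, rfl⟩
  obtain ⟨x, l', hl⟩ := hl
  have h₆ : Runs (fold P) (std (tk (f a).1 ++ m) (tk (f a).2 ++ r)) (2 + t)
      (std (tk ((f a).2.foldl (fun s b => h (b, s)) (f a).1) ++ m) r) := fun w => by
    refine ⟨1 + 1 + t, by omega, v, .seq (.pop .ret _ _) ?_⟩
    simpa [hl] using h₅
  rw [tk_pair, List.cons_append, List.append_assoc] at h₁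
  refine (h₁.seq (h₂.seq (h₃.seq (h₄.seq h₆)))).mono ?_
  have h₇ := length_lt_size (f a).2
  have h₈ : (f a).2.length * (p.eval (q.eval (size a) + B.eval (size a) + 1) + 6) ≤
      q.eval (size a) * (p.eval (q.eval (size a) + B.eval (size a) + 1) + 6) :=
    Nat.mul_le_mul_right _ (by omega)
  simp only [Polynomial.eval_add, Polynomial.eval_mul, Polynomial.eval_comp,
    Polynomial.eval_ofNat, Polynomial.eval_one]
  have h₉ : (code (f a).1).tok.length = size (f a).1 := rfl
  have h₁₀ : (code (f a).2).tok.length = size (f a).2 := rfl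
  omega

end PolyTime

open Code Prog

namespace PolyTime

variable {α β γ δ σ : Type} [Code α] [Code β] [Code γ] [Code δ] [Code σ]

/-! ### Closure properties of the functions computable in polynomial time -/

theorem congr {f g : α → β} (hf : PolyTime f) (h : ∀ a, f a = g a) : PolyTime g :=
  (funext h : f = g) ▸ hf

theorem fst' {f : α → β × γ} (hf : PolyTime f) : PolyTime fun a => (f a).1 := fst.comp hf

theorem snd' {f : α → β × γ} (hf : PolyTime f) : PolyTime fun a => (f a).2 := snd.comp hf

theorem size_le₂ {g : α → β → γ} (hg : PolyTime fun x : α × β => g x.1 x.2) {f : α → List β}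
    (hf : PolyTime f) :
    ∃ p : Polynomial ℕ, ∀ a, ∀ b ∈ f a, size (g a b) ≤ p.eval (size a) := by
  obtain ⟨p, hp⟩ := hg.size_le
  obtain ⟨q, hq⟩ := hf.size_le
  refine ⟨p.comp (.X + q + 1), fun a b hb => (hp (a, b)).trans ?_⟩
  simp only [Polynomial.eval_comp, Polynomial.eval_add, Polynomial.eval_X, Polynomial.eval_one]
  refine p.eval_mono_nat ?_
  have := hq a
  have := size_mem hb
  rw [size_pair]
  omega

/-- The step function of `foldl_aux` has no parameter; here the input is carried along as a constant
component of the state. -/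
theorem foldl {f : α → List β} {g : α → σ} {h : α → σ → β → σ} (hf : PolyTime f) (hg : PolyTime g)
    (hh : PolyTime fun x : (α × σ) × β => h x.1.1 x.1.2 x.2)
    (hB : ∃ p : Polynomial ℕ, ∀ a, ∀ l, l <+: f a → size (l.foldl (h a) (g a)) ≤ p.eval (size a)) :
    PolyTime fun a => (f a).foldl (h a) (g a) := by
  have key : ∀ a (l : List β) s, l.foldl (fun (s : α × σ) b => (s.1, h s.1 s.2 b)) (a, s) =
      (a, l.foldl (h a) s) := by
    intro a l
    induction l with
    | nil => simp
    | cons b l ih => intro s; simp [ih]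
  have h₁ : PolyTime fun x : β × α × σ => (x.2.1, h x.2.1 x.2.2 x.1) :=
    (snd.fst').pair (hh.comp (snd.pair fst))
  have h₂ := foldl_aux h₁ ((id.pair hg).pair hf) (by
    obtain ⟨p, hp⟩ := hB
    refine ⟨.X + p + 1, fun a l hl => ?_⟩
    dsimp only
    rw [key, size_pair]
    have := hp a l hl
    simpa using by omega)
  refine h₂.snd'.congr fun a => ?_
  dsimp only
  rw [key]

/-- If each step adds at most a polynomial in the size of the input, the states remain polynomial,
because the number of steps is polynomial too. -/
theorem foldl_of_growth {f : α → List β} {g : α → σ} {h : α → σ → β → σ} (hf : PolyTime f)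
    (hg : PolyTime g) (hh : PolyTime fun x : (α × σ) × β => h x.1.1 x.1.2 x.2)
    (hB : ∃ p : Polynomial ℕ, ∀ a s, ∀ b ∈ f a, size (h a s b) ≤ size s + p.eval (size a)) :
    PolyTime fun a => (f a).foldl (h a) (g a) := by
  obtain ⟨p, hp⟩ := hB
  obtain ⟨q, hq⟩ := hf.size_le
  obtain ⟨u, hu⟩ := hg.size_le
  refine hf.foldl hg hh ⟨u + q * p, fun a l hl => ?_⟩
  have key : ∀ (l : List β) s, (∀ b ∈ l, b ∈ f a) →
      size (l.foldl (h a) s) ≤ size s + l.length * p.eval (size a) := by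
    intro l
    induction l with
    | nil => simp
    | cons b l ih =>
      intro s hl
      have h₁ := ih (h a s b) fun b hb => hl b (List.mem_cons_of_mem _ hb)
      have h₂ := hp a s b (hl b (List.mem_cons_self ..))
      rw [List.foldl_cons, List.length_cons, add_mul]
      omega
  refine (key l (g a) fun b hb => hl.subset hb).trans ?_
  have h₁ : l.length ≤ q.eval (size a) :=
    (hl.length_le.trans (length_lt_size _).le).trans (hq a)
  have h₂ := Nat.mul_le_mul_right (p.eval (size a)) h₁
  have h₃ := hu a
  simp only [Polynomial.eval_add, Polynomial.eval_mul]
  omega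

theorem ite' {c : α → Prop} [DecidablePred c] {f g : α → β} (hc : PolyTime fun a => decide (c a))
    (hf : PolyTime f) (hg : PolyTime g) : PolyTime fun a => if c a then f a else g a :=
  (ite hc hf hg).congr fun a => by by_cases h : c a <;> simp [h]

/-! Booleans -/

theorem not {f : α → Bool} (hf : PolyTime f) : PolyTime fun a => !f a :=
  (ite hf (const false) (const true)).congr fun a => by cases f a <;> rfl

theorem and {f g : α → Bool} (hf : PolyTime f) (hg : PolyTime g) : PolyTime fun a => f a && g a :=
  (ite hf hg (const false)).congr fun a => by cases f a <;> rfl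

/-! Lists -/

theorem cons {f : α → β} {g : α → List β} (hf : PolyTime f) (hg : PolyTime g) :
    PolyTime fun a => f a :: g a :=
  (of_code_eq (f := fun x : β × List β => x.1 :: x.2) fun _ => rfl).comp (hf.pair hg)

theorem isEmpty {f : α → List β} (hf : PolyTime f) : PolyTime fun a => (f a).isEmpty :=
  ((list_cases_aux (γ := Unit) (const true) (const false)).comp (hf.pair (const ()))).congr
    fun a => by dsimp only; cases f a <;> rfl

theorem headD {f : α → List β} {g : α → β} (hf : PolyTime f) (hg : PolyTime g) :
    PolyTime fun a => (f a).headD (g a) :=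
  ((list_cases_aux id fst.fst').comp (hf.pair hg)).congr fun a => by
    dsimp only; cases f a <;> rfl

theorem tail {f : α → List β} (hf : PolyTime f) : PolyTime fun a => (f a).tail :=
  ((list_cases_aux (γ := Unit) (const []) fst.snd').comp (hf.pair (const ()))).congr
    fun a => by dsimp only; cases f a <;> rfl

theorem reverse {f : α → List β} (hf : PolyTime f) : PolyTime fun a => (f a).reverse := by
  obtain ⟨q, hq⟩ := hf.size_le
  refine (foldl_of_growth (g := fun _ => []) (h := fun _ s b => b :: s) hf (const [])
    (snd.cons fst.snd') ⟨q, fun a s b hb => ?_⟩).congr fun a => by simp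
  have := size_mem hb
  have := hq a
  rw [size_cons]
  omega

theorem append {f g : α → List β} (hf : PolyTime f) (hg : PolyTime g) :
    PolyTime fun a => f a ++ g a := by
  obtain ⟨q, hq⟩ := hf.size_le
  refine (foldl_of_growth (h := fun _ s b => b :: s) hf.reverse hg (snd.cons fst.snd')
    ⟨q, fun a s b hb => ?_⟩).congr fun a => by simp
  have := size_mem (List.mem_reverse.1 hb)
  have := hq a
  rw [size_cons]
  omega

theorem flatMap {f : α → List β} {g : α → β → List γ} (hf : PolyTime f)
    (hg : PolyTime fun x : α × β => g x.1 x.2) : PolyTime fun a => (f a).flatMap (g a) := by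
  obtain ⟨p, hp⟩ := hg.size_le₂ hf
  refine (foldl_of_growth (g := fun _ => []) (h := fun a s b => s ++ g a b) hf (const [])
    (fst.snd'.append (hg.comp (fst.fst'.pair snd))) ⟨p, fun a s b hb => ?_⟩).congr fun a => ?_
  · have := hp a b hb
    have := size_append s (g a b)
    omega
  · have : ∀ (l : List β) s, l.foldl (fun s b => s ++ g a b) s = s ++ l.flatMap (g a) := by
      intro l
      induction l with
      | nil => simp
      | cons b l ih => intro s; simp [ih]
    simp [this]

theorem map {f : α → List β} {g : α → β → γ} (hf : PolyTime f)
    (hg : PolyTime fun x : α × β => g x.1 x.2) : PolyTime fun a => (f a).map (g a) :=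
  (hf.flatMap (g := fun a b => [g a b]) (hg.cons (const []))).congr fun a => by
    rw [List.map_eq_flatMap]

theorem filter {f : α → List β} {c : α → β → Bool} (hf : PolyTime f)
    (hc : PolyTime fun x : α × β => c x.1 x.2) : PolyTime fun a => (f a).filter (c a) :=
  (hf.flatMap (g := fun a b => if c a b then [b] else [])
    (ite hc (snd.cons (const [])) (const []))).congr fun a => by
      induction f a with
      | nil => rfl
      | cons b l ih => by_cases h : c a b <;> simp_all

/-! Natural numbers -/

theorem succ {f : α → ℕ} (hf : PolyTime f) : PolyTime fun a => f a + 1 :=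
  (of_code_eq (f := fun x : Unit × ℕ => x.2 + 1) fun _ => rfl).comp ((const ()).pair hf)

theorem code_replicate (n : ℕ) : code (List.replicate n ()) = code n := by
  induction n with
  | zero => rfl
  | succ n ih => exact congrArg (BTree.node .nil) ih

theorem units {f : α → ℕ} (hf : PolyTime f) : PolyTime fun a => List.replicate (f a) () :=
  (of_code_eq (f := fun n : ℕ => List.replicate n ()) code_replicate).comp hf

theorem length {f : α → List β} (hf : PolyTime f) : PolyTime fun a => (f a).length :=
  ((of_code_eq (f := fun l : List Unit => l.length) fun l => by
    rw [← code_replicate]; exact congrArg code (List.eq_replicate_iff.2 ⟨rfl, by simp⟩).symm).comp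
    (hf.map (g := fun _ _ => ()) (const ()))).congr fun a => by simp

theorem replicate {f : α → ℕ} {g : α → β} (hf : PolyTime f) (hg : PolyTime g) :
    PolyTime fun a => List.replicate (f a) (g a) :=
  (hf.units.map (g := fun a _ => g a) (hg.comp fst)).congr fun a => by simp

/-- Iteration is a fold over a list of units, that is, over a number in unary. -/
theorem iterate {n : α → ℕ} {g : α → σ} {h : α → σ → σ} (hn : PolyTime n) (hg : PolyTime g)
    (hh : PolyTime fun x : α × σ => h x.1 x.2)
    (hB : ∃ p : Polynomial ℕ, ∀ a, ∀ i ≤ n a, size ((h a)^[i] (g a)) ≤ p.eval (size a)) :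
    PolyTime fun a => (h a)^[n a] (g a) := by
  have key : ∀ a (l : List Unit) s, l.foldl (fun s _ => h a s) s = (h a)^[l.length] s := by
    intro a l
    induction l with
    | nil => simp
    | cons b l ih => intro s; simp [ih]
  refine (foldl (h := fun a s _ => h a s) hn.units hg (hh.comp fst) ?_).congr fun a => by simp [key]
  obtain ⟨p, hp⟩ := hB
  refine ⟨p, fun a l hl => ?_⟩
  rw [key]
  exact hp a _ (by simpa using hl.length_le)

theorem pred {f : α → ℕ} (hf : PolyTime f) : PolyTime fun a => f a - 1 :=
  hf.units.tail.length.congr fun a => by simp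

theorem add {f g : α → ℕ} (hf : PolyTime f) (hg : PolyTime g) : PolyTime fun a => f a + g a :=
  (hf.units.append hg.units).length.congr fun a => by simp

theorem mul {f g : α → ℕ} (hf : PolyTime f) (hg : PolyTime g) : PolyTime fun a => f a * g a :=
  (hf.units.flatMap (g := fun a _ => List.replicate (g a) ()) (hg.units.comp fst)).length.congr
    fun a => by simp

theorem sub {f g : α → ℕ} (hf : PolyTime f) (hg : PolyTime g) : PolyTime fun a => f a - g a := by
  obtain ⟨p, hp⟩ := hf.size_le
  have key : ∀ k m : ℕ, (fun n => n - 1)^[k] m = m - k := by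
    intro k
    induction k with
    | zero => simp
    | succ k ih => intro m; rw [Function.iterate_succ_apply, ih]; omega
  refine (iterate (h := fun _ n => n - 1) hg hf snd.pred ⟨p, fun a i _ => ?_⟩).congr fun a => key _ _
  have := hp a
  rw [key, size_nat]
  rw [size_nat] at this
  omega

theorem natEq {f g : α → ℕ} (hf : PolyTime f) (hg : PolyTime g) :
    PolyTime fun a => decide (f a = g a) :=
  ((hf.sub hg).add (hg.sub hf)).units.isEmpty.congr fun a => by
    by_cases h : f a = g a
    · simp [h]
    · have : f a - g a + (g a - f a) ≠ 0 := by omega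
      simp [h]; omega

theorem range {f : α → ℕ} (hf : PolyTime f) : PolyTime fun a => List.range (f a) := by
  have key : ∀ k, (fun s : ℕ × List ℕ => (s.1 + 1, s.2 ++ [s.1]))^[k] (0, []) =
      (k, List.range k) := by
    intro k
    induction k with
    | zero => rfl
    | succ k ih => rw [Function.iterate_succ_apply', ih, List.range_succ]
  have hs : ∀ k n, k ≤ n → size (List.range k) ≤ 1 + (2 * n + 2) * k := by
    intro k n
    induction k with
    | zero => simp
    | succ k ih =>
      intro h
      have h₁ := ih (by omega)
      have h₂ := size_append (List.range k) [k]
      rw [List.range_succ]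
      rw [size_cons, size_nat, size_nil] at h₂
      rw [mul_add]
      omega
  obtain ⟨p, hp⟩ := hf.size_le
  refine (iterate (h := fun _ s => (s.1 + 1, s.2 ++ [s.1])) hf
    (const ((0 : ℕ), ([] : List ℕ))) (snd.fst'.succ.pair (snd.snd'.append (snd.fst'.cons (const []))))
    ⟨p + 1 + (1 + (2 * p + 2) * p), fun a i hi => ?_⟩).snd'.congr fun a => by rw [key]
  have h₁ := hp a
  rw [size_nat] at h₁
  rw [key, size_pair, size_nat]
  have h₂ := hs i (p.eval (size a)) (by omega)
  have h₃ : (2 * p.eval (size a) + 2) * i ≤ (2 * p.eval (size a) + 2) * p.eval (size a) :=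
    Nat.mul_le_mul_left _ (by omega)
  simp only [Polynomial.eval_add, Polynomial.eval_mul, Polynomial.eval_ofNat, Polynomial.eval_one]
  omega

end PolyTime

open Code Prog

namespace Prog

/-! ### Input and output -/

/-- Push the code of the symbol in the register, as the head of a list, on the main stack. -/
def readSymbol : Prog :=
  .ite (· == some .tick) (PolyTime.pushes (.pos :: tk CircuitSymbol.tick))
    (.ite (· == some .pos) (PolyTime.pushes (.pos :: tk CircuitSymbol.pos))
      (PolyTime.pushes (.pos :: tk CircuitSymbol.neg)))

/-- Turn the input into the code of a list on the main stack, in reversed order. -/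
def readInput : Prog := push .main .tick ;; drain .ret readSymbol

theorem loopFree_pushes (l : List CircuitSymbol) : LoopFree (PolyTime.pushes l) := by
  induction l with
  | nil => trivial
  | cons a l ih => exact ⟨ih, trivial⟩

theorem runs_readInput (w : List CircuitSymbol) :
    Runs readInput (std [] w) (100 * (w.length + 1)) (std (tk w.reverse) []) := by
  have h₁ := Runs.push .main .tick (std [] w)
  have h₂ := runs_drain (A := .ret) (Q := readSymbol)
    ⟨loopFree_pushes _, loopFree_pushes _, loopFree_pushes _⟩
    -- `pushes` contains a pop of the empty stack `cnt`, which shows up as a tail.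
    (fun a S => Function.update (Function.update S .cnt (S .cnt).tail) .main
      (.pos :: (tk a ++ S .main)))
    (fun a S => by
      cases a <;> simp [readSymbol, eval, PolyTime.pushes, tk, code, BTree.tok] <;> rfl)
    (fun a S => by simp) (fun a S l => by
      funext k; cases k <;> simp) (std [.tick] w)
  have h₃ : ∀ (w : List CircuitSymbol) (l : List CircuitSymbol),
      w.foldl (fun (S : Mem) a => Function.update (Function.update S .cnt (S .cnt).tail) .main
        (.pos :: (tk a ++ S .main))) (mem (tk l) w [] [] [] []) =
          mem (tk (w.reverse ++ l)) w [] [] [] [] := by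
    suffices ∀ (w r : List CircuitSymbol) (l : List CircuitSymbol),
        w.foldl (fun (S : Mem) a => Function.update (Function.update S .cnt (S .cnt).tail) .main
          (.pos :: (tk a ++ S .main))) (mem (tk l) r [] [] [] []) =
            mem (tk (w.reverse ++ l)) r [] [] [] [] from fun w => this w w
    intro w r
    induction w with
    | nil => simp
    | cons a w ih =>
      intro l
      have := ih (a :: l)
      simpa [tk_cons] using this
  have h₄ : cost readSymbol ≤ 60 := by
    simp [readSymbol, cost, PolyTime.pushes, tk, code, BTree.tok]
  have h₅ := h₃ w []
  simp only [mem_ret] at h₂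
  rw [← tk_nil (α := CircuitSymbol), h₅, update_mem_ret, List.append_nil] at h₂
  simp only [mem_main, update_mem_main] at h₁
  refine (h₁.seq h₂).mono ?_
  have := Nat.mul_le_mul_right w.length (Nat.add_le_add_right h₄ 3)
  omega

/-- Move the head of the list on the main stack to the output. -/
def writeSymbol : Prog :=
  pop .main ;; .ite (· == some .tick) (push .out .tick)
    (pop .main ;; .ite (· == some .tick) (pop .main ;; push .out .pos)
      (pop .main ;; pop .main ;; pop .main ;; push .out .neg)) ;; pop .main

/-- Move the list on the main stack to the output, in reversed order. -/
def writeOutput : Prog := pop .main ;; .loop (· == some .pos) writeSymbol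

theorem writeOutput_loop (l : List CircuitSymbol) : ∀ (o : List CircuitSymbol),
    ExecLe (.loop (· == some .pos) writeSymbol) (tk l).head? (mem (tk l).tail [] [] [] [] o)
      (1 + 40 * l.length) (some .tick) (mem [] [] [] [] [] (l.reverse ++ o)) := by
  induction l with
  | nil => exact fun o => ExecLe.loop_false (by rfl)
  | cons a l ih =>
    intro o
    have h₁ : eval writeSymbol (some .pos, mem (tk a ++ tk l) [] [] [] [] o) =
        ((tk l).head?, mem (tk l).tail [] [] [] [] (a :: o)) := by
      have e : (CircuitSymbol.pos == CircuitSymbol.tick) = false := by decide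
      generalize tk l = L
      cases a <;> simp [writeSymbol, eval, tk, code, BTree.tok, e]
    have h₂ : LoopFree writeSymbol := by simp [writeSymbol, LoopFree]
    have h₃ := h₂.loop_execLe (c := (· == some .pos)) (by rfl) h₁ (ih (a :: o))
    have h₄ : cost writeSymbol ≤ 30 := by simp [writeSymbol, cost]
    refine (h₃.mono ?_).cast rfl (by simp)
    rw [List.length_cons]
    omega

theorem runs_writeOutput (l : List CircuitSymbol) :
    Runs writeOutput (std (tk l) []) (3 + 40 * l.length) (mem [] [] [] [] [] l.reverse) := fun v => by
  obtain ⟨t, ht, h⟩ := writeOutput_loop l []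
  have h₁ := Exec.pop .main v (std (tk l) [])
  simp only [mem_main, update_mem_main] at h₁
  exact ⟨1 + 1 + t, by omega, _, by simpa [writeOutput] using h₁.seq h⟩

end Prog

/-- A function on words computable in polynomial time is computed by a machine in polynomial
time. -/
theorem PolyTime.computableInPolyTime {α β : Type} (ea : α → List CircuitSymbol)
    (eb : β → List CircuitSymbol) (f : α → β) {F : List CircuitSymbol → List CircuitSymbol}
    (hF : PolyTime F) (h : ∀ a, F (ea a) = eb (f a)) :
    Nonempty (Turing.TM2ComputableInPolyTime ea eb f) := by
  -- Input and output each reverse the word, so the program computes `F` conjugated by reversal.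
  have hG : PolyTime fun w : List CircuitSymbol => (F w.reverse).reverse :=
    (hF.comp id.reverse).reverse
  obtain ⟨q, hq⟩ := hG.size_le
  obtain ⟨P, p, hP⟩ := hG
  have hs : ∀ w : List CircuitSymbol, size w ≤ 10 * w.length + 10 := by
    intro w
    induction w with
    | nil => simp
    | cons a w ih =>
      have : size a ≤ 5 := by cases a <;> decide
      rw [size_cons, List.length_cons]; omega
  refine Prog.computableInPolyTime ea eb f (readInput ;; P ;; writeOutput)
    (100 * (.X + 1) + p.comp (10 * .X + 10) + 40 * q.comp (10 * .X + 10) + 10) fun a => ?_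
  have h₁ := runs_readInput (ea a)
  have h₂ := hP (ea a).reverse [] []
  have h₃ := runs_writeOutput (F (ea a).reverse.reverse).reverse
  simp only [List.append_nil] at h₂
  have h₄ := h₁.seq (h₂.seq h₃)
  rw [List.reverse_reverse, List.reverse_reverse, h] at h₄
  have e₁ : (Function.update (fun _ => []) .ret (ea a) : Mem) = std [] (ea a) := by
    funext k; cases k <;> rfl
  have e₂ : (Function.update (fun _ => []) .out (eb (f a)) : Mem) =
      mem [] [] [] [] [] (eb (f a)) := by
    funext k; cases k <;> rfl
  rw [e₁, e₂]
  refine h₄.mono ?_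
  have h₅ := hs (ea a).reverse
  rw [List.length_reverse] at h₅
  have h₆ := p.eval_mono_nat h₅
  have h₇ := (hq (ea a).reverse).trans (q.eval_mono_nat h₅)
  have h₈ := length_lt_size (F (ea a).reverse.reverse).reverse
  rw [List.reverse_reverse, h] at h₇ h₈
  dsimp only at h₆ h₇
  simp only [Polynomial.eval_add, Polynomial.eval_mul, Polynomial.eval_comp,
    Polynomial.eval_ofNat, Polynomial.eval_one, Polynomial.eval_X]
  omega

/-! ### The braid group -/

section BraidGroup

variable {n : ℕ}

/-- The generator `σᵢ` of the braid group. -/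
def braidGen (i : Fin (n - 1)) : BraidGroup n := toBraid [(i, true)]

theorem toBraid_append (u v : BraidWord n) : toBraid (u ++ v) = toBraid u * toBraid v := by
  unfold toBraid
  rw [← map_mul, FreeGroup.mul_mk]

theorem toBraid_nil : toBraid ([] : BraidWord n) = 1 := by
  unfold toBraid
  rw [← FreeGroup.one_eq_mk, map_one]

theorem toBraid_singleton (i : Fin (n - 1)) (b : Bool) :
    toBraid [(i, b)] = if b then braidGen i else (braidGen i)⁻¹ := by
  cases b
  · simp only [braidGen, toBraid]
    rfl
  · rfl

theorem toBraid_cons (x : Fin (n - 1) × Bool) (u : BraidWord n) :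
    toBraid (x :: u) = (if x.2 then braidGen x.1 else (braidGen x.1)⁻¹) * toBraid u := by
  rw [← toBraid_singleton, ← toBraid_append]
  rfl

theorem toBraid_eq_of_relation {u v : BraidWord n} (h : BraidRelation n u v) :
    toBraid u = toBraid v := by
  have : PresentedGroup.mk {x : FreeGroup (Fin (n - 1)) |
      ∃ r ∈ braidRelations n, x = FreeGroup.mk r.1 * (FreeGroup.mk r.2)⁻¹}
      (FreeGroup.mk u * (FreeGroup.mk v)⁻¹) = 1 :=
    PresentedGroup.one_of_mem ⟨(u, v), h, rfl⟩
  rwa [map_mul, map_inv, mul_inv_eq_one] at this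

theorem braidGen_comm {i j : Fin (n - 1)} (h : i.val + 2 ≤ j.val ∨ j.val + 2 ≤ i.val) :
    braidGen i * braidGen j = braidGen j * braidGen i := by
  have := toBraid_eq_of_relation (.comm i j h)
  simpa [toBraid_cons, toBraid_nil] using this

theorem braidGen_braid {i j : Fin (n - 1)} (h : j.val = i.val + 1) :
    braidGen i * (braidGen j * braidGen i) = braidGen j * (braidGen i * braidGen j) := by
  have := toBraid_eq_of_relation (.braid i j h)
  simpa [toBraid_cons, toBraid_nil] using this

theorem toBraid_eq_of_differByRelations {u v : BraidWord n}
    (h : DifferByRelations (braidRelations n) u v) : toBraid u = toBraid v := by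
  induction h with
  | rel _ _ h =>
    obtain ⟨r, hr, a, b, rfl, rfl⟩ := h
    rw [toBraid_append, toBraid_append, toBraid_append, toBraid_append, toBraid_eq_of_relation hr]
  | refl => rfl
  | symm _ _ _ ih => exact ih.symm
  | trans _ _ _ _ _ ih₁ ih₂ => exact ih₁.trans ih₂

theorem evalCircuit_cons {ι : Type} {M : Type*} [Monoid M] [Inv M] (g : ι → M) (x : ι × Bool)
    (C : Circuit ι) :
    evalCircuit g (x :: C) = (if x.2 then g x.1 else (g x.1)⁻¹) * evalCircuit g C := by
  simp [evalCircuit]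

/-- A representation of the braid group. -/
theorem exists_braidGroup_hom {H : Type*} [Group H] {g : Fin (n - 1) → H}
    (h : SatisfiesBraidRelations g) :
    ∃ φ : BraidGroup n →* H, ∀ w, φ (toBraid w) = evalCircuit g w := by
  have key : ∀ w : BraidWord n, FreeGroup.lift g (FreeGroup.mk w) = evalCircuit g w := by
    intro w
    rw [FreeGroup.lift_mk]
    simp only [evalCircuit]
    congr 1
    refine List.map_congr_left fun x _ => ?_
    obtain ⟨i, b⟩ := x
    cases b <;> rfl
  refine ⟨PresentedGroup.toGroup (f := g) ?_, fun w => ?_⟩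
  · rintro _ ⟨⟨u, v⟩, hr, rfl⟩
    change BraidRelation n u v at hr
    rw [map_mul, map_inv, mul_inv_eq_one, key, key]
    cases hr with
    | comm i j h' => simpa [evalCircuit] using h.1 i j h'
    | braid i j h' => simpa [evalCircuit, mul_assoc] using h.2 i j h'
    | cancel i b => cases b <;> simp [evalCircuit]
  · exact key w

/-! ### Permutations and inversions -/

/-- The strand position `i`. -/
def lo (i : Fin (n - 1)) : Fin n := ⟨i.val, by omega⟩

/-- The strand position `i + 1`. -/
def hi (i : Fin (n - 1)) : Fin n := ⟨i.val + 1, by omega⟩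

/-- The transposition of the positions `i` and `i + 1`. -/
def adj (i : Fin (n - 1)) : Equiv.Perm (Fin n) := Equiv.swap (lo i) (hi i)

theorem lo_lt_hi (i : Fin (n - 1)) : lo i < hi i := by simp [lo, hi, Fin.lt_def]

@[simp] theorem adj_lo (i : Fin (n - 1)) : adj i (lo i) = hi i := Equiv.swap_apply_left _ _

@[simp] theorem adj_hi (i : Fin (n - 1)) : adj i (hi i) = lo i := Equiv.swap_apply_right _ _

theorem adj_of_ne {i : Fin (n - 1)} {x : Fin n} (h : x ≠ lo i) (h' : x ≠ hi i) : adj i x = x :=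
  Equiv.swap_apply_of_ne_of_ne h h'

@[simp] theorem adj_inv (i : Fin (n - 1)) : (adj i)⁻¹ = adj i := Equiv.swap_inv _ _

@[simp] theorem adj_adj (i : Fin (n - 1)) (x : Fin n) : adj i (adj i x) = x :=
  Equiv.swap_apply_self _ _ _ |> fun h => h

@[simp] theorem adj_mul_self (i : Fin (n - 1)) : adj i * adj i = 1 := Equiv.swap_mul_self _ _

@[simp] theorem adj_mul_cancel (i : Fin (n - 1)) (f : Equiv.Perm (Fin n)) :
    adj i * (adj i * f) = f := by rw [← mul_assoc, adj_mul_self, one_mul]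

theorem adj_val (i : Fin (n - 1)) (x : Fin n) : (adj i x).val =
    if x.val = i.val then i.val + 1 else if x.val = i.val + 1 then i.val else x.val := by
  by_cases h : x = lo i
  · subst h; rw [adj_lo]; simp [lo, hi]
  · by_cases h' : x = hi i
    · subst h'; rw [adj_hi]; simp [lo, hi]
    · rw [adj_of_ne h h', if_neg, if_neg]
      · exact fun e => h' (Fin.ext e)
      · exact fun e => h (Fin.ext e)

/-- An adjacent transposition reverses the order of no other pair. -/
theorem adj_lt_adj {i : Fin (n - 1)} {x y : Fin n} (h : x < y) (h' : ¬(x = lo i ∧ y = hi i)) :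
    adj i x < adj i y := by
  rw [Fin.lt_def, adj_val, adj_val]
  have : ¬(x.val = i.val ∧ y.val = i.val + 1) := fun e => h' ⟨Fin.ext e.1, Fin.ext e.2⟩
  rw [Fin.lt_def] at h
  split_ifs <;> omega

theorem permOfPositive_nil : permOfPositive ([] : List (Fin (n - 1))) = 1 := rfl

theorem permOfPositive_cons (i : Fin (n - 1)) (u : List (Fin (n - 1))) :
    permOfPositive (i :: u) = adj i * permOfPositive u := by
  simp [permOfPositive, adj, lo, hi]

theorem permOfPositive_append (u v : List (Fin (n - 1))) :
    permOfPositive (u ++ v) = permOfPositive u * permOfPositive v := by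
  simp [permOfPositive]

theorem permOfPositive_singleton (i : Fin (n - 1)) : permOfPositive [i] = adj i := by
  rw [permOfPositive_cons, permOfPositive_nil, mul_one]

theorem permOfPositive_reverse (u : List (Fin (n - 1))) :
    permOfPositive u.reverse = (permOfPositive u)⁻¹ := by
  induction u with
  | nil => rfl
  | cons i u ih =>
    rw [List.reverse_cons, permOfPositive_append, ih, permOfPositive_singleton,
      permOfPositive_cons, mul_inv_rev, adj_inv]

/-- Applying `adj i` to both positions carries the inversions of `f` to inversions of `f * adj i`,
and the only new one is the pair of the positions `i` and `i + 1`. -/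
theorem inversions_mul_adj {f : Equiv.Perm (Fin n)} {i : Fin (n - 1)} (h : f (lo i) < f (hi i)) :
    inversions (f * adj i) = inversions f + 1 := by
  unfold inversions
  have e : (Finset.univ.filter fun x : Fin n × Fin n =>
      x.1 < x.2 ∧ (f * adj i) x.2 < (f * adj i) x.1) = insert (lo i, hi i)
      ((Finset.univ.filter fun x : Fin n × Fin n => x.1 < x.2 ∧ f x.2 < f x.1).map
        ((adj i).prodCongr (adj i)).toEmbedding) := by
    ext ⟨a, b⟩
    rw [Finset.mem_filter, Finset.mem_insert, Finset.mem_map_equiv, Finset.mem_filter]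
    simp only [Finset.mem_univ, true_and, Equiv.Perm.coe_mul, Function.comp_apply, Prod.mk.injEq]
    have hs : ((adj i).prodCongr (adj i)).symm (a, b) = (adj i a, adj i b) := by
      have : (adj i).symm = adj i := adj_inv i
      simp [this]
    rw [hs]
    constructor
    · rintro ⟨h₁, h₂⟩
      by_cases h₃ : a = lo i ∧ b = hi i
      · exact .inl h₃
      · exact .inr ⟨adj_lt_adj h₁ h₃, h₂⟩
    · rintro (⟨rfl, rfl⟩ | ⟨h₁, h₂⟩)
      · exact ⟨lo_lt_hi i, by simpa using h⟩
      · refine ⟨?_, h₂⟩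
        have := adj_lt_adj (i := i) h₁ (fun h₃ => by
          rw [h₃.1, h₃.2] at h₂
          exact absurd h (not_lt.2 h₂.le))
        simpa using this
  rw [e, Finset.card_insert_of_notMem, Finset.card_map]
  simp only [Finset.mem_map_equiv, Finset.mem_filter, Finset.mem_univ, true_and]
  have hs : ((adj i).prodCongr (adj i)).symm (lo i, hi i) = (hi i, lo i) := by
    have : (adj i).symm = adj i := adj_inv i
    simp [this]
  rw [hs]
  exact fun h' => absurd h'.1 (not_lt.2 (lo_lt_hi i).le)

theorem inversions_inv (f : Equiv.Perm (Fin n)) : inversions f⁻¹ = inversions f := by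
  unfold inversions
  refine Finset.card_bij' (fun x _ => (f⁻¹ x.2, f⁻¹ x.1)) (fun x _ => (f x.2, f x.1)) ?_ ?_ ?_ ?_ <;>
    simp +contextual

/-- `i` is a left descent of `f`: the simple braid of `f` can be written with first letter `σᵢ`. -/
def LeftDescent (i : Fin (n - 1)) (f : Equiv.Perm (Fin n)) : Prop := f⁻¹ (hi i) < f⁻¹ (lo i)

instance (i : Fin (n - 1)) (f : Equiv.Perm (Fin n)) : Decidable (LeftDescent i f) :=
  inferInstanceAs (Decidable (_ < _))

theorem not_leftDescent_iff {i : Fin (n - 1)} {f : Equiv.Perm (Fin n)} :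
    ¬LeftDescent i f ↔ f⁻¹ (lo i) < f⁻¹ (hi i) := by
  have : f⁻¹ (lo i) ≠ f⁻¹ (hi i) := fun h => (lo_lt_hi i).ne (f⁻¹.injective h)
  unfold LeftDescent
  rw [not_lt]
  exact ⟨fun h => lt_of_le_of_ne h this, le_of_lt⟩

theorem leftDescent_adj_mul {i : Fin (n - 1)} {f : Equiv.Perm (Fin n)} :
    LeftDescent i (adj i * f) ↔ ¬LeftDescent i f := by
  rw [not_leftDescent_iff]
  simp [LeftDescent]

theorem inversions_adj_mul {f : Equiv.Perm (Fin n)} {i : Fin (n - 1)} (h : ¬LeftDescent i f) :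
    inversions (adj i * f) = inversions f + 1 := by
  have := inversions_mul_adj (not_leftDescent_iff.1 h)
  rw [← inversions_inv, mul_inv_rev, adj_inv, this, inversions_inv]

theorem inversions_of_leftDescent {f : Equiv.Perm (Fin n)} {i : Fin (n - 1)}
    (h : LeftDescent i f) : inversions f = inversions (adj i * f) + 1 := by
  have := inversions_adj_mul (i := i) (f := adj i * f) (by rw [leftDescent_adj_mul]; simpa using h)
  rwa [adj_mul_cancel] at this

theorem inversions_adj_mul_le (f : Equiv.Perm (Fin n)) (i : Fin (n - 1)) :
    inversions (adj i * f) ≤ inversions f + 1 := by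
  by_cases h : LeftDescent i f
  · have := inversions_of_leftDescent h; omega
  · exact (inversions_adj_mul h).le

theorem inversions_one : inversions (1 : Equiv.Perm (Fin n)) = 0 := by
  unfold inversions
  rw [Finset.card_eq_zero, Finset.filter_eq_empty_iff]
  rintro x - ⟨h₁, h₂⟩
  exact absurd h₁ (not_lt.2 h₂.le)

theorem inversions_permOfPositive_le (u : List (Fin (n - 1))) :
    inversions (permOfPositive u) ≤ u.length := by
  induction u with
  | nil => rw [permOfPositive_nil, inversions_one]; exact Nat.zero_le _
  | cons i u ih =>
    rw [permOfPositive_cons, List.length_cons]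
    exact (inversions_adj_mul_le _ _).trans (Nat.succ_le_succ ih)

theorem inversions_le (f : Equiv.Perm (Fin n)) : inversions f ≤ n * n := by
  refine (Finset.card_filter_le _ _).trans ?_
  simp

/-- A positive word is reduced: no two strands cross twice. -/
def Reduced (u : List (Fin (n - 1))) : Prop := u.length = inversions (permOfPositive u)

theorem reduced_nil : Reduced ([] : List (Fin (n - 1))) := by
  rw [Reduced, permOfPositive_nil, inversions_one]; rfl

/-- A letter changes the number of inversions by one, up or down. Equality in the length bound
therefore forces equality for the tail and an increase at the first letter. -/
theorem reduced_cons {i : Fin (n - 1)} {u : List (Fin (n - 1))} :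
    Reduced (i :: u) ↔ Reduced u ∧ ¬LeftDescent i (permOfPositive u) := by
  unfold Reduced
  rw [permOfPositive_cons, List.length_cons]
  constructor
  · intro h
    have h₁ := inversions_permOfPositive_le u
    have h₂ := inversions_adj_mul_le (permOfPositive u) i
    refine ⟨by omega, fun h₃ => ?_⟩
    have := inversions_of_leftDescent h₃
    omega
  · rintro ⟨h₁, h₂⟩
    rw [inversions_adj_mul h₂, h₁]

theorem Reduced.leftDescent {i : Fin (n - 1)} {u : List (Fin (n - 1))} (h : Reduced (i :: u)) :
    LeftDescent i (permOfPositive (i :: u)) := by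
  rw [permOfPositive_cons, leftDescent_adj_mul]
  exact (reduced_cons.1 h).2

theorem Reduced.reverse {u : List (Fin (n - 1))} (h : Reduced u) : Reduced u.reverse := by
  unfold Reduced at *
  rw [permOfPositive_reverse, inversions_inv, List.length_reverse, h]

/-- Without descents `f⁻¹` is strictly increasing, and the identity is the only order automorphism
of a finite chain. -/
theorem eq_one_of_no_leftDescent {f : Equiv.Perm (Fin n)} (h : ∀ i, ¬LeftDescent i f) : f = 1 := by
  have hm : StrictMono (f⁻¹ : Equiv.Perm (Fin n)) := by
    rcases n with _ | n
    · exact fun a => a.elim0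
    · exact Fin.strictMono_iff_lt_succ.2 fun i => not_leftDescent_iff.1 (h i)
  have h₁ : hm.orderIsoOfSurjective _ (f⁻¹).surjective = OrderIso.refl _ := Subsingleton.elim _ _
  have : f⁻¹ = 1 := Equiv.ext fun x => DFunLike.congr_fun h₁ x
  exact inv_eq_one.1 this

end BraidGroup

section SimpleBraids

variable {n : ℕ}

/-! ### Simple braids -/

/-- Split off the left descents in the order given by a list. -/
def spell : List (Fin (n - 1)) → Equiv.Perm (Fin n) → List (Fin (n - 1))
  | [], _ => []
  | i :: l, f => if LeftDescent i f then i :: spell l (adj i * f) else spell l f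

/-- The permutation that is left by `spell`. -/
def spellRest : List (Fin (n - 1)) → Equiv.Perm (Fin n) → Equiv.Perm (Fin n)
  | [], f => f
  | i :: l, f => if LeftDescent i f then spellRest l (adj i * f) else spellRest l f

theorem permOfPositive_spell (l : List (Fin (n - 1))) (f : Equiv.Perm (Fin n)) :
    permOfPositive (spell l f) * spellRest l f = f := by
  induction l generalizing f with
  | nil => rfl
  | cons i l ih =>
    by_cases h : LeftDescent i f
    · simp only [spell, spellRest, h, if_true]
      rw [permOfPositive_cons, mul_assoc, ih, adj_mul_cancel]
    · simp only [spell, spellRest, h, if_false]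
      exact ih f

theorem length_spell (l : List (Fin (n - 1))) (f : Equiv.Perm (Fin n)) :
    (spell l f).length + inversions (spellRest l f) = inversions f := by
  induction l generalizing f with
  | nil => simp [spell, spellRest]
  | cons i l ih =>
    by_cases h : LeftDescent i f
    · simp only [spell, spellRest, h, if_true, List.length_cons]
      have := ih (adj i * f)
      have := inversions_of_leftDescent h
      omega
    · simp only [spell, spellRest, h, if_false]
      exact ih f

theorem spellRest_append (l l' : List (Fin (n - 1))) (f : Equiv.Perm (Fin n)) :
    spellRest (l ++ l') f = spellRest l' (spellRest l f) := by
  induction l generalizing f with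
  | nil => rfl
  | cons i l ih =>
    by_cases h : LeftDescent i f <;> simp only [List.cons_append, spellRest, h, if_true, if_false, ih]

theorem not_leftDescent_of_spellRest {l : List (Fin (n - 1))} {f : Equiv.Perm (Fin n)}
    (h : inversions (spellRest l f) = inversions f) : ∀ i ∈ l, ¬LeftDescent i f := by
  induction l with
  | nil => simp
  | cons i l ih =>
    by_cases hi : LeftDescent i f
    · simp only [spellRest, hi, if_true] at h
      have := length_spell l (adj i * f)
      have := inversions_of_leftDescent hi
      omega
    · simp only [spellRest, hi, if_false] at h
      exact fun j hj => (List.mem_cons.1 hj).elim (fun e => e ▸ hi) (ih h j)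

theorem spellRest_one (l : List (Fin (n - 1))) : spellRest l 1 = 1 := by
  induction l with
  | nil => rfl
  | cons i l ih =>
    have : ¬LeftDescent i (1 : Equiv.Perm (Fin n)) := not_leftDescent_iff.2 (lo_lt_hi i)
    simp only [spellRest, this, if_false, ih]

/-- A pass over all indices that splits off nothing shows that there is no left descent, so the
permutation is trivial. Otherwise the pass lowers the number of inversions. -/
theorem spellRest_replicate (k : ℕ) (f : Equiv.Perm (Fin n)) (h : inversions f ≤ k) :
    spellRest (List.replicate k (List.finRange (n - 1))).flatten f = 1 := by
  induction k generalizing f with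
  | zero =>
    refine eq_one_of_no_leftDescent fun i hi => ?_
    have : inversions f = inversions (adj i * f) + 1 := inversions_of_leftDescent hi
    omega
  | succ k ih =>
    rw [List.replicate_succ, List.flatten_cons, spellRest_append]
    by_cases hf : f = 1
    · rw [hf, spellRest_one, spellRest_one]
    · refine ih _ ?_
      have h₁ := length_spell (List.finRange (n - 1)) f
      rcases Nat.lt_or_ge (inversions (spellRest (List.finRange (n - 1)) f)) (inversions f) with h₂ | h₂
      · omega
      · exact absurd (eq_one_of_no_leftDescent fun i =>
          not_leftDescent_of_spellRest (by omega) i (List.mem_finRange i)) hf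

/-- The word of the simple braid of a permutation. -/
def simpleWord (n : ℕ) (f : Equiv.Perm (Fin n)) : List (Fin (n - 1)) :=
  -- The number of passes suffices by `inversions_le`.
  spell (List.replicate (n * n) (List.finRange (n - 1))).flatten f

theorem isSimpleSpelling_simpleWord (n : ℕ) : IsSimpleSpelling (simpleWord n) := fun f => by
  have h := spellRest_replicate (n * n) f (inversions_le f)
  have h₁ := permOfPositive_spell (List.replicate (n * n) (List.finRange (n - 1))).flatten f
  have h₂ := length_spell (List.replicate (n * n) (List.finRange (n - 1))).flatten f
  rw [h, mul_one] at h₁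
  rw [h, inversions_one, add_zero] at h₂
  exact ⟨h₁, h₂⟩

@[simp] theorem permOfPositive_simpleWord (f : Equiv.Perm (Fin n)) :
    permOfPositive (simpleWord n f) = f := (isSimpleSpelling_simpleWord n f).1

theorem reduced_simpleWord (f : Equiv.Perm (Fin n)) : Reduced (simpleWord n f) := by
  rw [Reduced, permOfPositive_simpleWord, (isSimpleSpelling_simpleWord n f).2]

/-- The braid of a positive word. -/
def posBraid (u : List (Fin (n - 1))) : BraidGroup n := (u.map braidGen).prod

theorem toBraid_positiveWord (u : List (Fin (n - 1))) :
    toBraid (positiveWord u) = posBraid u := by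
  induction u with
  | nil => exact toBraid_nil
  | cons i u ih =>
    rw [posBraid, List.map_cons, List.prod_cons]
    exact (toBraid_cons _ _).trans (by rw [if_pos rfl]; exact congrArg _ ih)

theorem posBraid_cons (i : Fin (n - 1)) (u : List (Fin (n - 1))) :
    posBraid (i :: u) = braidGen i * posBraid u := by simp [posBraid]

theorem posBraid_append (u v : List (Fin (n - 1))) :
    posBraid (u ++ v) = posBraid u * posBraid v := by simp [posBraid]

theorem leftDescent_far {i j : Fin (n - 1)} (h : i.val + 2 ≤ j.val ∨ j.val + 2 ≤ i.val)
    {f : Equiv.Perm (Fin n)} : LeftDescent j (adj i * f) ↔ LeftDescent j f := by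
  have h₁ : adj i (lo j) = lo j := adj_of_ne (by simp [lo]; omega) (by simp [lo, hi]; omega)
  have h₂ : adj i (hi j) = hi j := adj_of_ne (by simp [lo, hi]; omega) (by simp [hi]; omega)
  simp [LeftDescent, h₁, h₂]

theorem lo_eq_hi {i j : Fin (n - 1)} (h : j.val = i.val + 1) : lo j = hi i := Fin.ext h

theorem adj_lo_next {i j : Fin (n - 1)} (h : j.val = i.val + 1) : adj j (lo i) = lo i :=
  adj_of_ne (by simp [lo]; omega) (by simp [lo, hi]; omega)

theorem adj_hi_next {i j : Fin (n - 1)} (h : j.val = i.val + 1) : adj i (hi j) = hi j :=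
  adj_of_ne (by simp [lo, hi]; omega) (by simp [hi]; omega)

theorem adj_comm_far {i j : Fin (n - 1)} (h : i.val + 2 ≤ j.val ∨ j.val + 2 ≤ i.val)
    (f : Equiv.Perm (Fin n)) : adj i * (adj j * f) = adj j * (adj i * f) := by
  ext x
  simp only [Equiv.Perm.coe_mul, Function.comp_apply, adj_val]
  split_ifs <;> omega

theorem adj_hi_of_next {i j : Fin (n - 1)} (h : j.val = i.val + 1) : adj j (hi i) = hi j := by
  rw [← lo_eq_hi h, adj_lo]

theorem adj_braid {i j : Fin (n - 1)} (h : j.val = i.val + 1) (f : Equiv.Perm (Fin n)) :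
    adj i * (adj j * (adj i * f)) = adj j * (adj i * (adj j * f)) := by
  suffices adj i * (adj j * adj i) = adj j * (adj i * adj j) by
    rw [← mul_assoc, ← mul_assoc, mul_assoc (adj i), this]
    simp only [mul_assoc]
  have h₁ := lo_eq_hi h
  have h₂ := adj_lo_next h
  have h₃ := adj_hi_next h
  have h₄ := adj_hi_of_next h
  refine Equiv.ext fun x => ?_
  simp only [Equiv.Perm.coe_mul, Function.comp_apply]
  by_cases hx : x = lo i
  · subst hx; simp [h₂, h₃, h₄]
  by_cases hy : x = hi i
  · subst hy; simp [h₁, h₂, h₃, h₄]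
  by_cases hz : x = hi j
  · subst hz; simp [h₁, h₂, h₃]
  have hw : x ≠ lo j := h₁ ▸ hy
  simp only [adj_of_ne hx hy, adj_of_ne hw hz]

/-- Reduced words of the same permutation represent the same braid, the case of two words with
first letters `i` and `j`. -/
theorem posBraid_eq_aux {i j : Fin (n - 1)} (hij : i.val < j.val) {u v : List (Fin (n - 1))}
    (hu : Reduced (i :: u)) (hv : Reduced (j :: v))
    (h : permOfPositive (i :: u) = permOfPositive (j :: v))
    (ihu : ∀ w, Reduced w → permOfPositive u = permOfPositive w → posBraid u = posBraid w)
    (ihv : ∀ w, Reduced w → permOfPositive v = permOfPositive w → posBraid v = posBraid w) :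
    posBraid (i :: u) = posBraid (j :: v) := by
  have di := hu.leftDescent
  have dj := hv.leftDescent
  rw [← h] at dj
  have eu : permOfPositive u = adj i * permOfPositive (i :: u) := by
    rw [permOfPositive_cons, adj_mul_cancel]
  have ev : permOfPositive v = adj j * permOfPositive (i :: u) := by
    rw [h, permOfPositive_cons, adj_mul_cancel]
  generalize permOfPositive (i :: u) = f at *
  rw [posBraid_cons, posBraid_cons]
  by_cases hd : j.val = i.val + 1
  · have h₁ := lo_eq_hi hd
    have h₂ := adj_lo_next hd
    have h₃ := adj_hi_next hd
    have h₄ := adj_hi_of_next hd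
    have h₅ : adj j (hi j) = hi i := by rw [adj_hi, h₁]
    have hj' : f⁻¹ (hi j) < f⁻¹ (hi i) := h₁ ▸ dj
    have d₁ : LeftDescent j (adj i * f) := by
      simpa [LeftDescent, h₁, h₃] using hj'.trans di
    have d₂ : LeftDescent i (adj j * (adj i * f)) := by
      simpa [LeftDescent, h₂, h₃, h₄] using hj'
    have e₁ : LeftDescent i (adj j * f) := by
      simpa [LeftDescent, h₂, h₄] using hj'.trans di
    have e₂ : LeftDescent j (adj i * (adj j * f)) := by
      simpa [LeftDescent, h₁, h₂, h₃, h₅] using di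
    -- With neighbouring descents `i` and `j`, the three strands involved are completely reversed.
    -- Hence both words may be replaced, by the induction hypotheses, with words that continue with
    -- a common remainder `g`, after σᵢσⱼσᵢ and σⱼσᵢσⱼ respectively.
    set g := adj i * (adj j * (adj i * f)) with hg
    have hg' : g = adj j * (adj i * (adj j * f)) := adj_braid hd f
    have r₁ : Reduced (j :: i :: simpleWord n g) := by
      rw [reduced_cons, reduced_cons, permOfPositive_cons, permOfPositive_simpleWord, hg,
        adj_mul_cancel, leftDescent_adj_mul, leftDescent_adj_mul, not_not, not_not]
      exact ⟨⟨reduced_simpleWord _, d₂⟩, d₁⟩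
    have r₂ : Reduced (i :: j :: simpleWord n g) := by
      rw [reduced_cons, reduced_cons, permOfPositive_cons, permOfPositive_simpleWord, hg',
        adj_mul_cancel, leftDescent_adj_mul, leftDescent_adj_mul, not_not, not_not]
      exact ⟨⟨reduced_simpleWord _, e₂⟩, e₁⟩
    rw [ihu _ r₁ (by
        rw [permOfPositive_cons, permOfPositive_cons, permOfPositive_simpleWord, eu, hg]
        simp only [adj_mul_cancel]),
      ihv _ r₂ (by
        rw [permOfPositive_cons, permOfPositive_cons, permOfPositive_simpleWord, ev, hg']
        simp only [adj_mul_cancel])]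
    simp only [posBraid_cons]
    have := braidGen_braid hd
    rw [← mul_assoc, ← mul_assoc, mul_assoc (braidGen i), this]
    simp only [mul_assoc]
  · have far : i.val + 2 ≤ j.val ∨ j.val + 2 ≤ i.val := by omega
    -- Far descents do not interact: both letters split off, and a common remainder is left after
    -- σᵢσⱼ and σⱼσᵢ.
    set g := adj j * (adj i * f) with hg
    have r₁ : Reduced (j :: simpleWord n g) := by
      rw [reduced_cons, permOfPositive_simpleWord, hg, leftDescent_adj_mul, not_not,
        leftDescent_far far]
      exact ⟨reduced_simpleWord _, dj⟩
    have r₂ : Reduced (i :: simpleWord n g) := by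
      rw [reduced_cons, permOfPositive_simpleWord, hg, adj_comm_far far.symm, leftDescent_adj_mul,
        not_not, leftDescent_far far.symm]
      exact ⟨reduced_simpleWord _, di⟩
    rw [ihu _ r₁ (by rw [permOfPositive_cons, permOfPositive_simpleWord, eu, hg, adj_mul_cancel]),
      ihv _ r₂ (by rw [permOfPositive_cons, permOfPositive_simpleWord, ev, hg, adj_comm_far far.symm,
        adj_mul_cancel]), posBraid_cons, posBraid_cons, ← mul_assoc, ← mul_assoc, braidGen_comm far]

/-- Reduced words of the same permutation represent the same braid. -/
theorem posBraid_eq {u v : List (Fin (n - 1))} (hu : Reduced u) (hv : Reduced v)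
    (h : permOfPositive u = permOfPositive v) : posBraid u = posBraid v := by
  induction hk : u.length generalizing u v with
  | zero =>
    have e₁ := hu
    have e₂ := hv
    unfold Reduced at e₁ e₂
    rw [h, ← e₂, hk] at e₁
    rw [List.length_eq_zero_iff.1 hk, List.length_eq_zero_iff.1 e₁.symm]
  | succ k ih =>
    have e₁ := hu
    have e₂ := hv
    unfold Reduced at e₁ e₂
    rw [h, ← e₂, hk] at e₁
    obtain ⟨i, u, rfl⟩ := List.exists_cons_of_length_eq_add_one hk
    obtain ⟨j, v, rfl⟩ := List.exists_cons_of_length_eq_add_one e₁.symm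
    have ru := (reduced_cons.1 hu).1
    have rv := (reduced_cons.1 hv).1
    rw [List.length_cons] at hk e₁
    have ihu : ∀ w, Reduced w → permOfPositive u = permOfPositive w → posBraid u = posBraid w :=
      fun w hw e => ih ru hw e (by omega)
    have ihv : ∀ w, Reduced w → permOfPositive v = permOfPositive w → posBraid v = posBraid w :=
      fun w hw e => ih rv hw e (by omega)
    rcases lt_trichotomy i.val j.val with hij | hij | hij
    · exact posBraid_eq_aux hij hu hv h ihu ihv
    · obtain rfl : i = j := Fin.ext hij
      rw [posBraid_cons, posBraid_cons, ihu v rv]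
      rw [permOfPositive_cons, permOfPositive_cons] at h
      exact mul_left_cancel h
    · exact (posBraid_eq_aux hij hv hu h.symm ihv ihu).symm

/-- The simple braid of a permutation. -/
def simpleBraid (f : Equiv.Perm (Fin n)) : BraidGroup n := posBraid (simpleWord n f)

theorem Reduced.posBraid_eq {u : List (Fin (n - 1))} (hu : Reduced u) :
    posBraid u = simpleBraid (permOfPositive u) :=
  _root_.posBraid_eq hu (reduced_simpleWord _) (permOfPositive_simpleWord _).symm

theorem simpleBraid_adj_mul {i : Fin (n - 1)} {f : Equiv.Perm (Fin n)} (h : ¬LeftDescent i f) :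
    simpleBraid (adj i * f) = braidGen i * simpleBraid f := by
  have : Reduced (i :: simpleWord n f) :=
    reduced_cons.2 ⟨reduced_simpleWord f, by rwa [permOfPositive_simpleWord]⟩
  rw [simpleBraid.eq_def f, ← posBraid_cons, this.posBraid_eq, permOfPositive_cons,
    permOfPositive_simpleWord]

theorem Reduced.concat {u : List (Fin (n - 1))} {i : Fin (n - 1)} (hu : Reduced u)
    (h : permOfPositive u (lo i) < permOfPositive u (hi i)) : Reduced (u ++ [i]) := by
  unfold Reduced at *
  rw [permOfPositive_append, permOfPositive_singleton, inversions_mul_adj h, List.length_append,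
    hu, List.length_singleton]

theorem simpleBraid_mul_adj {i : Fin (n - 1)} {f : Equiv.Perm (Fin n)} (h : f (lo i) < f (hi i)) :
    simpleBraid (f * adj i) = simpleBraid f * braidGen i := by
  have : Reduced (simpleWord n f ++ [i]) :=
    (reduced_simpleWord f).concat (by rwa [permOfPositive_simpleWord])
  have h₁ := this.posBraid_eq
  rw [posBraid_append, permOfPositive_append, permOfPositive_simpleWord,
    permOfPositive_singleton] at h₁
  rw [← h₁, simpleBraid]
  simp [posBraid]

end SimpleBraids

section Delta

variable {n : ℕ}

/-! ### The half twist -/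

/-- The permutation of a word of natural numbers. -/
def natWordPerm (l : List ℕ) : Equiv.Perm ℕ := (l.map fun k => Equiv.swap k (k + 1)).prod

theorem permOfPositive_val (u : List (Fin (n - 1))) (x : Fin n) :
    (permOfPositive u x).val = natWordPerm (u.map Fin.val) x.val := by
  induction u generalizing x with
  | nil => rfl
  | cons i u ih =>
    rw [permOfPositive_cons, Equiv.Perm.mul_apply, adj_val, ih]
    simp only [natWordPerm, List.map_cons, List.prod_cons, Equiv.Perm.mul_apply,
      Equiv.swap_apply_def]
    rfl

/-- The word of the half twist, as a word of natural numbers. -/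
def natDelta (m : ℕ) : List ℕ := (List.range m).flatMap fun k => (List.range (k + 1)).reverse

theorem filter_range_le {m k : ℕ} (h : k < m) :
    (List.range m).filter (· ≤ k) = List.range (k + 1) := by
  induction m with
  | zero => omega
  | succ m ih =>
    rw [List.range_succ, List.filter_append]
    rcases Nat.lt_succ_iff_lt_or_eq.1 h with h | rfl
    · rw [ih h]; simp; try omega
    · rw [List.filter_eq_self.2 (fun x hx => by simp at hx ⊢; omega), List.range_succ]; simp

theorem deltaWord_map_val (n : ℕ) : (deltaWord n).map Fin.val = natDelta (n - 1) := by
  have h₁ : (List.finRange (n - 1)).map Fin.val = List.range (n - 1) := by simp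
  unfold deltaWord natDelta
  rw [List.map_flatMap, ← h₁, List.flatMap_map]
  refine List.flatMap_congr fun k _ => ?_
  rw [List.map_reverse, ← filter_range_le k.2, ← h₁, List.filter_map]
  rfl

theorem natWordPerm_append (l l' : List ℕ) :
    natWordPerm (l ++ l') = natWordPerm l * natWordPerm l' := by simp [natWordPerm]

theorem natWordPerm_range_reverse (k x : ℕ) : natWordPerm (List.range k).reverse x =
    if x = 0 then k else if x ≤ k then x - 1 else x := by
  induction k with
  | zero => rcases x with _ | x <;> simp [natWordPerm]
  | succ k ih =>
    rw [List.range_succ, List.reverse_append, natWordPerm_append, Equiv.Perm.mul_apply, ih]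
    simp only [natWordPerm, List.reverse_singleton, List.map_singleton, List.prod_singleton,
      Equiv.swap_apply_def]
    split_ifs <;> omega

theorem natWordPerm_natDelta (m x : ℕ) :
    natWordPerm (natDelta m) x = if x ≤ m then m - x else x := by
  induction m generalizing x with
  | zero => simp [natDelta, natWordPerm]; try omega
  | succ m ih =>
    have : natDelta (m + 1) = natDelta m ++ (List.range (m + 1)).reverse := by
      simp [natDelta, List.range_succ (n := m)]
    rw [this, natWordPerm_append, Equiv.Perm.mul_apply, natWordPerm_range_reverse, ih]
    split_ifs <;> omega

/-- The permutation of the half twist. -/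
def halfTwist (n : ℕ) : Equiv.Perm (Fin n) := permOfPositive (deltaWord n)

theorem halfTwist_val (x : Fin n) : (halfTwist n x).val = n - 1 - x.val := by
  rw [halfTwist, permOfPositive_val, deltaWord_map_val, natWordPerm_natDelta, if_pos (by omega)]

theorem halfTwist_lt {x y : Fin n} : halfTwist n x < halfTwist n y ↔ y < x := by
  rw [Fin.lt_def, Fin.lt_def, halfTwist_val, halfTwist_val]
  omega

theorem halfTwist_halfTwist (x : Fin n) : halfTwist n (halfTwist n x) = x := by
  ext
  rw [halfTwist_val, halfTwist_val]
  omega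

theorem halfTwist_inv : (halfTwist n)⁻¹ = halfTwist n :=
  inv_eq_of_mul_eq_one_left (Equiv.ext halfTwist_halfTwist)

theorem length_natDelta (m : ℕ) : (natDelta m).length = ∑ k ∈ Finset.range m, (k + 1) := by
  induction m with
  | zero => rfl
  | succ m ih =>
    rw [Finset.sum_range_succ, ← ih]
    simp [natDelta, List.range_succ (n := m)]

theorem length_deltaWord_le (n : ℕ) : (deltaWord n).length ≤ n * n := by
  have h₁ : (deltaWord n).length = ((deltaWord n).map Fin.val).length := (List.length_map _).symm
  rw [h₁, deltaWord_map_val, length_natDelta]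
  calc ∑ k ∈ Finset.range (n - 1), (k + 1) ≤ ∑ k ∈ Finset.range (n - 1), n :=
        Finset.sum_le_sum fun k hk => by rw [Finset.mem_range] at hk; omega
    _ ≤ n * n := by simp; exact Nat.mul_le_mul_right _ (by omega)

theorem filter_halfTwist (n : ℕ) : (Finset.univ.filter fun x : Fin n × Fin n =>
    x.1 < x.2 ∧ halfTwist n x.2 < halfTwist n x.1) =
      Finset.univ.filter fun x : Fin n × Fin n => x.1 < x.2 := by
  ext x
  simp [halfTwist_lt]

theorem inversions_le_halfTwist (f : Equiv.Perm (Fin n)) :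
    inversions f ≤ inversions (halfTwist n) := by
  unfold inversions
  rw [filter_halfTwist]
  exact Finset.card_le_card (Finset.monotone_filter_right _ fun x _ h => h.1)

/-- Every pair is inverted. Counting pairs by their larger element gives the sum of the lengths of
the blocks of the word Δ. -/
theorem inversions_halfTwist : inversions (halfTwist n) = (deltaWord n).length := by
  have h₁ : (deltaWord n).length = ((deltaWord n).map Fin.val).length := (List.length_map _).symm
  rw [h₁, deltaWord_map_val, length_natDelta]
  have h₂ := filter_halfTwist n
  have h₃ : (Finset.univ.filter fun x : Fin n × Fin n => x.1 < x.2).card = ∑ b : Fin n, b.val := by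
    rw [Finset.card_filter, Fintype.sum_prod_type_right]
    refine Finset.sum_congr rfl fun b _ => ?_
    rw [← Finset.card_filter, ← Fin.card_Iio b]
    congr 1
    ext a
    simp
  unfold inversions
  rw [h₂, h₃, Fin.sum_univ_eq_sum_range (fun k => k) n]
  rcases n with _ | n
  · rfl
  · rw [Finset.sum_range_succ']; simp

theorem reduced_deltaWord : Reduced (deltaWord n) := inversions_halfTwist.symm

/-- The position opposite to `i`. -/
def opp (i : Fin (n - 1)) : Fin (n - 1) := ⟨n - 2 - i.val, by omega⟩

theorem halfTwist_lo (i : Fin (n - 1)) : halfTwist n (lo i) = hi (opp i) := by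
  ext; rw [halfTwist_val]; simp [lo, hi, opp]; omega

theorem halfTwist_hi (i : Fin (n - 1)) : halfTwist n (hi i) = lo (opp i) := by
  ext; rw [halfTwist_val]; simp [lo, hi, opp]; omega

/-- Multiplication by the order-reversing half twist turns all descents into ascents. -/
theorem eq_halfTwist_of_leftDescents {f : Equiv.Perm (Fin n)} (h : ∀ i, LeftDescent i f) :
    f = halfTwist n := by
  have : halfTwist n * f = 1 := by
    refine eq_one_of_no_leftDescent fun i => not_leftDescent_iff.2 ?_
    rw [mul_inv_rev, halfTwist_inv, Equiv.Perm.mul_apply, Equiv.Perm.mul_apply, halfTwist_lo,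
      halfTwist_hi]
    exact h (opp i)
  rw [← halfTwist_inv]
  exact (inv_eq_of_mul_eq_one_right this).symm

/-- If some `i` were not a left descent, prefixing it would give more inversions than the half twist
has. -/
theorem eq_halfTwist_of_inversions {f : Equiv.Perm (Fin n)}
    (h : (deltaWord n).length ≤ inversions f) : f = halfTwist n := by
  refine eq_halfTwist_of_leftDescents fun i => by_contra fun hi => ?_
  have h₁ := inversions_adj_mul hi
  have h₂ := inversions_le_halfTwist (adj i * f)
  rw [inversions_halfTwist] at h₂
  omega

/-- The braid `Δ`. -/
def deltaBraid (n : ℕ) : BraidGroup n := posBraid (deltaWord n)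

theorem simpleBraid_halfTwist : simpleBraid (halfTwist n) = deltaBraid n :=
  reduced_deltaWord.posBraid_eq.symm

theorem opp_opp (i : Fin (n - 1)) : opp (opp i) = i := by
  ext; simp [opp]; omega

theorem leftDescent_halfTwist (i : Fin (n - 1)) : LeftDescent i (halfTwist n) := by
  rw [LeftDescent, halfTwist_inv, halfTwist_lt]
  exact lo_lt_hi i

theorem halfTwist_mul_adj (i : Fin (n - 1)) : halfTwist n * adj i = adj (opp i) * halfTwist n := by
  rw [adj, Equiv.mul_swap_eq_swap_mul, halfTwist_lo, halfTwist_hi, Equiv.swap_comm, adj]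

/-- The half twist conjugates σᵢ to the opposite generator already in the symmetric group. So one
simple braid `u` satisfies both Δ = σ_{opp i} u and Δ = u σᵢ. -/
theorem deltaBraid_mul_gen (i : Fin (n - 1)) :
    deltaBraid n * braidGen i = braidGen (opp i) * deltaBraid n := by
  set u := adj (opp i) * halfTwist n with hu
  have h₁ : simpleBraid (halfTwist n) = braidGen (opp i) * simpleBraid u := by
    rw [← simpleBraid_adj_mul, hu, adj_mul_cancel]
    rw [hu, leftDescent_adj_mul, not_not]
    exact leftDescent_halfTwist _
  have h₂ : simpleBraid (halfTwist n) = simpleBraid u * braidGen i := by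
    rw [← simpleBraid_mul_adj, hu, ← halfTwist_mul_adj, mul_assoc, adj_mul_self, mul_one]
    rw [hu, ← halfTwist_mul_adj]
    simp only [Equiv.Perm.mul_apply, adj_lo, adj_hi, halfTwist_lt]
    exact lo_lt_hi i
  rw [← simpleBraid_halfTwist]
  nth_rewrite 1 [h₁]
  rw [mul_assoc, ← h₂]

theorem commute_deltaBraid_sq (u : List (Fin (n - 1))) :
    Commute (deltaBraid n * deltaBraid n) (posBraid u) := by
  induction u with
  | nil => exact Commute.one_right _
  | cons i u ih =>
    rw [posBraid_cons]
    refine Commute.mul_right ?_ ih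
    show _ * _ = _ * _
    rw [mul_assoc, deltaBraid_mul_gen, ← mul_assoc, deltaBraid_mul_gen, opp_opp, mul_assoc]

end Delta

section LawrenceKrammer

variable {R : Type*} [CommRing R] (q t : R)

/-! ### The Lawrence–Krammer operators -/

/-- The Lawrence–Krammer operator of the generator `σₖ₊₁`, acting on functions of pairs `a < b`. -/
def krammer (k : ℕ) (φ : ℕ → ℕ → R) (a b : ℕ) : R :=
  -- Only pairs `a < b` matter; the other values are left alone, which does not disturb
  -- invertibility.
  if b ≤ a then φ a b
  else if a = k ∧ b = k + 1 then t * q ^ 2 * φ k (k + 1)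
  else if b = k then (1 - q) * φ a k + q * φ a (k + 1)
  else if b = k + 1 then φ a k + t * q * (q - 1) * φ k (k + 1)
  else if a = k then φ (k + 1) b + t * q * (q - 1) * φ k (k + 1)
  else if a = k + 1 then q * φ k b + (1 - q) * φ (k + 1) b
  else if a < k ∧ k + 1 < b then φ a b + t * (q - 1) ^ 2 * φ k (k + 1)
  else φ a b

section
variable {q t} {k a b : ℕ} (φ : ℕ → ℕ → R)

theorem krammer_of_le (h : b ≤ a) : krammer q t k φ a b = φ a b := by simp [krammer, h]

theorem krammer_self (h : a = k) (h' : b = k + 1) :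
    krammer q t k φ a b = t * q ^ 2 * φ k (k + 1) := by
  subst h h'; simp [krammer]

theorem krammer_left_lo (h : a < k) (h' : b = k) :
    krammer q t k φ a b = (1 - q) * φ a k + q * φ a (k + 1) := by
  subst h'; simp [krammer, h.not_ge, h.ne]

theorem krammer_left_hi (h : a < k) (h' : b = k + 1) :
    krammer q t k φ a b = φ a k + t * q * (q - 1) * φ k (k + 1) := by
  subst h'; simp [krammer, h.ne, show ¬(k + 1 ≤ a) by omega]

theorem krammer_right_lo (h : a = k) (h' : k + 1 < b) :
    krammer q t k φ a b = φ (k + 1) b + t * q * (q - 1) * φ k (k + 1) := by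
  subst h
  simp [krammer, show ¬(b ≤ a) by omega, show ¬(b = a + 1) by omega, show ¬(b = a) by omega]

theorem krammer_right_hi (h : a = k + 1) (h' : k + 1 < b) :
    krammer q t k φ a b = q * φ k b + (1 - q) * φ (k + 1) b := by
  subst h
  simp [krammer, show ¬(b ≤ k + 1) by omega, show ¬(b = k + 1) by omega, show ¬(b = k) by omega]

theorem krammer_mid (h : a < k) (h' : k + 1 < b) :
    krammer q t k φ a b = φ a b + t * (q - 1) ^ 2 * φ k (k + 1) := by
  simp [krammer, show ¬(b ≤ a) by omega, show ¬(b = k + 1) by omega, show ¬(b = k) by omega, h.ne,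
    show ¬(a = k + 1) by omega, h, h']

theorem krammer_of_lt (h : b < k) : krammer q t k φ a b = φ a b := by
  unfold krammer
  split_ifs <;> first | rfl | omega

theorem krammer_of_gt (h : k + 1 < a) : krammer q t k φ a b = φ a b := by
  unfold krammer
  split_ifs <;> first | rfl | omega

end

/-- Once the positions of `a` and `b` relative to `k`, `k + 1`, `k + 2` are fixed, this is a
polynomial identity in `q`, `t` and values of `φ`. -/
theorem krammer_braid (k : ℕ) (φ : ℕ → ℕ → R) :
    krammer q t k (krammer q t (k + 1) (krammer q t k φ)) =
      krammer q t (k + 1) (krammer q t k (krammer q t (k + 1) φ)) := by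
  funext a b
  rcases Nat.lt_or_ge a b with hab | hab
  swap
  · simp only [krammer_of_le _ hab]
  have ha : a < k ∨ a = k ∨ a = k + 1 ∨ a = k + 1 + 1 ∨ k + 1 + 1 < a := by omega
  have hb : b < k ∨ b = k ∨ b = k + 1 ∨ b = k + 1 + 1 ∨ k + 1 + 1 < b := by omega
  rcases ha with ha | ha | ha | ha | ha <;> rcases hb with hb | hb | hb | hb | hb <;>
    first
    | omega
    | (try subst ha
       try subst hb
       simp (disch := omega) only [krammer_self, krammer_left_lo, krammer_left_hi, krammer_right_lo,
        krammer_right_hi, krammer_mid, krammer_of_lt, krammer_of_gt]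
       try ring)

theorem krammer_comm {k l : ℕ} (h : k + 2 ≤ l) (φ : ℕ → ℕ → R) :
    krammer q t k (krammer q t l φ) = krammer q t l (krammer q t k φ) := by
  funext a b
  rcases Nat.lt_or_ge a b with hab | hab
  swap
  · simp only [krammer_of_le _ hab]
  have ha : a < k ∨ a = k ∨ a = k + 1 ∨ (k + 1 < a ∧ a < l) ∨ a = l ∨ a = l + 1 ∨ l + 1 < a := by
    omega
  have hb : b < k ∨ b = k ∨ b = k + 1 ∨ (k + 1 < b ∧ b < l) ∨ b = l ∨ b = l + 1 ∨ l + 1 < b := by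
    omega
  rcases ha with ha | ha | ha | ha | ha | ha | ha <;>
  rcases hb with hb | hb | hb | hb | hb | hb | hb <;>
    first
    | omega
    | (try subst ha
       try subst hb
       simp (disch := omega) only [krammer_self, krammer_left_lo, krammer_left_hi, krammer_right_lo,
        krammer_right_hi, krammer_mid, krammer_of_lt, krammer_of_gt]
       try ring)

/-- Used twice: for the embedding of polynomials into their fraction field, and for the substitution
of `t = 0`. -/
theorem krammer_map {S : Type*} [CommRing S] (f : R →+* S) (k : ℕ) (φ : ℕ → ℕ → R) :
    (krammer (f q) (f t) k fun a b => f (φ a b)) = fun a b => f (krammer q t k φ a b) := by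
  funext a b
  unfold krammer
  split_ifs <;> simp

end LawrenceKrammer

/-! ### Invertibility of the operators over a field -/

section

variable {K : Type*} [Field K] (q t : K)

/-- The inverse of the Lawrence–Krammer operator. -/
def krammerInv (k : ℕ) (ψ : ℕ → ℕ → K) (a b : ℕ) : K :=
  let m := ψ k (k + 1) / (t * q ^ 2)
  if b ≤ a then ψ a b
  else if a = k ∧ b = k + 1 then m
  else if b = k then ψ a (k + 1) - t * q * (q - 1) * m
  else if b = k + 1 then (ψ a k - (1 - q) * (ψ a (k + 1) - t * q * (q - 1) * m)) / q
  else if a = k then (ψ (k + 1) b - (1 - q) * (ψ k b - t * q * (q - 1) * m)) / q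
  else if a = k + 1 then ψ k b - t * q * (q - 1) * m
  else if a < k ∧ k + 1 < b then ψ a b - t * (q - 1) ^ 2 * m
  else ψ a b

variable {q t}

/-- The Lawrence–Krammer operator over a field, as a permutation. -/
def krammerEquiv (hq : q ≠ 0) (ht : t ≠ 0) (k : ℕ) : Equiv.Perm (ℕ → ℕ → K) where
  toFun := krammer q t k
  invFun := krammerInv q t k
  left_inv φ := by
    funext a b
    unfold krammerInv
    rw [krammer_self φ rfl rfl]
    split_ifs with h₁ h₂ h₃ h₄ h₅ h₆ h₇
    · rw [krammer_of_le _ h₁]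
    · obtain ⟨rfl, rfl⟩ := h₂; field_simp
    · subst h₃; rw [krammer_left_hi _ (by omega) rfl]; field_simp; ring
    · subst h₄
      rw [krammer_left_hi _ (by omega) rfl, krammer_left_lo _ (by omega) rfl]; field_simp; ring
    · subst h₅
      rw [krammer_right_hi _ rfl (by omega), krammer_right_lo _ rfl (by omega)]; field_simp; ring
    · subst h₆; rw [krammer_right_lo _ rfl (by omega)]; field_simp; ring
    · rw [krammer_mid _ h₇.1 h₇.2]; field_simp; ring
    · rcases Nat.lt_or_ge b k with h | h
      · rw [krammer_of_lt _ h]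
      · rw [krammer_of_gt _ (by omega)]
  right_inv ψ := by
    have hs : ∀ k, krammerInv q t k ψ k (k + 1) = ψ k (k + 1) / (t * q ^ 2) := fun k => by
      simp [krammerInv]
    have hl : ∀ {a k}, a < k → krammerInv q t k ψ a k =
        ψ a (k + 1) - t * q * (q - 1) * (ψ k (k + 1) / (t * q ^ 2)) := fun {a k} h => by
      simp [krammerInv, h.not_ge, h.ne]
    have hl' : ∀ {a k}, a < k → krammerInv q t k ψ a (k + 1) = (ψ a k - (1 - q) * (ψ a (k + 1) -
        t * q * (q - 1) * (ψ k (k + 1) / (t * q ^ 2)))) / q := fun {a k} h => by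
      simp [krammerInv, h.ne, show ¬(k + 1 ≤ a) by omega]
    have hr : ∀ {b k}, k + 1 < b → krammerInv q t k ψ k b = (ψ (k + 1) b - (1 - q) * (ψ k b -
        t * q * (q - 1) * (ψ k (k + 1) / (t * q ^ 2)))) / q := fun {b k} h => by
      simp [krammerInv, show ¬(b ≤ k) by omega, show ¬(b = k + 1) by omega,
        show ¬(b = k) by omega]
    have hr' : ∀ {b k}, k + 1 < b → krammerInv q t k ψ (k + 1) b =
        ψ k b - t * q * (q - 1) * (ψ k (k + 1) / (t * q ^ 2)) := fun {b k} h => by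
      simp [krammerInv, show ¬(b ≤ k + 1) by omega, show ¬(b = k + 1) by omega,
        show ¬(b = k) by omega]
    funext a b
    unfold krammer
    rw [hs]
    split_ifs with h₁ h₂ h₃ h₄ h₅ h₆ h₇
    · simp [krammerInv, h₁]
    · obtain ⟨rfl, rfl⟩ := h₂; field_simp
    · subst h₃; rw [hl (by omega), hl' (by omega)]; field_simp; ring
    · subst h₄; rw [hl (by omega)]; field_simp; ring
    · subst h₅; rw [hr' (by omega)]; field_simp; ring
    · subst h₆; rw [hr (by omega), hr' (by omega)]; field_simp; ring
    · simp only [krammerInv, if_neg h₁, if_neg h₂, if_neg h₃, if_neg h₄, if_neg h₅, if_neg h₆,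
        if_pos h₇]
      ring
    · simp only [krammerInv, if_neg h₁, if_neg h₂, if_neg h₃, if_neg h₄, if_neg h₅, if_neg h₆,
        if_neg h₇]

end

/-! ### Operators of positive words and the specialization at t = 0 -/

section

variable {n : ℕ}

theorem satisfiesBraidRelations_krammerEquiv {K : Type*} [Field K] {q t : K} (hq : q ≠ 0)
    (ht : t ≠ 0) :
    SatisfiesBraidRelations fun i : Fin (n - 1) => krammerEquiv hq ht i.val := by
  refine ⟨fun i j h => Equiv.ext fun φ => ?_, fun i j h => Equiv.ext fun φ => ?_⟩
  · rcases h with h | h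
    · exact krammer_comm q t h φ
    · exact (krammer_comm q t h φ).symm
  · have := krammer_braid q t i.val φ
    rw [← h] at this
    exact this

/-- The Lawrence–Krammer operator of a positive word. -/
def krammerWord {R : Type*} [CommRing R] (q t : R) (u : List (Fin (n - 1))) (φ : ℕ → ℕ → R) :
    ℕ → ℕ → R := u.foldr (fun i φ => krammer q t i.val φ) φ

theorem krammerWord_map {R S : Type*} [CommRing R] [CommRing S] (q t : R) (f : R →+* S)
    (u : List (Fin (n - 1))) (φ : ℕ → ℕ → R) :
    (krammerWord (f q) (f t) u fun a b => f (φ a b)) = fun a b => f (krammerWord q t u φ a b) := by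
  induction u with
  | nil => rfl
  | cons i u ih =>
    have h := krammer_map q t f i.val (krammerWord q t u φ)
    rw [← ih] at h
    exact h

/-- Positive words that represent the same braid have the same Lawrence–Krammer operators at
`t = 0`, where the operators are not invertible. -/
theorem krammerWord_eq {u v : List (Fin (n - 1))} (h : posBraid u = posBraid v) (q : ℚ)
    (hq : q ≠ 0) : krammerWord q 0 u (fun _ _ => 1) = krammerWord q 0 v fun _ _ => 1 := by
  -- Over the rational functions in `t` the operators are invertible and define a representation.
  -- Positive words never use inverses, so their values on the constant 1 lie in the polynomial
  -- ring. The equality holds there by injectivity of `ι`, and `t = 0` can be substituted.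
  let K := FractionRing (Polynomial ℚ)
  let ι : Polynomial ℚ →+* K := algebraMap (Polynomial ℚ) K
  have hι : Function.Injective ι := IsFractionRing.injective _ _
  have hq' : ι (.C q) ≠ 0 := by
    rw [Ne, map_eq_zero_iff ι hι]; simpa using hq
  have ht' : ι .X ≠ 0 := by
    rw [Ne, map_eq_zero_iff ι hι]; exact Polynomial.X_ne_zero
  obtain ⟨Φ, hΦ⟩ := exists_braidGroup_hom (satisfiesBraidRelations_krammerEquiv (n := n) hq' ht')
  have key : ∀ (u : List (Fin (n - 1))) φ,
      Φ (posBraid u) φ = krammerWord (ι (.C q)) (ι .X) u φ := by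
    intro u
    rw [← toBraid_positiveWord, hΦ]
    induction u with
    | nil => exact fun φ => rfl
    | cons i u ih =>
      intro φ
      have : evalCircuit (fun i : Fin (n - 1) => krammerEquiv hq' ht' i.val)
          (positiveWord (i :: u)) = krammerEquiv hq' ht' i.val * evalCircuit
          (fun i : Fin (n - 1) => krammerEquiv hq' ht' i.val) (positiveWord u) := evalCircuit_cons _ _ _
      rw [this, Equiv.Perm.mul_apply, ih]
      rfl
  have h₁ : krammerWord (.C q) .X u (fun _ _ => (1 : Polynomial ℚ)) =
      krammerWord (.C q) .X v fun _ _ => 1 := by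
    have h₂ := krammerWord_map (.C q) .X ι u fun _ _ => (1 : Polynomial ℚ)
    have h₃ := krammerWord_map (.C q) .X ι v fun _ _ => (1 : Polynomial ℚ)
    rw [← key] at h₂ h₃
    rw [h] at h₂
    rw [h₂] at h₃
    funext a b
    exact hι (congrFun (congrFun h₃ a) b)
  have h₂ := krammerWord_map (.C q) .X (Polynomial.evalRingHom 0) u fun _ _ => (1 : Polynomial ℚ)
  have h₃ := krammerWord_map (.C q) .X (Polynomial.evalRingHom 0) v fun _ _ => (1 : Polynomial ℚ)
  rw [h₁, ← h₃] at h₂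
  simpa using h₂

end

section

/-! ### Crossing sets and the uniqueness of the normal form -/

/-- The action of the generator `σₖ₊₁` on sets of pairs: if `A` is the set of the pairs of strands
that cross in the greatest simple left divisor of `x`, then the result is this set for
`σₖ₊₁ x`. -/
def crossStep (k : ℕ) (A : ℕ → ℕ → Prop) (a b : ℕ) : Prop :=
  if a = k ∧ b = k + 1 then True
  else if b = k then A a k ∧ A a (k + 1)
  else if b = k + 1 then A a k
  else if a = k then A (k + 1) b
  else if a = k + 1 then A k b ∧ A (k + 1) b
  else A a b

/-- At `q = 1/2`, `t = 0` all coefficients of the operator are nonnegative. -/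
theorem krammer_nonneg {k : ℕ} {φ : ℕ → ℕ → ℚ} (h : ∀ a b, 0 ≤ φ a b) (a b : ℕ) :
    0 ≤ krammer (1 / 2) 0 k φ a b := by
  have h₁ := h a k
  have h₂ := h a (k + 1)
  have h₃ := h k b
  have h₄ := h (k + 1) b
  have h₅ := h a b
  unfold krammer
  split_ifs <;> norm_num <;> linarith

/-- A combination of nonnegative values vanishes exactly if every term with a positive coefficient
does; `crossStep` records which terms these are. -/
theorem krammer_eq_zero_iff {k : ℕ} {φ : ℕ → ℕ → ℚ} (h : ∀ a b, 0 ≤ φ a b) {a b : ℕ} (hab : a < b) :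
    krammer (1 / 2) 0 k φ a b = 0 ↔ crossStep k (fun a b => φ a b = 0) a b := by
  have h₁ := h a k
  have h₂ := h a (k + 1)
  have h₃ := h k b
  have h₄ := h (k + 1) b
  unfold krammer crossStep
  rw [if_neg (not_le.2 hab)]
  split_ifs <;> norm_num
  · exact ⟨fun e => ⟨by linarith, by linarith⟩, fun e => by rw [e.1, e.2]; norm_num⟩
  · exact ⟨fun e => ⟨by linarith, by linarith⟩, fun e => by rw [e.1, e.2]; norm_num⟩

/-- Transitivity along increasing indices. -/
def IncTrans (A : ℕ → ℕ → Prop) : Prop := ∀ a b c, a < b → b < c → A a b → A b c → A a c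

theorem IncTrans.crossStep {A : ℕ → ℕ → Prop} (h : IncTrans A) (k : ℕ) :
    IncTrans (crossStep k A) := by
  intro a b c hab hbc
  have := h a b c hab hbc
  have ha : a < k ∨ a = k ∨ a = k + 1 ∨ k + 1 < a := by omega
  have hb : b < k ∨ b = k ∨ b = k + 1 ∨ k + 1 < b := by omega
  have hc : c < k ∨ c = k ∨ c = k + 1 ∨ k + 1 < c := by omega
  unfold IncTrans at h
  unfold _root_.crossStep
  rcases ha with ha | ha | ha | ha <;> rcases hb with hb | hb | hb | hb <;>
    rcases hc with hc | hc | hc | hc <;> first | omega | grind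

variable {n : ℕ}

theorem perm_apply_inv (f : Equiv.Perm (Fin n)) (x : Fin n) : f (f⁻¹ x) = x := f.apply_symm_apply x

theorem perm_inv_apply (f : Equiv.Perm (Fin n)) (x : Fin n) : f⁻¹ (f x) = x := f.symm_apply_apply x

/-- The set of crossings of the greatest simple left divisor of the braid of `u` times a braid with
set of crossings `A`. -/
def crossWord (u : List (Fin (n - 1))) (A : ℕ → ℕ → Prop) : ℕ → ℕ → Prop :=
  u.foldr (fun i A => crossStep i.val A) A

theorem crossWord_append (u v : List (Fin (n - 1))) (A : ℕ → ℕ → Prop) :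
    crossWord (u ++ v) A = crossWord u (crossWord v A) := by simp [crossWord]

theorem IncTrans.crossWord {A : ℕ → ℕ → Prop} (h : IncTrans A)
    (u : List (Fin (n - 1))) : IncTrans (crossWord u A) := by
  induction u with
  | nil => exact h
  | cons i u ih => exact ih.crossStep i

theorem crossStep_congr {k : ℕ} {A B : ℕ → ℕ → Prop} (h : ∀ a b, a < b → (A a b ↔ B a b)) {a b : ℕ}
    (hab : a < b) : crossStep k A a b ↔ crossStep k B a b := by
  unfold crossStep
  split_ifs with h₁ h₂ h₃ h₄ h₅
  · rfl
  · rw [h _ _ (by omega), h _ _ (by omega)]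
  · rw [h _ _ (by omega)]
  · rw [h _ _ (by omega)]
  · rw [h _ _ (by omega), h _ _ (by omega)]
  · rw [h _ _ hab]

theorem krammerWord_eq_zero_iff (u : List (Fin (n - 1))) {a b : ℕ} (hab : a < b) :
    krammerWord (1 / 2 : ℚ) 0 u (fun _ _ => 1) a b = 0 ↔ crossWord u (fun _ _ => False) a b := by
  have hn : ∀ u : List (Fin (n - 1)), ∀ a b, 0 ≤ krammerWord (1 / 2 : ℚ) 0 u (fun _ _ => 1) a b := by
    intro u
    induction u with
    | nil => intro a b; simp [krammerWord]
    | cons i u ih => exact krammer_nonneg ih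
  induction u generalizing a b with
  | nil => simp [krammerWord, crossWord]
  | cons i u ih =>
    exact (krammer_eq_zero_iff (hn u) hab).trans (crossStep_congr (fun a b h => ih h) hab)

theorem crossWord_eq {u v : List (Fin (n - 1))} (h : posBraid u = posBraid v) {a b : ℕ}
    (hab : a < b) : crossWord u (fun _ _ => False) a b ↔ crossWord v (fun _ _ => False) a b := by
  rw [← krammerWord_eq_zero_iff u hab, ← krammerWord_eq_zero_iff v hab,
    krammerWord_eq h (1 / 2) (by norm_num)]

/-- The crossing of the strands at `i` and `i + 1` enters with the letter `i`. The conjunctions in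
`crossStep` hold because these two strands do not cross again in a reduced word: a third strand that
crosses the farther one must also cross the nearer one. -/
theorem crossWord_of_inversion {u : List (Fin (n - 1))} (hu : Reduced u) (A : ℕ → ℕ → Prop)
    {a b : Fin n} (hab : a < b) (h : (permOfPositive u)⁻¹ b < (permOfPositive u)⁻¹ a) :
    crossWord u A a.val b.val := by
  induction u generalizing a b with
  | nil => rw [permOfPositive_nil] at h; exact absurd hab (not_lt.2 h.le)
  | cons i u ih =>
    obtain ⟨ru, hd⟩ := reduced_cons.1 hu
    rw [not_leftDescent_iff] at hd
    rw [permOfPositive_cons, mul_inv_rev, adj_inv, Equiv.Perm.mul_apply, Equiv.Perm.mul_apply] at h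
    have ih := fun {a b : Fin n} => @ih ru a b
    generalize (permOfPositive u)⁻¹ = g at *
    show crossStep i.val (crossWord u A) a.val b.val
    have va : ∀ x : Fin n, x.val = i.val → x = lo i := fun x hx => Fin.ext hx
    have vb : ∀ x : Fin n, x.val = i.val + 1 → x = hi i := fun x hx => Fin.ext hx
    have la : i.val = (lo i).val := rfl
    have lb : i.val + 1 = (hi i).val := rfl
    have lab : lo i < hi i := lo_lt_hi i
    unfold crossStep
    split_ifs with h₁ h₂ h₃ h₄ h₅
    · obtain rfl := va b h₂
      rw [adj_lo, adj_of_ne hab.ne (hab.trans lab).ne] at h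
      exact ⟨ih hab (hd.trans h), ih (hab.trans lab) h⟩
    · obtain rfl := vb b h₃
      have hne : a ≠ lo i := fun e => h₁ ⟨by rw [e]; rfl, h₃⟩
      rw [adj_hi, adj_of_ne hne hab.ne] at h
      exact ih (Fin.lt_def.2 (by have := Fin.val_ne_of_ne hne; have := Fin.lt_def.1 hab; omega)) h
    · obtain rfl := va a h₄
      have hne : b ≠ hi i := fun e => h₁ ⟨h₄, by rw [e]; rfl⟩
      rw [adj_lo, adj_of_ne hab.ne' hne] at h
      exact ih (Fin.lt_def.2 (by have := Fin.val_ne_of_ne hne; have := Fin.lt_def.1 hab; omega)) h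
    · obtain rfl := vb a h₅
      rw [adj_hi, adj_of_ne (lab.trans hab).ne' hab.ne'] at h
      exact ⟨ih (lab.trans hab) h, ih hab (h.trans hd)⟩
    · rw [adj_of_ne (fun e => h₂ (by rw [e]; rfl)) (fun e => h₃ (by rw [e]; rfl)),
        adj_of_ne (fun e => h₄ (by rw [e]; rfl)) (fun e => h₅ (by rw [e]; rfl))] at h
      exact ih hab h

/-- Follow the two strands through `u`: as they never cross there, their pair can only stem from
`A`, at the positions where they end. -/
theorem of_crossWord {u : List (Fin (n - 1))} (hu : Reduced u) {A : ℕ → ℕ → Prop}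
    {a b : Fin n} (hab : a < b) (h : (permOfPositive u)⁻¹ a < (permOfPositive u)⁻¹ b)
    (hA : crossWord u A a.val b.val) :
    A ((permOfPositive u)⁻¹ a).val ((permOfPositive u)⁻¹ b).val := by
  induction u generalizing a b with
  | nil => exact hA
  | cons i u ih =>
    obtain ⟨ru, hd⟩ := reduced_cons.1 hu
    rw [not_leftDescent_iff] at hd
    rw [permOfPositive_cons, mul_inv_rev, adj_inv, Equiv.Perm.mul_apply, Equiv.Perm.mul_apply]
      at h ⊢
    have ih := fun {a b : Fin n} => @ih ru a b
    generalize (permOfPositive u)⁻¹ = g at *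
    change crossStep i.val (crossWord u A) a.val b.val at hA
    have hne : ¬(a = lo i ∧ b = hi i) := by
      rintro ⟨rfl, rfl⟩
      rw [adj_lo, adj_hi] at h
      exact lt_asymm h hd
    have va : ∀ x : Fin n, x.val = i.val ↔ x = lo i := fun x => by rw [Fin.ext_iff]; rfl
    have vb : ∀ x : Fin n, x.val = i.val + 1 ↔ x = hi i := fun x => by rw [Fin.ext_iff]; rfl
    refine ih (adj_lt_adj hab hne) h ?_
    unfold crossStep at hA
    simp only [va, vb] at hA
    rw [if_neg hne] at hA
    split_ifs at hA with h₂ h₃ h₄ h₅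
    · subst h₂
      rw [adj_lo, adj_of_ne hab.ne (hab.trans (lo_lt_hi i)).ne]
      exact hA.2
    · subst h₃
      rw [adj_hi, adj_of_ne (fun e => hne ⟨e, rfl⟩) hab.ne]
      exact hA
    · subst h₄
      rw [adj_lo, adj_of_ne hab.ne' (fun e => hne ⟨rfl, e⟩)]
      exact hA
    · subst h₅
      rw [adj_hi, adj_of_ne ((lo_lt_hi i).trans hab).ne' hab.ne']
      exact hA.1
    · rwa [adj_of_ne h₄ h₅, adj_of_ne h₂ h₃]

/-- The conditions that characterize the set of the pairs of strands that cross in a simple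
braid. -/
structure IsCrossingSet (E : Fin n → Fin n → Prop) : Prop where
  trans : ∀ a b c, a < b → b < c → E a b → E b c → E a c
  cotrans : ∀ a b c, a < b → b < c → E a c → E a b ∨ E b c

theorem isCrossingSet_inversion (f : Equiv.Perm (Fin n)) : IsCrossingSet fun a b => f b < f a :=
  ⟨fun _ _ _ _ _ h h' => h'.trans h, fun _ b c _ _ h => by
    rcases lt_or_ge (f b) (f c) with h' | h'
    · exact Or.inl (h'.trans h)
    · exact Or.inr (lt_of_le_of_ne h' fun e => by have := f.injective e; omega)⟩

/-- The crossings of the simple braid of `f` are the greatest crossing set contained in `A`. -/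
structure IsGreatestCrossing (A : ℕ → ℕ → Prop) (f : Equiv.Perm (Fin n)) : Prop where
  mem : ∀ a b : Fin n, a < b → f⁻¹ b < f⁻¹ a → A a b
  le : ∀ E : Fin n → Fin n → Prop, IsCrossingSet E → (∀ a b : Fin n, a < b → E a b → A a b) →
    ∀ a b : Fin n, a < b → E a b → f⁻¹ b < f⁻¹ a

/-- The closure of `E` and the inversions of `f⁻¹`. -/
def crossingClosure (f : Equiv.Perm (Fin n)) (E : Fin n → Fin n → Prop) : Fin n → Fin n → Prop :=
  Relation.TransGen fun a b => a < b ∧ (E a b ∨ f⁻¹ b < f⁻¹ a)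

theorem crossingClosure_imp {f : Equiv.Perm (Fin n)} {E : Fin n → Fin n → Prop}
    {A : ℕ → ℕ → Prop} (hA : IncTrans A) (h : ∀ a b : Fin n, a < b → E a b → A a b)
    (h' : ∀ a b : Fin n, a < b → f⁻¹ b < f⁻¹ a → A a b) {a b : Fin n}
    (hab : crossingClosure f E a b) : a < b ∧ A a b := by
  induction hab with
  | single hr => exact ⟨hr.1, hr.2.elim (h _ _ hr.1) (h' _ _ hr.1)⟩
  | tail _ hr ih => exact ⟨ih.1.trans hr.1, hA _ _ _ ih.1 hr.1 ih.2
      (hr.2.elim (h _ _ hr.1) (h' _ _ hr.1))⟩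

/-- A path from `a` to `c` either meets `b` or jumps over it in one step. That step is a pair of one
of two crossing sets and can be split at `b`. -/
theorem crossingClosure_cotrans {f : Equiv.Perm (Fin n)} {E : Fin n → Fin n → Prop}
    (hE : IsCrossingSet E) {a c : Fin n} (h : crossingClosure f E a c) :
    ∀ b, a < b → b < c → crossingClosure f E a b ∨ crossingClosure f E b c := by
  have key : ∀ a b c : Fin n, a < b → b < c → (E a c ∨ f⁻¹ c < f⁻¹ a) →
      crossingClosure f E a b ∨ crossingClosure f E b c := by
    rintro a b c hab hbc (h | h)
    · exact (hE.cotrans a b c hab hbc h).imp (fun h => .single ⟨hab, Or.inl h⟩)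
        fun h => .single ⟨hbc, Or.inl h⟩
    · exact ((isCrossingSet_inversion f⁻¹).cotrans a b c hab hbc h).imp
        (fun h => .single ⟨hab, Or.inr h⟩) fun h => .single ⟨hbc, Or.inr h⟩
  induction h with
  | single hr => exact fun b hab hbc => key _ b _ hab hbc hr.2
  | tail hd hr ih =>
    intro b hab hbc
    rename_i d c
    rcases lt_trichotomy b d with hb | rfl | hb
    · exact (ih b hab hb).imp_right fun h => h.tail hr
    · exact Or.inl hd
    · exact (key d b c hb hbc hr.2).imp_left fun h => Relation.TransGen.trans hd h

/-- The heart of uniqueness. If `E` had a pair not crossed by `u`, consider the closure of `E` and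
the crossings of `u`: it still lies in `crossWord u B`, which is transitive along increasing
indices. Among its pairs not crossed by `u`, descend to one whose strands end at neighbouring
positions `i`, `i + 1`. That pair of positions lies in `B`, so it is crossed by `g`, and normality
says that `u` crosses the two strands, a contradiction. -/
theorem isGreatestCrossing_crossWord {u : List (Fin (n - 1))} (hu : Reduced u)
    {B : ℕ → ℕ → Prop} {g : Equiv.Perm (Fin n)} (hB : IncTrans B) (h : IsGreatestCrossing B g)
    (hp : NormalPair (permOfPositive u) g) :
    IsGreatestCrossing (crossWord u B) (permOfPositive u) := by
  refine ⟨fun a b hab => crossWord_of_inversion hu B hab, fun E hE hEA => ?_⟩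
  have himp := fun {a b} => @crossingClosure_imp n (permOfPositive u) E _ (hB.crossWord u) hEA
    (fun a b hab => crossWord_of_inversion hu B hab) a b
  have hcot := fun {a c} => @crossingClosure_cotrans n (permOfPositive u) E hE a c
  have hinv : ∀ a b, a < b → (permOfPositive u)⁻¹ b < (permOfPositive u)⁻¹ a →
      crossingClosure (permOfPositive u) E a b := fun a b hab h => .single ⟨hab, Or.inr h⟩
  have key : ∀ m : ℕ, ∀ a b : Fin n, crossingClosure (permOfPositive u) E a b →
      ((permOfPositive u)⁻¹ b).val = ((permOfPositive u)⁻¹ a).val + 1 + m → False := by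
    intro m
    induction m using Nat.strong_induction_on with
    | _ m ih =>
      intro a b hab hm
      rcases m with _ | m
      · have hlt := ((permOfPositive u)⁻¹ b).isLt
        let i : Fin (n - 1) := ⟨((permOfPositive u)⁻¹ a).val, by omega⟩
        have h₁ : lo i = (permOfPositive u)⁻¹ a := rfl
        have h₂ : hi i = (permOfPositive u)⁻¹ b := Fin.ext hm.symm
        have hBi := of_crossWord hu (himp hab).1 (Fin.lt_def.2 (by omega)) (himp hab).2
        rw [← h₁, ← h₂] at hBi
        -- A single pair of neighbouring positions is a crossing set, since nothing lies between
        -- them.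
        have hg := h.le (fun x y => x = lo i ∧ y = hi i)
          ⟨by rintro a b c - h ⟨rfl, rfl⟩ ⟨h', -⟩; exact absurd h' (lo_lt_hi i).ne',
            by
              rintro a b c h h' ⟨rfl, rfl⟩
              have h : i.val < b.val := h
              have h' : b.val < i.val + 1 := h'
              omega⟩
          (by rintro a b - ⟨rfl, rfl⟩; exact hBi) (lo i) (hi i) (lo_lt_hi i) ⟨rfl, rfl⟩
        have := hp (lo i) (hi i) rfl hg
        rw [h₁, h₂, perm_apply_inv, perm_apply_inv] at this
        exact lt_asymm this (himp hab).1
      · have hlt := ((permOfPositive u)⁻¹ b).isLt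
        -- Let `c` be the strand that ends immediately after `a`. Wherever it starts, transitivity
        -- or cotransitivity of the closure yields a pair with `c` whose end positions are closer.
        obtain ⟨c, hc⟩ : ∃ c, ((permOfPositive u)⁻¹ c).val =
            ((permOfPositive u)⁻¹ a).val + 1 :=
          ⟨permOfPositive u ⟨((permOfPositive u)⁻¹ a).val + 1, by omega⟩, by
            rw [perm_inv_apply]⟩
        have hca : c ≠ a := by rintro rfl; omega
        have hcb : c ≠ b := by rintro rfl; omega
        rcases lt_or_gt_of_ne hca with hca | hca
        · exact ih m (by omega) c b ((hinv c a hca (Fin.lt_def.2 (by omega))).trans hab) (by omega)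
        · rcases lt_or_gt_of_ne hcb with hcb | hcb
          · rcases hcot hab c hca hcb with h' | h'
            · exact ih 0 (by omega) a c h' (by omega)
            · exact ih m (by omega) c b h' (by omega)
          · exact ih 0 (by omega) a c (hab.trans (hinv b c hcb (Fin.lt_def.2 (by omega))))
              (by omega)
  intro a b hab hab'
  by_contra hcon
  have hne : (permOfPositive u)⁻¹ a ≠ (permOfPositive u)⁻¹ b := fun e =>
    hab.ne ((permOfPositive u)⁻¹.injective e)
  have := Fin.val_ne_of_ne hne
  rw [Fin.lt_def] at hcon
  exact key (((permOfPositive u)⁻¹ b).val - ((permOfPositive u)⁻¹ a).val - 1) a b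
    (.single ⟨hab, Or.inl hab'⟩) (by omega)

/-- Inversion sets are crossing sets, so each of the two is contained in the other, and a
permutation is determined by its inversions. -/
theorem IsGreatestCrossing.unique {A B : ℕ → ℕ → Prop} {f g : Equiv.Perm (Fin n)}
    (hf : IsGreatestCrossing A f) (hg : IsGreatestCrossing B g)
    (h : ∀ a b, a < b → (A a b ↔ B a b)) : f = g := by
  have key : ∀ a b : Fin n, a < b → (f⁻¹ b < f⁻¹ a ↔ g⁻¹ b < g⁻¹ a) := fun a b hab =>
    ⟨hg.le _ (isCrossingSet_inversion f⁻¹) (fun a b hab h' => (h a b hab).1 (hf.mem a b hab h'))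
      a b hab,
    hf.le _ (isCrossingSet_inversion g⁻¹) (fun a b hab h' => (h a b hab).2 (hg.mem a b hab h'))
      a b hab⟩
  -- Equal inversion sets mean that `g⁻¹ * f` preserves the order of neighbours.
  have : f⁻¹ * g = 1 := by
    apply eq_one_of_no_leftDescent
    intro i
    rw [not_leftDescent_iff, mul_inv_rev, inv_inv, Equiv.Perm.mul_apply, Equiv.Perm.mul_apply]
    have hl := lo_lt_hi i
    have hne : f (lo i) ≠ f (hi i) := fun e => hl.ne (f.injective e)
    have hne' : g⁻¹ (f (lo i)) ≠ g⁻¹ (f (hi i)) := fun e => hne (g⁻¹.injective e)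
    rcases lt_or_gt_of_ne hne with h' | h'
    · have := key _ _ h'
      rw [perm_inv_apply, perm_inv_apply] at this
      exact lt_of_le_of_ne (not_lt.1 fun e => lt_asymm hl (this.2 e)) hne'
    · have := key _ _ h'
      rw [perm_inv_apply, perm_inv_apply] at this
      exact this.1 hl
  exact (inv_mul_eq_one.1 this)

/-- The product of the simple braids of a list of permutations. -/
def simpleProd (fs : List (Equiv.Perm (Fin n))) : BraidGroup n := (fs.map simpleBraid).prod

theorem simpleProd_eq_posBraid (fs : List (Equiv.Perm (Fin n))) :
    simpleProd fs = posBraid (fs.flatMap (simpleWord n)) := by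
  induction fs with
  | nil => rfl
  | cons f fs ih =>
    rw [List.flatMap_cons, posBraid_append, ← ih]
    simp [simpleProd, simpleBraid]

/-- The first term becomes an invariant of the braid. The default value 1 represents the empty
sequence, and any permutation forms a normal pair with it. -/
theorem isGreatestCrossing_chain {fs : List (Equiv.Perm (Fin n))} (h : fs.IsChain NormalPair) :
    IncTrans (crossWord (fs.flatMap (simpleWord n)) fun _ _ => False) ∧
    IsGreatestCrossing (crossWord (fs.flatMap (simpleWord n)) fun _ _ => False) (fs.headD 1) := by
  induction fs with
  | nil =>
    refine ⟨by simp [IncTrans, crossWord], ⟨fun a b hab h => ?_, ?_⟩⟩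
    · exact absurd h (lt_asymm hab)
    · intro E _ h' a b hab hE
      exact (h' a b hab hE).elim
  | cons f fs ih =>
    obtain ⟨h₁, h₂⟩ := ih h.tail
    rw [List.flatMap_cons, crossWord_append]
    refine ⟨h₁.crossWord _, ?_⟩
    have := isGreatestCrossing_crossWord (reduced_simpleWord f) h₁ h₂
    rw [permOfPositive_simpleWord] at this
    refine this ?_
    cases fs with
    | nil =>
      intro i j hij hlt
      rw [List.headD_nil, inv_one, Equiv.Perm.one_apply, Equiv.Perm.one_apply, Fin.lt_def] at hlt
      omega
    | cons g fs => exact (List.isChain_cons_cons.1 h).1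

theorem eq_one_of_normalPair_one {g : Equiv.Perm (Fin n)} (h : NormalPair 1 g) : g = 1 :=
  eq_one_of_no_leftDescent fun i hd => lt_asymm (lo_lt_hi i) (h (lo i) (hi i) rfl hd)

/-- After a trivial term only trivial terms can follow, so excluding them at the end excludes them
everywhere. -/
theorem one_notMem_of_chain {fs : List (Equiv.Perm (Fin n))} (h : fs.IsChain NormalPair)
    (hl : fs.getLast? ≠ some 1) : (1 : Equiv.Perm (Fin n)) ∉ fs := by
  induction fs with
  | nil => simp
  | cons f fs ih =>
    cases fs with
    | nil => simpa [eq_comm] using hl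
    | cons g fs =>
      obtain ⟨h₁, h₂⟩ := List.isChain_cons_cons.1 h
      have := ih h₂ (by simpa using hl)
      rw [List.mem_cons, not_or]
      refine ⟨?_, this⟩
      rintro rfl
      rw [eq_one_of_normalPair_one h₁] at this
      simp at this

/-- The invariant `crossWord_eq` identifies the first terms, which are then cancelled in the group.
The absence of 1 excludes sequences of different lengths. -/
theorem eq_of_simpleProd_eq {fs gs : List (Equiv.Perm (Fin n))} (hf : fs.IsChain NormalPair)
    (hg : gs.IsChain NormalPair) (hf' : 1 ∉ fs) (hg' : 1 ∉ gs)
    (h : simpleProd fs = simpleProd gs) : fs = gs := by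
  induction fs generalizing gs with
  | nil =>
    have := (isGreatestCrossing_chain hf).2.unique (isGreatestCrossing_chain hg).2 fun a b =>
      crossWord_eq (by rw [← simpleProd_eq_posBraid, ← simpleProd_eq_posBraid, h])
    cases gs with
    | nil => rfl
    | cons g gs => simp at this; simp [← this] at hg'
  | cons f fs ih =>
    have := (isGreatestCrossing_chain hf).2.unique (isGreatestCrossing_chain hg).2 fun a b =>
      crossWord_eq (by rw [← simpleProd_eq_posBraid, ← simpleProd_eq_posBraid, h])
    cases gs with
    | nil => simp at this; simp [this] at hf'
    | cons g gs =>
      obtain rfl : f = g := by simpa using this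
      have e : fs = gs := ih hf.tail hg.tail (fun e => hf' (List.mem_cons_of_mem _ e))
        (fun e => hg' (List.mem_cons_of_mem _ e)) (by simpa [simpleProd] using h)
      rw [e]

theorem normalPair_halfTwist (g : Equiv.Perm (Fin n)) : NormalPair (halfTwist n) g :=
  fun i j hij _ => halfTwist_lt.2 (Fin.lt_def.2 (by omega))

theorem isChain_replicate_halfTwist (k : ℕ) {fs : List (Equiv.Perm (Fin n))}
    (h : fs.IsChain NormalPair) : (List.replicate k (halfTwist n) ++ fs).IsChain NormalPair := by
  induction k with
  | zero => exact h
  | succ k ih =>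
    rw [List.replicate_succ, List.cons_append]
    exact List.isChain_cons.2 ⟨fun g _ => normalPair_halfTwist g, ih⟩

theorem halfTwist_ne_one (hn : 2 ≤ n) : halfTwist n ≠ 1 := by
  intro h
  have := (@halfTwist_lt n ⟨1, by omega⟩ ⟨0, by omega⟩).2 (Fin.lt_def.2 (by simp))
  rw [h] at this
  simp [Fin.lt_def] at this

theorem toBraid_flatten_replicate (k : ℕ) (w : BraidWord n) :
    toBraid (List.replicate k w).flatten = toBraid w ^ k := by
  induction k with
  | zero => simp [toBraid_nil]
  | succ k ih => rw [List.replicate_succ, List.flatten_cons, toBraid_append, ih, pow_succ']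

theorem toBraid_inverseWord (u : List (Fin (n - 1))) :
    toBraid (inverseWord u) = (posBraid u)⁻¹ := by
  induction u with
  | nil => simp [inverseWord, posBraid, toBraid_nil]
  | cons i u ih =>
    have : inverseWord (i :: u) = inverseWord u ++ [(i, false)] := by simp [inverseWord]
    rw [this, toBraid_append, ih, toBraid_singleton, posBraid_cons, mul_inv_rev]
    simp

theorem toBraid_deltaPower (m : ℤ) : toBraid (deltaPower n m) = deltaBraid n ^ m := by
  cases m with
  | ofNat k =>
    rw [deltaPower, toBraid_flatten_replicate, toBraid_positiveWord]
    simp [deltaBraid]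
  | negSucc k =>
    rw [deltaPower, toBraid_flatten_replicate, toBraid_inverseWord, zpow_negSucc, inv_pow,
      deltaBraid]

theorem toBraid_flatMap_simpleWord (fs : List (Equiv.Perm (Fin n))) :
    toBraid (fs.flatMap fun f => positiveWord (simpleWord n f)) = simpleProd fs := by
  induction fs with
  | nil => simp [simpleProd, toBraid_nil]
  | cons f fs ih =>
    rw [List.flatMap_cons, toBraid_append, ih, toBraid_positiveWord]
    simp [simpleProd, simpleBraid]

/-- The surplus Δᵏ is written as `k` leading half twists, which keep a sequence normal. As `fs` does
not start with a half twist, `k = 0`. -/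
theorem normalForm_unique_aux (hn : 2 ≤ n) {m m' : ℤ} {fs gs : List (Equiv.Perm (Fin n))}
    (hm : m ≤ m') (hf : fs.IsChain NormalPair) (hg : gs.IsChain NormalPair) (hf' : 1 ∉ fs)
    (hg' : 1 ∉ gs) (hd : fs.head? ≠ some (halfTwist n))
    (h : deltaBraid n ^ m * simpleProd fs = deltaBraid n ^ m' * simpleProd gs) :
    m = m' ∧ fs = gs := by
  obtain ⟨k, rfl⟩ := Int.le.dest hm
  rw [zpow_add, mul_assoc] at h
  replace h := mul_left_cancel h
  have e : (deltaBraid n ^ (k : ℤ)) * simpleProd gs =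
      simpleProd (List.replicate k (halfTwist n) ++ gs) := by
    simp [simpleProd, simpleBraid_halfTwist]
  rw [e] at h
  have := eq_of_simpleProd_eq hf (isChain_replicate_halfTwist k hg) hf' (by
    rw [List.mem_append, not_or]
    exact ⟨fun h => halfTwist_ne_one hn (List.eq_of_mem_replicate h).symm, hg'⟩) h
  cases k with
  | zero => simpa using this
  | succ k => rw [this] at hd; simp [List.replicate_succ] at hd

/-- A braid is represented by at most one word in Garside normal form. -/
theorem normalForm_unique {w v : BraidWord n} (hw : IsGarsideNormalForm (simpleWord n) w)
    (hv : IsGarsideNormalForm (simpleWord n) v) (h : toBraid w = toBraid v) : w = v := by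
  rcases lt_or_ge n 2 with hn | hn
  -- Here Δ is trivial and its exponent is not determined, but the empty word is the only word.
  · have : IsEmpty (Fin (n - 1)) := ⟨fun i => by have := i.isLt; omega⟩
    exact Subsingleton.elim _ _
  obtain ⟨m, fs, hf, hd, hl, rfl⟩ := hw
  obtain ⟨m', gs, hg, hd', hl', rfl⟩ := hv
  rw [toBraid_append, toBraid_append, toBraid_deltaPower, toBraid_deltaPower,
    toBraid_flatMap_simpleWord, toBraid_flatMap_simpleWord] at h
  rcases le_total m m' with hm | hm
  · obtain ⟨rfl, rfl⟩ := normalForm_unique_aux hn hm hf hg (one_notMem_of_chain hf hl)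
      (one_notMem_of_chain hg hl') hd h
    rfl
  · obtain ⟨rfl, rfl⟩ := normalForm_unique_aux hn hm hg hf (one_notMem_of_chain hg hl')
      (one_notMem_of_chain hf hl) hd' h.symm
    rfl

end

section

/-! ### Words of natural numbers: extracting descents and normalizing -/

/-- The transposition of `j` and `j + 1`. -/
def swapNat (j x : ℕ) : ℕ := if x = j then j + 1 else if x = j + 1 then j else x

/-- One step of `track`: the letters read, the present positions of the two strands, and whether
their crossing has been found. -/
def trackStep (s : List ℕ × (ℕ × ℕ) × Bool) (j : ℕ) : List ℕ × (ℕ × ℕ) × Bool :=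
  if s.2.2 then (s.1 ++ [j], s.2)
  else if s.2.1.1 = j ∧ s.2.1.2 = j + 1 then (s.1, s.2.1, true)
  else (s.1 ++ [j], (swapNat j s.2.1.1, swapNat j s.2.1.2), false)

/-- Follow the strands that start at `i` and `i + 1`, and remove their first crossing. -/
def track (w : List ℕ) (i : ℕ) : List ℕ := (w.foldl trackStep ([], (i, i + 1), false)).1

/-- Follow the strands that end at `i` and `i + 1`, and remove their last crossing. -/
def trackRight (w : List ℕ) (i : ℕ) : List ℕ := (track w.reverse i).reverse

/-- Move the letter `i` from the second word to the first one if possible. -/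
def moveLetter (x : List ℕ × List ℕ) (i : ℕ) : List ℕ × List ℕ :=
  -- Lengths serve as tests: no crossing to delete on the right means that the first word stays
  -- reduced with `i` appended; a deleted crossing on the left means that `i` splits off from the
  -- second word.
  if (trackRight x.1 i).length = x.1.length ∧ ¬(track x.2 i).length = x.2.length then
    (x.1 ++ [i], track x.2 i)
  else x

/-- Move letters from the second word to the first one. -/
def pairStep (n : ℕ) (x : List ℕ × List ℕ) : List ℕ × List ℕ :=
  (List.range (n - 1)).foldl moveLetter x

/-- One step of `sweep`: the words that are done, in reverse order, and the present one. -/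
def sweepStep (n : ℕ) (s : List (List ℕ) × List ℕ) (w : List ℕ) : List (List ℕ) × List ℕ :=
  ((pairStep n (s.2, w)).1 :: s.1, (pairStep n (s.2, w)).2)

/-- Apply `pairStep` to all pairs of neighbours, from the left to the right. -/
def sweep (n : ℕ) (ws : List (List ℕ)) : List (List ℕ) :=
  if ws.isEmpty then []
  else ((ws.tail.foldl (sweepStep n) ([], ws.headD [])).2 ::
    (ws.tail.foldl (sweepStep n) ([], ws.headD [])).1).reverse

/-- Iterate `sweep` until the sequence of words is normal. -/
def normalizeWords (n : ℕ) (ws : List (List ℕ)) : List (List ℕ) :=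
  -- The exponent is at least `weight ws`, by `weight_le`.
  (sweep n)^[ws.length * ws.flatten.length] ws

/-- Split off the left descents in the order given by a list. -/
def spellNat (l w : List ℕ) : List ℕ :=
  (l.foldl (fun (s : List ℕ × List ℕ) i =>
    if (track s.2 i).length = s.2.length then s else (s.1 ++ [i], track s.2 i)) ([], w)).1

/-! ### Correctness of the algorithms on words -/

variable {n : ℕ}

theorem adj_val_eq_swapNat (i : Fin (n - 1)) (x : Fin n) : (adj i x).val = swapNat i x := adj_val i x

theorem trackStep_found (w acc : List ℕ) (p : ℕ × ℕ) :
    w.foldl trackStep (acc, p, true) = (acc ++ w, p, true) := by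
  induction w generalizing acc with
  | nil => simp
  | cons j w ih =>
    have : trackStep (acc, p, true) j = (acc ++ [j], p, true) := by simp [trackStep]
    rw [List.foldl_cons, this, ih]
    simp

/-- The exchange property: deleting the first crossing of two strands composes the permutation with
the transposition of their starting positions. -/
theorem foldl_trackStep (u : List (Fin (n - 1))) (acc : List ℕ) {a b : Fin n} (hab : a < b) :
    ((permOfPositive u)⁻¹ a < (permOfPositive u)⁻¹ b ∧
      ((u.map Fin.val).foldl trackStep (acc, (a.val, b.val), false)).1 = acc ++ u.map Fin.val) ∨
    ∃ u' : List (Fin (n - 1)), u'.length + 1 = u.length ∧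
      ((u.map Fin.val).foldl trackStep (acc, (a.val, b.val), false)).1 = acc ++ u'.map Fin.val ∧
      permOfPositive u' = Equiv.swap a b * permOfPositive u := by
  induction u generalizing acc a b with
  | nil => exact Or.inl ⟨hab, by simp⟩
  | cons j u ih =>
    rw [List.map_cons, List.foldl_cons]
    by_cases h : a = lo j ∧ b = hi j
    · right
      refine ⟨u, rfl, ?_, ?_⟩
      · have : trackStep (acc, (a.val, b.val), false) j.val = (acc, (a.val, b.val), true) := by
          simp [trackStep, h.1, h.2, lo, hi]
        rw [this, trackStep_found]
      · rw [h.1, h.2, permOfPositive_cons]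
        exact (adj_mul_cancel j _).symm
    · have h' : ¬(a.val = j.val ∧ b.val = j.val + 1) := fun e => h ⟨Fin.ext e.1, Fin.ext e.2⟩
      have : trackStep (acc, (a.val, b.val), false) j.val =
          (acc ++ [j.val], ((adj j a).val, (adj j b).val), false) := by
        rw [adj_val_eq_swapNat, adj_val_eq_swapNat]
        simp [trackStep, h']
      rw [this]
      rcases ih (acc ++ [j.val]) (adj_lt_adj hab h) with ⟨h₁, h₂⟩ | ⟨u', h₁, h₂, h₃⟩
      · left
        rw [permOfPositive_cons, mul_inv_rev, adj_inv, Equiv.Perm.mul_apply, Equiv.Perm.mul_apply]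
        exact ⟨h₁, by rw [h₂]; simp⟩
      · right
        refine ⟨j :: u', by simp [h₁], by rw [h₂]; simp, ?_⟩
        rw [permOfPositive_cons, permOfPositive_cons, h₃, ← mul_assoc, ← mul_assoc,
          Equiv.mul_swap_eq_swap_mul, adj_adj, adj_adj]

/-- For neighbouring strands the transposition is `adj i`. In a reduced word the shorter result
forces a left descent, and counting inversions shows that the result is again reduced. -/
theorem track_spec {u : List (Fin (n - 1))} (hu : Reduced u) (i : Fin (n - 1)) :
    (¬LeftDescent i (permOfPositive u) ∧ track (u.map Fin.val) i = u.map Fin.val) ∨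
    (LeftDescent i (permOfPositive u) ∧ ∃ u' : List (Fin (n - 1)), Reduced u' ∧
      u'.length + 1 = u.length ∧ track (u.map Fin.val) i = u'.map Fin.val ∧
      permOfPositive u = adj i * permOfPositive u') := by
  rcases foldl_trackStep u [] (lo_lt_hi i) with ⟨h₁, h₂⟩ | ⟨u', h₁, h₂, h₃⟩
  · exact Or.inl ⟨not_leftDescent_iff.2 h₁, h₂⟩
  · have h₄ : permOfPositive u' = adj i * permOfPositive u := h₃
    have h₅ := inversions_permOfPositive_le u'
    have hd : LeftDescent i (permOfPositive u) := by
      by_contra hd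
      have := inversions_adj_mul hd
      rw [← h₄] at this
      unfold Reduced at hu
      omega
    have h₆ := inversions_of_leftDescent hd
    rw [← h₄] at h₆
    unfold Reduced at hu
    refine Or.inr ⟨hd, u', ?_, h₁, h₂, ?_⟩
    · unfold Reduced; omega
    · rw [h₄, adj_mul_cancel]

theorem trackRight_spec {u : List (Fin (n - 1))} (hu : Reduced u) (i : Fin (n - 1)) :
    (permOfPositive u (lo i) < permOfPositive u (hi i) ∧
      trackRight (u.map Fin.val) i = u.map Fin.val) ∨
    (permOfPositive u (hi i) < permOfPositive u (lo i) ∧ ∃ u' : List (Fin (n - 1)), Reduced u' ∧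
      u'.length + 1 = u.length ∧ trackRight (u.map Fin.val) i = u'.map Fin.val ∧
      permOfPositive u = permOfPositive u' * adj i) := by
  have e : (u.map Fin.val).reverse = u.reverse.map Fin.val := by simp
  rcases track_spec hu.reverse i with ⟨h₁, h₂⟩ | ⟨h₁, u', h₂, h₃, h₄, h₅⟩
  · left
    rw [not_leftDescent_iff, permOfPositive_reverse, inv_inv] at h₁
    rw [trackRight, e, h₂]
    exact ⟨h₁, by simp⟩
  · right
    rw [LeftDescent, permOfPositive_reverse, inv_inv] at h₁
    refine ⟨h₁, u'.reverse, h₂.reverse, by simpa using h₃, by rw [trackRight, e, h₄]; simp, ?_⟩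
    rw [permOfPositive_reverse] at h₅ ⊢
    rw [← inv_inv (permOfPositive u), h₅, mul_inv_rev, adj_inv]

theorem moveLetter_spec {u v : List (Fin (n - 1))} (hu : Reduced u) (hv : Reduced v)
    (i : Fin (n - 1)) :
    (moveLetter (u.map Fin.val, v.map Fin.val) i = (u.map Fin.val, v.map Fin.val) ∧
      (LeftDescent i (permOfPositive v) → permOfPositive u (hi i) < permOfPositive u (lo i))) ∨
    ∃ u' v' : List (Fin (n - 1)),
      moveLetter (u.map Fin.val, v.map Fin.val) i = (u'.map Fin.val, v'.map Fin.val) ∧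
      Reduced u' ∧ Reduced v' ∧ u'.length = u.length + 1 ∧ v.length = v'.length + 1 ∧
      posBraid u' * posBraid v' = posBraid u * posBraid v := by
  unfold moveLetter
  rcases track_spec hv i with ⟨h₁, h₂⟩ | ⟨h₁, v', h₂, h₃, h₄, h₅⟩
  · left
    rw [h₂]
    exact ⟨by simp, fun h => absurd h h₁⟩
  rcases trackRight_spec hu i with ⟨h₁', h₂'⟩ | ⟨h₁', u', h₂', h₃', h₄', h₅'⟩
  · right
    refine ⟨u ++ [i], v', ?_, hu.concat h₁', h₂, by simp, h₃.symm, ?_⟩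
    · rw [h₂', h₄, if_pos]
      · simp
      · simp; omega
    · have : posBraid v = braidGen i * posBraid v' := by
        rw [← posBraid_cons]
        refine posBraid_eq hv ?_ ?_
        · refine reduced_cons.2 ⟨h₂, ?_⟩
          rw [h₅, leftDescent_adj_mul] at h₁
          exact h₁
        · rw [permOfPositive_cons, h₅]
      rw [this, posBraid_append, mul_assoc]
      simp [posBraid]
  · left
    rw [h₄']
    refine ⟨if_neg ?_, fun _ => h₁'⟩
    simp; omega

theorem foldl_moveLetter_spec (l : List (Fin (n - 1))) {u v : List (Fin (n - 1))} (hu : Reduced u)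
    (hv : Reduced v) : ∃ u' v' : List (Fin (n - 1)),
      (l.map Fin.val).foldl moveLetter (u.map Fin.val, v.map Fin.val) =
        (u'.map Fin.val, v'.map Fin.val) ∧
      Reduced u' ∧ Reduced v' ∧ u'.length + v'.length = u.length + v.length ∧
      v'.length ≤ v.length ∧ posBraid u' * posBraid v' = posBraid u * posBraid v ∧
      (v'.length = v.length → u' = u ∧ v' = v ∧ ∀ i ∈ l, LeftDescent i (permOfPositive v) →
        permOfPositive u (hi i) < permOfPositive u (lo i)) := by
  induction l generalizing u v with
  | nil => exact ⟨u, v, rfl, hu, hv, rfl, le_rfl, rfl, fun _ => ⟨rfl, rfl, by simp⟩⟩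
  | cons i l ih =>
    rw [List.map_cons, List.foldl_cons]
    rcases moveLetter_spec hu hv i with ⟨h₁, h₂⟩ | ⟨u', v', h₁, h₂, h₃, h₄, h₅, h₆⟩
    · rw [h₁]
      obtain ⟨u', v', e₁, e₂, e₃, e₄, e₅, e₆, e₇⟩ := ih hu hv
      refine ⟨u', v', e₁, e₂, e₃, e₄, e₅, e₆, fun h => ?_⟩
      obtain ⟨k₁, k₂, k₃⟩ := e₇ h
      exact ⟨k₁, k₂, fun j hj => (List.mem_cons.1 hj).elim (fun e => e ▸ h₂) (k₃ j)⟩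
    · rw [h₁]
      obtain ⟨u'', v'', e₁, e₂, e₃, e₄, e₅, e₆, e₇⟩ := ih h₂ h₃
      exact ⟨u'', v'', e₁, e₂, e₃, by omega, by omega, e₆.trans h₆, fun h => by omega⟩

theorem finRange_map_val (m : ℕ) : (List.finRange m).map Fin.val = List.range m := by simp

theorem pairStep_spec {u v : List (Fin (n - 1))} (hu : Reduced u) (hv : Reduced v) :
    ∃ u' v' : List (Fin (n - 1)),
      pairStep n (u.map Fin.val, v.map Fin.val) = (u'.map Fin.val, v'.map Fin.val) ∧
      Reduced u' ∧ Reduced v' ∧ u'.length + v'.length = u.length + v.length ∧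
      v'.length ≤ v.length ∧ posBraid u' * posBraid v' = posBraid u * posBraid v ∧
      (v'.length = v.length → u' = u ∧ v' = v ∧
        NormalPair (permOfPositive u) (permOfPositive v)) := by
  obtain ⟨u', v', e₁, e₂, e₃, e₄, e₅, e₆, e₇⟩ := foldl_moveLetter_spec (List.finRange (n - 1)) hu hv
  refine ⟨u', v', ?_, e₂, e₃, e₄, e₅, e₆, fun h => ?_⟩
  · rw [← e₁, finRange_map_val, pairStep]
  · obtain ⟨k₁, k₂, k₃⟩ := e₇ h
    refine ⟨k₁, k₂, fun i j hij hlt => ?_⟩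
    have hlo : i.val < n - 1 := by have := j.isLt; omega
    have e : j = hi ⟨i.val, hlo⟩ := Fin.ext hij
    rw [e] at hlt ⊢
    exact k₃ _ (List.mem_finRange _) hlt

/-- `sweep` as a recursion over the list of words. -/
def sweepFrom (n : ℕ) (w : List ℕ) : List (List ℕ) → List (List ℕ)
  | [] => [w]
  | v :: ws => (pairStep n (w, v)).1 :: sweepFrom n (pairStep n (w, v)).2 ws

theorem foldl_sweepStep (n : ℕ) (ws : List (List ℕ)) (acc : List (List ℕ)) (w : List ℕ) :
    ((ws.foldl (sweepStep n) (acc, w)).2 :: (ws.foldl (sweepStep n) (acc, w)).1).reverse =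
      acc.reverse ++ sweepFrom n w ws := by
  induction ws generalizing acc w with
  | nil => simp [sweepFrom]
  | cons v ws ih =>
    rw [List.foldl_cons, sweepStep, ih, sweepFrom]
    simp

theorem sweep_cons (n : ℕ) (w : List ℕ) (ws : List (List ℕ)) :
    sweep n (w :: ws) = sweepFrom n w ws := by
  have := foldl_sweepStep n ws [] w
  simpa [sweep] using this

/-- The total number of letters of a list of words. -/
def letters {α : Type} (us : List (List α)) : ℕ := us.flatten.length

/-- The sum of the positions of the letters of a list of words. -/
def weight {α : Type} : List (List α) → ℕ
  | [] => 0
  | _ :: us => letters us + weight us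

theorem letters_cons {α : Type} (u : List α) (us : List (List α)) :
    letters (u :: us) = u.length + letters us := by simp [letters]

theorem weight_le {α : Type} (us : List (List α)) : weight us ≤ us.length * letters us := by
  induction us with
  | nil => simp [weight]
  | cons u us ih =>
    rw [weight, letters_cons, List.length_cons]
    nlinarith [Nat.zero_le u.length, Nat.zero_le us.length]

/-- The braid of a list of words. -/
def braidOfWords (us : List (List (Fin (n - 1)))) : BraidGroup n := (us.map posBraid).prod

/-- A list of words is normal. -/
def NormalWords (us : List (List (Fin (n - 1)))) : Prop :=
  (us.map permOfPositive).IsChain NormalPair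

/-- The words over `Fin (n - 1)`, as words of natural numbers. -/
def natWords (us : List (List (Fin (n - 1)))) : List (List ℕ) := us.map (List.map Fin.val)

/-- A letter moved to the left lowers `weight`. If the weight is unchanged, no letter was moved, and
then all neighbours already form normal pairs. -/
theorem sweepFrom_spec {u : List (Fin (n - 1))} {us : List (List (Fin (n - 1)))}
    (hu : Reduced u) (hus : ∀ v ∈ us, Reduced v) : ∃ us' : List (List (Fin (n - 1))),
      sweepFrom n (u.map Fin.val) (natWords us) = natWords us' ∧ (∀ v ∈ us', Reduced v) ∧
      us'.length = us.length + 1 ∧ letters us' = letters (u :: us) ∧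
      weight us' ≤ weight (u :: us) ∧ braidOfWords us' = braidOfWords (u :: us) ∧
      (weight us' = weight (u :: us) → us' = u :: us ∧ NormalWords (u :: us)) := by
  induction us generalizing u with
  | nil => exact ⟨[u], rfl, by simpa using hu, rfl, rfl, le_rfl, rfl, fun _ =>
      ⟨rfl, by simp [NormalWords]⟩⟩
  | cons v us ih =>
    obtain ⟨u', v', e₁, e₂, e₃, e₄, e₅, e₆, e₇⟩ := pairStep_spec hu (hus v (by simp))
    obtain ⟨us', k₁, k₂, k₃, k₄, k₅, k₆, k₇⟩ := ih e₃ fun w hw => hus w (by simp [hw])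
    simp only [weight, letters_cons] at k₄ k₅ k₇
    refine ⟨u' :: us', ?_, ?_, by simp [k₃], ?_, ?_, ?_, ?_⟩
    · simp only [natWords, List.map_cons, sweepFrom]
      rw [e₁]
      exact congrArg _ k₁
    · simpa using ⟨e₂, k₂⟩
    · simp only [letters_cons]; omega
    · simp only [weight, letters_cons]; omega
    · simp only [braidOfWords, List.map_cons, List.prod_cons] at k₆ ⊢
      rw [k₆, ← mul_assoc, ← mul_assoc, e₆]
    · simp only [weight, letters_cons]
      intro h
      obtain ⟨rfl, rfl, hp⟩ := e₇ (by omega)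
      obtain ⟨rfl, hc⟩ := k₇ (by omega)
      refine ⟨rfl, ?_⟩
      simp only [NormalWords, List.map_cons] at hc ⊢
      exact List.isChain_cons_cons.2 ⟨hp, hc⟩

theorem sweep_spec {us : List (List (Fin (n - 1)))} (hus : ∀ v ∈ us, Reduced v) :
    ∃ us' : List (List (Fin (n - 1))),
      sweep n (natWords us) = natWords us' ∧ (∀ v ∈ us', Reduced v) ∧
      us'.length = us.length ∧ letters us' = letters us ∧
      weight us' ≤ weight us ∧ braidOfWords us' = braidOfWords us ∧
      (weight us' = weight us → us' = us ∧ NormalWords us) := by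
  cases us with
  | nil => exact ⟨[], rfl, hus, rfl, rfl, le_rfl, rfl, fun _ => ⟨rfl, by simp [NormalWords]⟩⟩
  | cons u us =>
    obtain ⟨us', h⟩ := sweepFrom_spec (hus u (by simp)) fun v hv =>
      hus v (List.mem_cons_of_mem _ hv)
    exact ⟨us', by rw [← h.1, natWords, List.map_cons, sweep_cons]; rfl, h.2⟩

/-- Each sweep lowers the weight or certifies that the sequence is normal and fixed by all further
sweeps. -/
theorem iterate_sweep_spec {us : List (List (Fin (n - 1)))} (hus : ∀ v ∈ us, Reduced v) {N : ℕ}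
    (hN : weight us ≤ N) : ∃ us' : List (List (Fin (n - 1))),
      (sweep n)^[N] (natWords us) = natWords us' ∧ (∀ v ∈ us', Reduced v) ∧
      us'.length = us.length ∧ letters us' = letters us ∧
      braidOfWords us' = braidOfWords us ∧ NormalWords us' := by
  induction N generalizing us with
  | zero =>
    obtain ⟨us', h₁, h₂, h₃, h₄, h₅, h₆, h₇⟩ := sweep_spec hus
    exact ⟨us, rfl, hus, rfl, rfl, rfl, (h₇ (by omega)).2⟩
  | succ N ih =>
    obtain ⟨us', h₁, h₂, h₃, h₄, h₅, h₆, h₇⟩ := sweep_spec hus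
    rw [Function.iterate_succ_apply, h₁]
    rcases Nat.lt_or_ge (weight us') (weight us) with hlt | hge
    · obtain ⟨us'', k₁, k₂, k₃, k₄, k₅, k₆⟩ := ih h₂ (by omega)
      exact ⟨us'', k₁, k₂, k₃.trans h₃, k₄.trans h₄, k₅.trans h₆, k₆⟩
    · obtain ⟨rfl, hn⟩ := h₇ (by omega)
      have : ∀ k, (sweep n)^[k] (natWords us') = natWords us' := fun k => by
        induction k with
        | zero => rfl
        | succ k ih => rw [Function.iterate_succ_apply, h₁, ih]
      exact ⟨us', this N, hus, rfl, rfl, rfl, hn⟩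

theorem normalizeWords_spec {us : List (List (Fin (n - 1)))} (hus : ∀ v ∈ us, Reduced v) :
    ∃ us' : List (List (Fin (n - 1))),
      normalizeWords n (natWords us) = natWords us' ∧ (∀ v ∈ us', Reduced v) ∧
      us'.length = us.length ∧ letters us' = letters us ∧
      braidOfWords us' = braidOfWords us ∧ NormalWords us' := by
  have e : (natWords us).length * (natWords us).flatten.length = us.length * letters us := by
    have : (natWords us).flatten = us.flatten.map Fin.val := by rw [natWords, List.map_flatten]
    rw [this, letters, List.length_map, natWords, List.length_map]
  rw [normalizeWords, e]
  exact iterate_sweep_spec hus (weight_le us)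

/-- `track` decides left descents and splits them off, so the letters found depend only on the
permutation of the word, although no permutation is computed. -/
theorem spellNat_spec {u : List (Fin (n - 1))} (hu : Reduced u) (l : List (Fin (n - 1))) :
    spellNat (l.map Fin.val) (u.map Fin.val) = (spell l (permOfPositive u)).map Fin.val := by
  have key : ∀ (l u : List (Fin (n - 1))) (acc : List ℕ), Reduced u →
      ((l.map Fin.val).foldl (fun (s : List ℕ × List ℕ) i =>
        if (track s.2 i).length = s.2.length then s else (s.1 ++ [i], track s.2 i))
          (acc, u.map Fin.val)).1 = acc ++ (spell l (permOfPositive u)).map Fin.val := by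
    intro l
    induction l with
    | nil => intro u acc _; simp [spell]
    | cons i l ih =>
      intro u acc hu
      rw [List.map_cons, List.foldl_cons]
      rcases track_spec hu i with ⟨h₁, h₂⟩ | ⟨h₁, v', h₂, h₃, h₄, h₅⟩
      · rw [if_pos (by rw [h₂]), ih u acc hu, spell, if_neg h₁]
      · rw [if_neg (by rw [h₄, List.length_map, List.length_map]; omega)]
        dsimp only
        rw [h₄, ih v' _ h₂, spell, if_pos h₁, h₅, adj_mul_cancel]
        simp
  exact key l u [] hu

end

section

/-! ### Garside normal forms of words of natural numbers -/

/-- Reduced words whose product is the given letter, up to the factor `Δ⁻²` for an inverse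
letter. -/
def letterWords (n : ℕ) (x : ℕ × Bool) : List (List ℕ) :=
  -- The two words for an inverse letter are Δ and Δσᵢ⁻¹; the latter is Δ without the crossing of
  -- the strands that end at `i` and `i + 1`.
  if x.2 then [[x.1]] else [natDelta (n - 1), trackRight (natDelta (n - 1)) x.1]

/-- The normal sequence of a circuit, up to the factor `Δ⁻²` for every inverse letter. -/
def garsideWords (n : ℕ) (C : List (ℕ × Bool)) : List (List ℕ) :=
  normalizeWords n (C.flatMap (letterWords n))

/-- The list of indices that is used for spelling simple braids. -/
def spellIndices (n : ℕ) : List ℕ := (List.replicate (n * n) (List.range (n - 1))).flatten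

/-- The power of `Δ` with exponent `p - m`. -/
def natDeltaPower (n p m : ℕ) : List (ℕ × Bool) :=
  -- Subtraction is truncated: at most one of the two exponents is nonzero.
  (List.replicate (p - m) ((natDelta (n - 1)).map fun i => (i, true))).flatten ++
    (List.replicate (m - p) ((natDelta (n - 1)).reverse.map fun i => (i, false))).flatten

/-- The circuit of a normal sequence and a power `Δ⁻ᵐ`. -/
def assemble (n m : ℕ) (ws : List (List ℕ)) : List (ℕ × Bool) :=
  -- Among reduced words, the half twist is recognized by its maximal length and the identity by
  -- length zero.
  natDeltaPower n (ws.filter fun w => decide (w.length = (natDelta (n - 1)).length)).length m ++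
    (ws.filter fun w => !decide (w.length = 0) &&
      !decide (w.length = (natDelta (n - 1)).length)).flatMap fun w =>
        (spellNat (spellIndices n) w).map fun i => (i, true)

/-- The Garside normal form of a circuit. -/
def garside (n : ℕ) (C : List (ℕ × Bool)) : List (ℕ × Bool) :=
  assemble n (2 * (C.filter fun x => !x.2).length) (garsideWords n C)

/-! ### Correctness of the normal form algorithm -/

variable {n : ℕ}

/-- A braid word, as a word of natural numbers. -/
def natCircuit (C : BraidWord n) : List (ℕ × Bool) := C.map fun x => (x.1.val, x.2)

theorem braidOfWords_append (us vs : List (List (Fin (n - 1)))) :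
    braidOfWords (us ++ vs) = braidOfWords us * braidOfWords vs := by simp [braidOfWords]

theorem reduced_singleton (i : Fin (n - 1)) : Reduced [i] := by
  rw [reduced_cons]
  exact ⟨reduced_nil, not_leftDescent_iff.2 (lo_lt_hi i)⟩

theorem letterWords_spec (x : Fin (n - 1) × Bool) : ∃ us : List (List (Fin (n - 1))),
    letterWords n (x.1.val, x.2) = natWords us ∧ (∀ u ∈ us, Reduced u) ∧ us.length ≤ 2 ∧
    letters us ≤ 2 * (n * n) ∧
    braidOfWords us = (deltaBraid n * deltaBraid n) ^ (if x.2 then 0 else 1) * toBraid [x] := by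
  obtain ⟨i, b⟩ := x
  cases b
  · rw [letterWords, if_neg (by simp), ← deltaWord_map_val]
    have hl := length_deltaWord_le n
    rcases trackRight_spec reduced_deltaWord i with ⟨h₁, -⟩ | ⟨-, u, h₁, h₂, h₃, h₄⟩
    · have : halfTwist n (lo i) < halfTwist n (hi i) := h₁
      rw [halfTwist_lt] at this
      exact absurd this (lo_lt_hi i).not_gt
    · refine ⟨[deltaWord n, u], by rw [h₃]; rfl, by simpa using ⟨reduced_deltaWord, h₁⟩, le_rfl,
        ?_, ?_⟩
      · simp [letters]; omega
      · have : deltaBraid n = posBraid u * braidGen i := by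
          rw [deltaBraid, reduced_deltaWord.posBraid_eq, h₄, h₁.posBraid_eq]
          refine simpleBraid_mul_adj ?_
          have e : permOfPositive u = halfTwist n * adj i := by
            rw [halfTwist, h₄, mul_assoc, adj_mul_self, mul_one]
          rw [e, Equiv.Perm.mul_apply, Equiv.Perm.mul_apply, adj_lo, adj_hi, halfTwist_lt]
          exact lo_lt_hi i
        have e : posBraid u = deltaBraid n * toBraid [(i, false)] := by
          rw [toBraid_singleton, this]
          simp
        simp only [braidOfWords, List.map_cons, List.map_nil, List.prod_cons, List.prod_nil, e]
        simp [deltaBraid, mul_assoc]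
  · refine ⟨[[i]], rfl, by simpa using reduced_singleton i, by simp, ?_, ?_⟩
    · have : 0 < n := by have := i.isLt; omega
      simp only [letters, List.flatten_cons, List.flatten_nil, List.append_nil, List.length_singleton]
      nlinarith
    · rw [toBraid_singleton]
      simp [braidOfWords, posBraid]

/-- The factors Δ² of the inverse letters can be collected in front because Δ² commutes with every
letter. -/
theorem flatMap_letterWords_spec (C : BraidWord n) : ∃ us : List (List (Fin (n - 1))),
    (natCircuit C).flatMap (letterWords n) = natWords us ∧ (∀ u ∈ us, Reduced u) ∧
    us.length ≤ 2 * C.length ∧ letters us ≤ 2 * (n * n) * C.length ∧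
    braidOfWords us =
      (deltaBraid n * deltaBraid n) ^ ((natCircuit C).filter fun x => !x.2).length * toBraid C := by
  induction C with
  | nil => exact ⟨[], rfl, by simp, by simp, by simp [letters], by
      simp [braidOfWords, natCircuit, toBraid_nil]⟩
  | cons x C ih =>
    obtain ⟨us, h₁, h₂, h₃, h₄, h₅⟩ := ih
    obtain ⟨vs, k₁, k₂, k₃, k₄, k₅⟩ := letterWords_spec x
    refine ⟨vs ++ us, ?_, ?_, ?_, ?_, ?_⟩
    · rw [natCircuit, List.map_cons, List.flatMap_cons, k₁]
      simp only [natWords, List.map_append] at h₁ ⊢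
      rw [← h₁]
      rfl
    · intro u hu
      exact (List.mem_append.1 hu).elim (k₂ u) (h₂ u)
    · simp; omega
    · have : letters (vs ++ us) = letters vs + letters us := by simp [letters]
      rw [this, List.length_cons, mul_add]
      omega
    · have e : ((natCircuit (x :: C)).filter fun x => !x.2).length =
          (if x.2 then 0 else 1) + ((natCircuit C).filter fun x => !x.2).length := by
        obtain ⟨i, b⟩ := x
        cases b <;> simp [natCircuit]; omega
      have hc : Commute (deltaBraid n * deltaBraid n) (toBraid [x]) := by
        obtain ⟨i, b⟩ := x
        have := commute_deltaBraid_sq [i]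
        rw [posBraid_cons] at this
        rw [toBraid_singleton]
        cases b
        · simpa [posBraid] using this
        · simpa [posBraid] using this
      have hx : toBraid (x :: C) = toBraid [x] * toBraid C := toBraid_append [x] C
      rw [braidOfWords_append, h₅, k₅, e, pow_add, hx, mul_assoc, mul_assoc,
        ← mul_assoc (toBraid [x]), ← (hc.pow_left _).eq, mul_assoc (_ ^ _) (toBraid [x])]

theorem permOfPositive_eq_one_iff {u : List (Fin (n - 1))} (hu : Reduced u) :
    permOfPositive u = 1 ↔ u.length = 0 := by
  constructor
  · intro h
    rw [hu, h, inversions_one]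
  · intro h
    rw [List.length_eq_zero_iff.1 h, permOfPositive_nil]

theorem permOfPositive_eq_halfTwist_iff {u : List (Fin (n - 1))} (hu : Reduced u) :
    permOfPositive u = halfTwist n ↔ u.length = (deltaWord n).length := by
  constructor
  · intro h
    rw [hu, h, inversions_halfTwist]
  · intro h
    exact eq_halfTwist_of_inversions (by rw [← hu, h])

/-- The terms of a normal sequence other than `Δ` and `1`. -/
def core (fs : List (Equiv.Perm (Fin n))) : List (Equiv.Perm (Fin n)) :=
  fs.filter fun f => !decide (f = 1) && !decide (f = halfTwist n)

/-- Every index is a left descent of the half twist, so normality reverses all neighbours under `f`.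
-/
theorem eq_halfTwist_of_normalPair {f : Equiv.Perm (Fin n)} (h : NormalPair f (halfTwist n)) :
    f = halfTwist n := by
  have : f⁻¹ = halfTwist n := eq_halfTwist_of_leftDescents fun i => by
    rw [LeftDescent, inv_inv]
    exact h (lo i) (hi i) rfl (leftDescent_halfTwist i)
  rw [← inv_inv f, this, halfTwist_inv]

theorem eq_one_of_chain {fs : List (Equiv.Perm (Fin n))} (h : (1 :: fs).IsChain NormalPair) :
    ∀ f ∈ fs, f = 1 := by
  induction fs with
  | nil => simp
  | cons g fs ih =>
    obtain ⟨h₁, h₂⟩ := List.isChain_cons_cons.1 h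
    obtain rfl := eq_one_of_normalPair_one h₁
    intro f hf
    exact (List.mem_cons.1 hf).elim id (ih h₂ f)

theorem core_eq_nil {fs : List (Equiv.Perm (Fin n))} (h : ∀ f ∈ fs, f = 1) : core fs = [] :=
  List.filter_eq_nil_iff.2 fun f hf => by simp [h f hf]

/-- Half twists form an initial segment and identities a final one, so deleting them makes no new
neighbours. -/
theorem isChain_core {fs : List (Equiv.Perm (Fin n))} (h : fs.IsChain NormalPair) :
    (core fs).IsChain NormalPair := by
  induction fs with
  | nil => simp [core]
  | cons f fs ih =>
    by_cases h₁ : f = 1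
    · have : core (f :: fs) = core fs := by simp [core, h₁]
      rw [this]; exact ih h.tail
    by_cases h₂ : f = halfTwist n
    · have : core (f :: fs) = core fs := by simp [core, h₂]
      rw [this]; exact ih h.tail
    have e : core (f :: fs) = f :: core fs := by simp [core, h₁, h₂]
    rw [e]
    refine List.isChain_cons.2 ⟨?_, ih h.tail⟩
    cases fs with
    | nil => simp [core]
    | cons g gs =>
      have hfg := (List.isChain_cons_cons.1 h).1
      by_cases h₃ : g = 1
      · subst h₃
        rw [core_eq_nil (by simpa using eq_one_of_chain h.tail)]
        simp
      have h₄ : g ≠ halfTwist n := by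
        rintro rfl
        exact h₂ (eq_halfTwist_of_normalPair hfg)
      have e : core (g :: gs) = g :: core gs := by simp [core, h₃, h₄]
      rw [e]
      simpa using hfg

theorem simpleBraid_one : simpleBraid (1 : Equiv.Perm (Fin n)) = 1 :=
  reduced_nil.posBraid_eq.symm

/-- The deleted half twists all stand in front, so they contribute exactly a power of Δ on the left.
-/
theorem simpleProd_eq_core {fs : List (Equiv.Perm (Fin n))}
    (h : fs.IsChain NormalPair) : simpleProd fs =
      deltaBraid n ^ (fs.filter fun f => decide (f = halfTwist n)).length * simpleProd (core fs) := by
  induction fs with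
  | nil => simp [core, simpleProd]
  | cons f fs ih =>
    have hs : simpleProd (f :: fs) = simpleBraid f * simpleProd fs := by simp [simpleProd]
    rw [hs, ih h.tail]
    by_cases h₂ : f = halfTwist n
    · have e : core (f :: fs) = core fs := by simp [core, h₂]
      rw [e, h₂, simpleBraid_halfTwist, List.filter_cons_of_pos (by simp), List.length_cons,
        pow_succ', mul_assoc]
    rw [List.filter_cons_of_neg (by simpa using h₂)]
    by_cases h₁ : f = 1
    · have e : core (f :: fs) = core fs := by simp [core, h₁]
      rw [e, h₁, simpleBraid_one, one_mul]
    have e : core (f :: fs) = f :: core fs := by simp [core, h₁, h₂]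
    have key : (fs.filter fun f => decide (f = halfTwist n)) = [] := by
      cases fs with
      | nil => rfl
      | cons g gs =>
        have hfg := (List.isChain_cons_cons.1 h).1
        have hg : g ≠ halfTwist n := by
          rintro rfl
          exact h₂ (eq_halfTwist_of_normalPair hfg)
        have : ∀ (gs : List (Equiv.Perm (Fin n))) (g : Equiv.Perm (Fin n)), g ≠ halfTwist n →
            (g :: gs).IsChain NormalPair → ∀ x ∈ g :: gs, x ≠ halfTwist n := by
          intro gs
          induction gs with
          | nil => intro g hg _; simpa using hg
          | cons g' gs ih =>
            intro g hg hc x hx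
            obtain ⟨hc₁, hc₂⟩ := List.isChain_cons_cons.1 hc
            rcases List.mem_cons.1 hx with rfl | hx
            · exact hg
            · refine ih g' ?_ hc₂ x hx
              rintro rfl
              exact hg (eq_halfTwist_of_normalPair hc₁)
        exact List.filter_eq_nil_iff.2 fun x hx => by simpa using this gs g hg h.tail x hx
    rw [e, key]
    simp [simpleProd]

theorem deltaPower_sub (p m : ℕ) : natCircuit (deltaPower n ((p : ℤ) - m)) = natDeltaPower n p m := by
  have e₁ : (natDelta (n - 1)).map (fun i => (i, true)) =
      (positiveWord (deltaWord n)).map fun x => (x.1.val, x.2) := by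
    rw [← deltaWord_map_val]; simp [positiveWord]
  have e₂ : (natDelta (n - 1)).reverse.map (fun i => (i, false)) =
      (inverseWord (deltaWord n)).map fun x => (x.1.val, x.2) := by
    rw [← deltaWord_map_val]; simp [inverseWord]
  rw [natDeltaPower, e₁, e₂, natCircuit]
  rcases Nat.lt_or_ge p m with h | h
  · obtain ⟨k, rfl⟩ : ∃ k, m = p + (k + 1) := ⟨m - p - 1, by omega⟩
    have : (p : ℤ) - (p + (k + 1) : ℕ) = Int.negSucc k := by omega
    rw [this, deltaPower, Nat.sub_eq_zero_of_le h.le, Nat.add_sub_cancel_left, List.map_flatten,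
      List.map_replicate]
    simp
  · obtain ⟨k, rfl⟩ := Nat.exists_eq_add_of_le h
    have : ((m + k : ℕ) : ℤ) - m = Int.ofNat k := by simp
    rw [this, deltaPower, Nat.sub_eq_zero_of_le h, Nat.add_sub_cancel_left, List.map_flatten,
      List.map_replicate]
    simp

theorem spellNat_spellIndices {u : List (Fin (n - 1))} (hu : Reduced u) :
    spellNat (spellIndices n) (u.map Fin.val) =
      (simpleWord n (permOfPositive u)).map Fin.val := by
  rw [simpleWord, ← spellNat_spec hu, spellIndices, List.map_flatten, List.map_replicate,
    finRange_map_val]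

theorem filter_natWords {us : List (List (Fin (n - 1)))} (c : ℕ → Bool) :
    (natWords us).filter (fun w => c w.length) = natWords (us.filter fun u => c u.length) := by
  rw [natWords, List.filter_map]
  simp [natWords, Function.comp_def]

theorem length_flatMap_simpleWord_le {us : List (List (Fin (n - 1)))} (hus : ∀ u ∈ us, Reduced u)
    (c : List (Fin (n - 1)) → Bool) : (((us.filter c).map permOfPositive).flatMap fun f =>
      positiveWord (simpleWord n f)).length ≤ letters us := by
  induction us with
  | nil => simp
  | cons u us ih =>
    have ih := ih fun v hv => hus v (List.mem_cons_of_mem _ hv)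
    rw [letters_cons, List.filter_cons]
    split_ifs
    · rw [List.map_cons, List.flatMap_cons, List.length_append]
      have : (positiveWord (simpleWord n (permOfPositive u))).length = u.length := by
        rw [positiveWord, List.length_map, (isSimpleSpelling_simpleWord n _).2]
        exact (hus u (by simp)).symm
      omega
    · omega

theorem assemble_spec {us : List (List (Fin (n - 1)))} (hus : ∀ u ∈ us, Reduced u)
    (hc : NormalWords us) (m : ℕ) : ∃ D : BraidWord n,
      assemble n m (natWords us) = natCircuit D ∧ IsGarsideNormalForm (simpleWord n) D ∧
      deltaBraid n ^ m * toBraid D = braidOfWords us ∧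
      D.length ≤ (us.length + m) * (n * n) + letters us := by
  set p := (us.filter fun u => decide (u.length = (deltaWord n).length)).length with hp
  set fs := us.map permOfPositive with hfs
  have hd : (natDelta (n - 1)).length = (deltaWord n).length := by
    rw [← deltaWord_map_val, List.length_map]
  have hcore : core fs = (us.filter fun u => !decide (u.length = 0) &&
      !decide (u.length = (deltaWord n).length)).map permOfPositive := by
    rw [hfs, core, List.filter_map]
    congr 1
    refine List.filter_congr fun u hu => ?_
    simp only [Function.comp, permOfPositive_eq_one_iff (hus u hu),
      permOfPositive_eq_halfTwist_iff (hus u hu)]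
  have hcount : (fs.filter fun f => decide (f = halfTwist n)).length = p := by
    rw [hfs, List.filter_map, List.length_map, hp]
    congr 1
    refine List.filter_congr fun u hu => ?_
    simp only [Function.comp, permOfPositive_eq_halfTwist_iff (hus u hu)]
  refine ⟨deltaPower n ((p : ℤ) - m) ++ (core fs).flatMap fun f => positiveWord (simpleWord n f),
    ?_, ⟨_, core fs, isChain_core hc, ?_, ?_, rfl⟩, ?_, ?_⟩
  · rw [assemble, hd, filter_natWords fun k => decide (k = (deltaWord n).length),
      filter_natWords fun k => !decide (k = 0) && !decide (k = (deltaWord n).length)]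
    have : (natWords (us.filter fun u => decide (u.length = (deltaWord n).length))).length = p := by
      rw [natWords, List.length_map]
    rw [this, ← deltaPower_sub, natCircuit, natCircuit, List.map_append, hcore, natWords,
      List.flatMap_map, List.flatMap_map, List.map_flatMap]
    congr 1
    refine List.flatMap_congr fun u hu => ?_
    rw [spellNat_spellIndices (hus u (List.mem_filter.1 hu).1)]
    simp [positiveWord]
  · intro h
    have := List.mem_of_mem_head? h
    simp [core, halfTwist] at this
  · intro h
    have := List.mem_of_mem_getLast? h
    simp [core] at this
  · have h₁ : braidOfWords us = simpleProd fs := by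
      rw [braidOfWords, simpleProd, hfs, List.map_map]
      congr 1
      exact List.map_congr_left fun u hu => (hus u hu).posBraid_eq
    rw [h₁, simpleProd_eq_core hc, hcount, toBraid_append, toBraid_deltaPower,
      toBraid_flatMap_simpleWord, ← mul_assoc, ← zpow_natCast, ← zpow_add, add_sub_cancel,
      zpow_natCast]
  · have h₁ : (deltaPower n ((p : ℤ) - m)).length ≤ (us.length + m) * (n * n) := by
      have h₂ := congrArg List.length (deltaPower_sub (n := n) p m)
      rw [natCircuit, List.length_map] at h₂
      rw [h₂, natDeltaPower]
      simp only [List.length_append, List.length_flatten, List.map_replicate, List.sum_replicate,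
        List.length_map, List.length_reverse, smul_eq_mul, hd]
      rw [← add_mul]
      have : p ≤ us.length := List.length_filter_le _ _
      exact Nat.mul_le_mul (by omega) (length_deltaWord_le n)
    have h₂ : ((core fs).flatMap fun f => positiveWord (simpleWord n f)).length ≤ letters us := by
      rw [hcore]
      exact length_flatMap_simpleWord_le hus _
    rw [List.length_append]
    omega

theorem garside_spec (C : BraidWord n) : ∃ D : BraidWord n,
    garside n (natCircuit C) = natCircuit D ∧ IsGarsideNormalForm (simpleWord n) D ∧
    toBraid D = toBraid C ∧ D.length ≤ 6 * (n * n) * C.length := by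
  obtain ⟨us, h₁, h₂, h₃, h₄, h₅⟩ := flatMap_letterWords_spec C
  obtain ⟨vs, k₁, k₂, k₃, k₄, k₅, k₆⟩ := normalizeWords_spec h₂
  obtain ⟨D, e₁, e₂, e₃, e₄⟩ := assemble_spec k₂ k₆
    (2 * ((natCircuit C).filter fun x => !x.2).length)
  refine ⟨D, ?_, e₂, ?_, ?_⟩
  · rw [garside, garsideWords, h₁, k₁, e₁]
  · rw [k₅, h₅, pow_mul, pow_two] at e₃
    exact mul_left_cancel e₃
  · have : ((natCircuit C).filter fun x => !x.2).length ≤ C.length := by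
      refine (List.length_filter_le _ _).trans ?_
      simp [natCircuit]
    have h₆ : (vs.length + 2 * ((natCircuit C).filter fun x => !x.2).length) * (n * n) ≤
        (4 * C.length) * (n * n) := Nat.mul_le_mul_right _ (by omega)
    -- The 4 collects at most two words and an exponent of at most two per letter of `C`; the 2
    -- bounds the letters of the words themselves.
    calc D.length ≤ _ := e₄
      _ ≤ (4 * C.length) * (n * n) + 2 * (n * n) * C.length := by omega
      _ = 6 * (n * n) * C.length := by ring

end

/-! ### Polynomial running time of the normal form algorithm -/

open Code

section

theorem Code.size_sublist {α : Type} [Code α] {l l' : List α} (h : l.Sublist l') :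
    size l ≤ size l' := by
  induction h with
  | slnil => exact le_rfl
  | cons a _ ih => rw [size_cons]; omega
  | cons_cons a _ ih => rw [size_cons, size_cons]; omega

theorem Code.size_reverse {α : Type} [Code α] (l : List α) : size l.reverse = size l := by
  induction l with
  | nil => rfl
  | cons a l ih =>
    have := size_append l.reverse [a]
    rw [size_cons a [], size_nil] at this
    rw [List.reverse_cons, size_cons]
    omega

theorem foldl_trackStep_sublist (w acc v : List ℕ) (p : (ℕ × ℕ) × Bool) (h : acc.Sublist v) :
    (w.foldl trackStep (acc, p)).1.Sublist (v ++ w) := by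
  induction w generalizing acc v p with
  | nil => simpa using h
  | cons j w ih =>
    rw [List.foldl_cons, List.append_cons]
    unfold trackStep
    split_ifs
    · exact ih _ _ _ (h.append (List.Sublist.refl _))
    · exact ih _ _ _ (h.trans (List.sublist_append_left _ _))
    · exact ih _ _ _ (h.append (List.Sublist.refl _))

theorem track_sublist (w : List ℕ) (i : ℕ) : (track w i).Sublist w :=
  foldl_trackStep_sublist w [] [] _ (List.Sublist.refl _)

namespace PolyTime

variable {α β : Type} [Code α] [Code β]

theorem swapNat_aux : PolyTime fun x : ℕ × ℕ => _root_.swapNat x.1 x.2 :=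
  ite' (snd.natEq fst) fst.succ (ite' (snd.natEq fst.succ) fst snd)

theorem swapNat {f : α → ℕ} {g : α → ℕ} (hf : PolyTime f) (hg : PolyTime g) :
    PolyTime fun a => _root_.swapNat (f a) (g a) :=
  (swapNat_aux.comp (hf.pair hg)).congr fun _ => rfl

theorem size_trackStep (s : List ℕ × (ℕ × ℕ) × Bool) (j : ℕ) :
    size (trackStep s j) ≤ size s + (size j + 10) := by
  have hs : ∀ x, size (_root_.swapNat j x) ≤ size x + 2 := fun x => by
    rw [size_nat, size_nat]; unfold _root_.swapNat; split_ifs <;> omega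
  obtain ⟨l, ⟨x, y⟩, b⟩ := s
  have h₁ := size_append l [j]
  rw [size_cons j [], size_nil] at h₁
  have h₂ := size_bool true
  have h₃ := size_bool false
  have h₄ := size_pos b
  have h₅ := hs x
  have h₆ := hs y
  unfold trackStep
  split_ifs <;> simp only [size_pair] <;> omega

theorem trackStep_aux : PolyTime fun x : (List ℕ × (ℕ × ℕ) × Bool) × ℕ => _root_.trackStep x.1 x.2 := by
  unfold _root_.trackStep
  refine ite fst.snd'.snd' ((fst.fst'.append (snd.cons (const []))).pair fst.snd') (ite' ?_
    (fst.fst'.pair (fst.snd'.fst'.pair (const true)))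
    ((fst.fst'.append (snd.cons (const []))).pair (((swapNat snd fst.snd'.fst'.fst').pair
      (swapNat snd fst.snd'.fst'.snd')).pair (const false))))
  exact ((fst.snd'.fst'.fst'.natEq snd).and (fst.snd'.fst'.snd'.natEq snd.succ)).congr fun a => by simp

theorem trackStep {f : α → List ℕ × (ℕ × ℕ) × Bool} {g : α → ℕ} (hf : PolyTime f) (hg : PolyTime g) :
    PolyTime fun a => _root_.trackStep (f a) (g a) :=
  (trackStep_aux.comp (hf.pair hg)).congr fun _ => rfl

theorem track_aux : PolyTime fun x : List ℕ × ℕ => _root_.track x.1 x.2 := by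
  unfold _root_.track
  refine (foldl_of_growth (f := fun x : List ℕ × ℕ => x.1)
    (g := fun x => (([] : List ℕ), (x.2, x.2 + 1), false))
    (h := fun _ s j => _root_.trackStep s j) fst
    ((const []).pair ((snd.pair snd.succ).pair (const false)))
    (trackStep fst.snd' snd) ⟨.X + 10, fun a s j hj => ?_⟩).fst'
  refine (size_trackStep s j).trans ?_
  obtain ⟨w, i⟩ := a
  have := size_mem hj
  simp only [Polynomial.eval_add, Polynomial.eval_X, Polynomial.eval_ofNat, size_pair]
  dsimp only at this
  omega

theorem track {f : α → List ℕ} {g : α → ℕ} (hf : PolyTime f) (hg : PolyTime g) :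
    PolyTime fun a => _root_.track (f a) (g a) :=
  (track_aux.comp (hf.pair hg)).congr fun _ => rfl

theorem trackRight_aux : PolyTime fun x : List ℕ × ℕ => _root_.trackRight x.1 x.2 := by
  unfold _root_.trackRight
  exact (track fst.reverse snd).reverse

theorem trackRight {f : α → List ℕ} {g : α → ℕ} (hf : PolyTime f) (hg : PolyTime g) :
    PolyTime fun a => _root_.trackRight (f a) (g a) :=
  (trackRight_aux.comp (hf.pair hg)).congr fun _ => rfl

theorem moveLetter_aux : PolyTime fun x : (List ℕ × List ℕ) × ℕ => _root_.moveLetter x.1 x.2 := by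
  unfold _root_.moveLetter
  refine ite' ?_ ((fst.fst'.append (snd.cons (const []))).pair (track fst.snd' snd)) fst
  exact ((((trackRight fst.fst' snd).length.natEq fst.fst'.length)).and
    ((track fst.snd' snd).length.natEq fst.snd'.length).not).congr fun a => by simp

theorem moveLetter {f : α → List ℕ × List ℕ} {g : α → ℕ} (hf : PolyTime f) (hg : PolyTime g) :
    PolyTime fun a => _root_.moveLetter (f a) (g a) :=
  (moveLetter_aux.comp (hf.pair hg)).congr fun _ => rfl

theorem size_moveLetter (x : List ℕ × List ℕ) (i : ℕ) :
    size (_root_.moveLetter x i) ≤ size x + (size i + 1) := by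
  obtain ⟨u, v⟩ := x
  have h₁ := size_append u [i]
  rw [size_cons i [], size_nil] at h₁
  have h₂ := size_sublist (track_sublist v i)
  unfold _root_.moveLetter
  split_ifs <;> simp only [size_pair] <;> omega

theorem pairStep_aux : PolyTime fun x : ℕ × List ℕ × List ℕ => _root_.pairStep x.1 x.2 := by
  unfold _root_.pairStep
  have hr : PolyTime fun x : ℕ × List ℕ × List ℕ => List.range (x.1 - 1) := fst.pred.range
  obtain ⟨p, hp⟩ := hr.size_le
  refine foldl_of_growth (g := fun x : ℕ × List ℕ × List ℕ => x.2)
    (h := fun _ s j => _root_.moveLetter s j) hr snd (moveLetter fst.snd' snd)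
    ⟨p, fun a s j hj => (size_moveLetter s j).trans ?_⟩
  have := hp a
  have := size_mem hj
  omega

theorem pairStep {f : α → ℕ} {g : α → List ℕ × List ℕ} (hf : PolyTime f) (hg : PolyTime g) :
    PolyTime fun a => _root_.pairStep (f a) (g a) :=
  (pairStep_aux.comp (hf.pair hg)).congr fun _ => rfl

theorem sweepStep_aux : PolyTime fun x : ℕ × (List (List ℕ) × List ℕ) × List ℕ =>
    _root_.sweepStep x.1 x.2.1 x.2.2 := by
  unfold _root_.sweepStep
  have h : PolyTime fun x : ℕ × (List (List ℕ) × List ℕ) × List ℕ =>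
    _root_.pairStep x.1 (x.2.1.2, x.2.2) := pairStep fst (snd.fst'.snd'.pair snd.snd')
  exact (h.fst'.cons snd.fst'.fst').pair h.snd'

theorem sweepStep {f : α → ℕ} {g : α → List (List ℕ) × List ℕ} {h : α → List ℕ} (hf : PolyTime f)
    (hg : PolyTime g) (hh : PolyTime h) : PolyTime fun a => _root_.sweepStep (f a) (g a) (h a) :=
  (sweepStep_aux.comp (hf.pair (hg.pair hh))).congr fun _ => rfl

end PolyTime

/-- Bounds for the number of words, the number of letters and the letters of a list of words. -/
structure WordsBounded (c t M : ℕ) (ws : List (List ℕ)) : Prop where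
  length_le : ws.length ≤ c
  letters_le : letters ws ≤ t
  le : ∀ w ∈ ws, ∀ j ∈ w, j ≤ M

theorem WordsBounded.size_le {c t M : ℕ} {ws : List (List ℕ)} (h : WordsBounded c t M ws) :
    size ws ≤ 1 + 2 * c + t * (2 * M + 2) := by
  have hw : ∀ w : List ℕ, (∀ j ∈ w, j ≤ M) → size w ≤ 1 + w.length * (2 * M + 2) := by
    intro w
    induction w with
    | nil => simp
    | cons j w ih =>
      intro h
      have h₁ := ih fun k hk => h k (List.mem_cons_of_mem _ hk)
      have h₂ := h j (by simp)
      rw [size_cons, size_nat, List.length_cons, add_mul]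
      omega
  have key : ∀ ws : List (List ℕ), (∀ w ∈ ws, ∀ j ∈ w, j ≤ M) →
      size ws ≤ 1 + 2 * ws.length + letters ws * (2 * M + 2) := by
    intro ws
    induction ws with
    | nil => simp
    | cons w ws ih =>
      intro h
      have h₁ := ih fun k hk => h k (List.mem_cons_of_mem _ hk)
      have h₂ := hw w (h w (by simp))
      rw [size_cons, List.length_cons, letters_cons, add_mul]
      omega
  refine (key ws h.le).trans ?_
  have := Nat.mul_le_mul_right (2 * M + 2) h.letters_le
  have := h.length_le
  omega

theorem wordsBounded_size (ws : List (List ℕ)) : WordsBounded (size ws) (size ws) (size ws) ws := by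
  refine ⟨(length_lt_size ws).le, ?_, fun w hw j hj => ?_⟩
  · induction ws with
    | nil => simp [letters]
    | cons w ws ih =>
      have := length_lt_size w
      rw [letters_cons, size_cons]
      omega
  · have h₁ := size_mem hw
    have h₂ := size_mem hj
    rw [size_nat] at h₂
    omega

/-- Arbitrary words of numbers are allowed, because `PolyTime` requires bounds for all inputs,
including those that are not reduced words. -/
theorem moveLetter_bounded {M i : ℕ} (hiM : i ≤ M) {u v : List ℕ} (hu : ∀ j ∈ u, j ≤ M)
    (hv : ∀ j ∈ v, j ≤ M) :
    (moveLetter (u, v) i).1.length + (moveLetter (u, v) i).2.length ≤ u.length + v.length ∧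
    (∀ j ∈ (moveLetter (u, v) i).1, j ≤ M) ∧ ∀ j ∈ (moveLetter (u, v) i).2, j ≤ M := by
  unfold moveLetter
  have hs := track_sublist v i
  split_ifs with h
  · refine ⟨?_, fun j hj => ?_, fun j hj => hv j (hs.subset hj)⟩
    · have h₁ := hs.length_le
      have h₂ : (track v i).length ≠ v.length := h.2
      simp only [List.length_append, List.length_singleton]
      omega
    · rcases List.mem_append.1 hj with hj | hj
      · exact hu j hj
      · rw [List.mem_singleton.1 hj]; exact hiM
  · exact ⟨le_rfl, hu, hv⟩

theorem pairStep_bounded {n M : ℕ} (hn : n ≤ M) {u v : List ℕ} (hu : ∀ j ∈ u, j ≤ M)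
    (hv : ∀ j ∈ v, j ≤ M) :
    (pairStep n (u, v)).1.length + (pairStep n (u, v)).2.length ≤ u.length + v.length ∧
    (∀ j ∈ (pairStep n (u, v)).1, j ≤ M) ∧ ∀ j ∈ (pairStep n (u, v)).2, j ≤ M := by
  have key : ∀ (l : List ℕ) (x : List ℕ × List ℕ), (∀ i ∈ l, i ≤ M) → (∀ j ∈ x.1, j ≤ M) →
      (∀ j ∈ x.2, j ≤ M) →
      (l.foldl moveLetter x).1.length + (l.foldl moveLetter x).2.length ≤
        x.1.length + x.2.length ∧
      (∀ j ∈ (l.foldl moveLetter x).1, j ≤ M) ∧ ∀ j ∈ (l.foldl moveLetter x).2, j ≤ M := by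
    intro l
    induction l with
    | nil => exact fun x _ h₁ h₂ => ⟨le_rfl, h₁, h₂⟩
    | cons i l ih =>
      intro x hl h₁ h₂
      obtain ⟨k₁, k₂, k₃⟩ := moveLetter_bounded (hl i (by simp)) h₁ h₂
      obtain ⟨e₁, e₂⟩ := ih (moveLetter x i) (fun k hk => hl k (List.mem_cons_of_mem _ hk)) k₂ k₃
      exact ⟨e₁.trans k₁, e₂⟩
  exact key _ (u, v) (fun i h => by rw [List.mem_range] at h; omega) hu hv

theorem sweepFrom_bounded {n M : ℕ} (hn : n ≤ M) {c t : ℕ} {w : List ℕ} {ws : List (List ℕ)}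
    (h : WordsBounded c t M (w :: ws)) : WordsBounded c t M (sweepFrom n w ws) := by
  induction ws generalizing w c t with
  | nil => exact h
  | cons v ws ih =>
    obtain ⟨h₁, h₂, h₃⟩ := h
    obtain ⟨k₁, k₂, k₃⟩ := pairStep_bounded hn (h₃ w (by simp)) (h₃ v (by simp))
    simp only [letters_cons, List.length_cons] at h₁ h₂
    have hb : WordsBounded (c - 1) (t - (pairStep n (w, v)).1.length) M
        ((pairStep n (w, v)).2 :: ws) := by
      refine ⟨by simp only [List.length_cons]; omega, by simp only [letters_cons]; omega, ?_⟩
      intro x hx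
      rcases List.mem_cons.1 hx with rfl | hx
      · exact k₃
      · exact h₃ x (by simp [hx])
    obtain ⟨e₁, e₂, e₃⟩ := ih hb
    rw [sweepFrom]
    refine ⟨by simp only [List.length_cons]; omega, by simp only [letters_cons]; omega, ?_⟩
    intro x hx
    rcases List.mem_cons.1 hx with rfl | hx
    · exact k₂
    · exact e₃ x hx

theorem sweep_bounded {n M c t : ℕ} (hn : n ≤ M) {ws : List (List ℕ)} (h : WordsBounded c t M ws) :
    WordsBounded c t M (sweep n ws) := by
  cases ws with
  | nil => exact h
  | cons w ws => rw [sweep_cons]; exact sweepFrom_bounded hn h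

theorem iterate_sweep_bounded {n M c t : ℕ} (hn : n ≤ M) {ws : List (List ℕ)}
    (h : WordsBounded c t M ws) (k : ℕ) : WordsBounded c t M ((sweep n)^[k] ws) := by
  induction k with
  | zero => exact h
  | succ k ih => rw [Function.iterate_succ_apply']; exact sweep_bounded hn ih

theorem WordsBounded.mono {c t M c' t' M' : ℕ} {ws : List (List ℕ)} (h : WordsBounded c t M ws)
    (hc : c ≤ c') (ht : t ≤ t') (hM : M ≤ M') : WordsBounded c' t' M' ws :=
  ⟨h.1.trans hc, h.2.trans ht, fun w hw j hj => (h.3 w hw j hj).trans hM⟩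

namespace PolyTime

variable {α β : Type} [Code α] [Code β]

theorem le_size_pair (n : ℕ) (a : α) : n ≤ size (n, a) ∧ size a ≤ size (n, a) := by
  rw [size_pair, size_nat]; omega

theorem sweep_aux : PolyTime fun x : ℕ × List (List ℕ) => _root_.sweep x.1 x.2 := by
  unfold _root_.sweep
  have h : PolyTime fun x : ℕ × List (List ℕ) =>
      x.2.tail.foldl (_root_.sweepStep x.1) ([], x.2.headD []) := by
    refine foldl (f := fun x : ℕ × List (List ℕ) => x.2.tail)
      (g := fun x : ℕ × List (List ℕ) => (([] : List (List ℕ)), x.2.headD []))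
      (h := fun x => _root_.sweepStep x.1) snd.tail ((const []).pair (snd.headD (const [])))
      (sweepStep fst.fst'.fst' fst.snd' snd)
      ⟨1 + 2 * (.X + 2) + (.X + 2) * (2 * (.X + 2) + 2), fun a l hl => ?_⟩
    obtain ⟨n, ws⟩ := a
    obtain ⟨hn, hw⟩ := le_size_pair n ws
    have h₁ := foldl_sweepStep n l [] (ws.headD [])
    set s := l.foldl (_root_.sweepStep n) ([], ws.headD []) with hs
    -- The intermediate state is, up to reversal, the list that a sweep of the words read so far
    -- returns, and sweeping preserves the bounds.
    have h₂ : size s = size (sweepFrom n (ws.headD []) l) := by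
      have : size s = size (s.2 :: s.1) := by
        obtain ⟨s₁, s₂⟩ := s
        rw [size_pair, size_cons, add_comm (size s₁)]
      rw [this, ← size_reverse, h₁]
      simp
    have hb : WordsBounded (size (n, ws) + 2) (size (n, ws) + 2) (size (n, ws) + 2)
        (ws.headD [] :: l) := by
      have hw' := (wordsBounded_size ws).mono hw hw hw
      cases ws with
      | nil =>
        obtain rfl : l = [] := by simpa using hl
        exact ⟨by simp, by simp [letters], by simp⟩
      | cons w ws =>
        have hl : l <+: ws := hl
        obtain ⟨l', rfl⟩ := hl
        obtain ⟨e₁, e₂, e₃⟩ := hw'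
        simp only [letters, List.length_cons, List.length_append, List.flatten_cons,
          List.flatten_append] at e₁ e₂
        refine ⟨by simp only [List.headD_cons, List.length_cons]; omega, ?_, ?_⟩
        · simp only [letters, List.headD_cons, List.flatten_cons, List.length_append]
          omega
        · intro x hx j hj
          refine (e₃ x ?_ j hj).trans (by omega)
          rw [← List.cons_append]
          exact List.mem_append_left _ hx
    have h₃ := (sweepFrom_bounded (n := n) (by omega) hb).size_le
    rw [← h₂] at h₃
    simpa using h₃
  exact ite snd.isEmpty (const []) (h.snd'.cons h.fst').reverse

theorem sweep {f : α → ℕ} {g : α → List (List ℕ)} (hf : PolyTime f) (hg : PolyTime g) :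
    PolyTime fun a => _root_.sweep (f a) (g a) :=
  (sweep_aux.comp (hf.pair hg)).congr fun _ => rfl

/-- The sizes do not accumulate over the iteration: a sweep increases neither the number of words
nor that of letters, and its new indices are below `n`. -/
theorem normalizeWords_aux : PolyTime fun x : ℕ × List (List ℕ) => _root_.normalizeWords x.1 x.2 := by
  unfold _root_.normalizeWords
  refine iterate (n := fun x : ℕ × List (List ℕ) => x.2.length * x.2.flatten.length)
    (g := fun x => x.2) (h := fun x => _root_.sweep x.1) (snd.length.mul ?_) snd
    (sweep fst.fst' snd) ⟨1 + 2 * .X + .X * (2 * .X + 2), fun a i _ => ?_⟩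
  · exact ((snd.flatMap (g := fun _ w => w) snd).congr fun a => by simp).length
  · obtain ⟨n, ws⟩ := a
    obtain ⟨hn, hw⟩ := le_size_pair n ws
    have := (iterate_sweep_bounded hn ((wordsBounded_size ws).mono hw hw hw) i).size_le
    simpa using this

theorem normalizeWords {f : α → ℕ} {g : α → List (List ℕ)} (hf : PolyTime f) (hg : PolyTime g) :
    PolyTime fun a => _root_.normalizeWords (f a) (g a) :=
  (normalizeWords_aux.comp (hf.pair hg)).congr fun _ => rfl

theorem spellNat_aux : PolyTime fun x : List ℕ × List ℕ => _root_.spellNat x.1 x.2 := by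
  unfold _root_.spellNat
  refine (foldl_of_growth (f := fun x : List ℕ × List ℕ => x.1)
    (g := fun x => (([] : List ℕ), x.2))
    (h := fun _ (s : List ℕ × List ℕ) i => if (_root_.track s.2 i).length = s.2.length then s
      else (s.1 ++ [i], _root_.track s.2 i)) fst ((const []).pair snd) ?_
      ⟨.X, fun a s j hj => ?_⟩).fst'
  · have h : PolyTime fun x : ((List ℕ × List ℕ) × (List ℕ × List ℕ)) × ℕ =>
      _root_.track x.1.2.2 x.2 := track fst.snd'.snd' snd
    exact ite' (h.length.natEq fst.snd'.snd'.length) fst.snd'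
      ((fst.snd'.fst'.append (snd.cons (const []))).pair h)
  · obtain ⟨l, w⟩ := a
    obtain ⟨u, v⟩ := s
    have h₀ := size_mem hj
    have h₁ := size_append u [j]
    rw [size_cons j [], size_nil] at h₁
    have h₂ := size_sublist (track_sublist v j)
    simp only [Polynomial.eval_X, size_pair]
    dsimp only at h₀ ⊢
    split_ifs <;> simp only [size_pair] <;> omega

theorem spellNat {f : α → List ℕ} {g : α → List ℕ} (hf : PolyTime f) (hg : PolyTime g) :
    PolyTime fun a => _root_.spellNat (f a) (g a) :=
  (spellNat_aux.comp (hf.pair hg)).congr fun _ => rfl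

theorem flatten {f : α → List (List β)} (hf : PolyTime f) : PolyTime fun a => (f a).flatten :=
  (hf.flatMap (g := fun _ w => w) snd).congr fun a => by simp

theorem natDelta {f : α → ℕ} (hf : PolyTime f) : PolyTime fun a => _root_.natDelta (f a) :=
  hf.range.flatMap (g := fun _ k => (List.range (k + 1)).reverse) snd.succ.range.reverse

theorem letterWords_aux : PolyTime fun x : ℕ × ℕ × Bool => _root_.letterWords x.1 x.2 := by
  unfold _root_.letterWords
  exact ite snd.snd' ((snd.fst'.cons (const [])).cons (const []))
    (fst.pred.natDelta.cons ((trackRight fst.pred.natDelta snd.fst').cons (const [])))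

theorem letterWords {f : α → ℕ} {g : α → ℕ × Bool} (hf : PolyTime f) (hg : PolyTime g) :
    PolyTime fun a => _root_.letterWords (f a) (g a) :=
  (letterWords_aux.comp (hf.pair hg)).congr fun _ => rfl

theorem garsideWords_aux : PolyTime fun x : ℕ × List (ℕ × Bool) => _root_.garsideWords x.1 x.2 := by
  unfold _root_.garsideWords
  have h : PolyTime fun x : ℕ × List (ℕ × Bool) => x.2.flatMap (_root_.letterWords x.1) :=
    flatMap (f := fun x : ℕ × List (ℕ × Bool) => x.2) (g := fun x y => _root_.letterWords x.1 y) snd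
      (letterWords fst.fst' snd)
  exact normalizeWords fst h

theorem garsideWords {f : α → ℕ} {g : α → List (ℕ × Bool)} (hf : PolyTime f) (hg : PolyTime g) :
    PolyTime fun a => _root_.garsideWords (f a) (g a) :=
  (garsideWords_aux.comp (hf.pair hg)).congr fun _ => rfl

theorem spellIndices {f : α → ℕ} (hf : PolyTime f) :
    PolyTime fun a => _root_.spellIndices (f a) := by
  unfold _root_.spellIndices
  exact ((hf.mul hf).replicate hf.pred.range).flatten

theorem natDeltaPower_aux : PolyTime fun x : ℕ × ℕ × ℕ => _root_.natDeltaPower x.1 x.2.1 x.2.2 := by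
  unfold _root_.natDeltaPower
  have h₁ : PolyTime fun x : ℕ × ℕ × ℕ => (_root_.natDelta (x.1 - 1)).map fun i => (i, true) :=
    map (f := fun x : ℕ × ℕ × ℕ => _root_.natDelta (x.1 - 1)) (g := fun _ i => (i, true))
      fst.pred.natDelta (snd.pair (const true))
  have h₂ : PolyTime fun x : ℕ × ℕ × ℕ =>
      (_root_.natDelta (x.1 - 1)).reverse.map fun i => (i, false) :=
    map (f := fun x : ℕ × ℕ × ℕ => (_root_.natDelta (x.1 - 1)).reverse) (g := fun _ i => (i, false))
      fst.pred.natDelta.reverse (snd.pair (const false))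
  exact ((snd.fst'.sub snd.snd').replicate h₁).flatten.append
    ((snd.snd'.sub snd.fst').replicate h₂).flatten

theorem natDeltaPower {f : α → ℕ} {g : α → ℕ} {h : α → ℕ} (hf : PolyTime f)
    (hg : PolyTime g) (hh : PolyTime h) : PolyTime fun a => _root_.natDeltaPower (f a) (g a) (h a) :=
  (natDeltaPower_aux.comp (hf.pair (hg.pair hh))).congr fun _ => rfl

theorem assemble_aux : PolyTime fun x : ℕ × ℕ × List (List ℕ) => _root_.assemble x.1 x.2.1 x.2.2 := by
  unfold _root_.assemble
  have hd : PolyTime fun x : (ℕ × ℕ × List (List ℕ)) × List ℕ =>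
      decide (x.2.length = (_root_.natDelta (x.1.1 - 1)).length) :=
    natEq snd.length fst.fst'.pred.natDelta.length
  have h₀ : PolyTime fun x : (ℕ × ℕ × List (List ℕ)) × List ℕ => decide (x.2.length = 0) :=
    natEq snd.length (const 0)
  have h₁ : PolyTime fun x : ℕ × ℕ × List (List ℕ) =>
      x.2.2.filter fun w => decide (w.length = (_root_.natDelta (x.1 - 1)).length) :=
    filter (f := fun x : ℕ × ℕ × List (List ℕ) => x.2.2)
      (c := fun x w => decide (w.length = (_root_.natDelta (x.1 - 1)).length)) snd.snd' hd
  have h₂ : PolyTime fun x : ℕ × ℕ × List (List ℕ) =>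
      x.2.2.filter fun w => !decide (w.length = 0) &&
        !decide (w.length = (_root_.natDelta (x.1 - 1)).length) :=
    filter (f := fun x : ℕ × ℕ × List (List ℕ) => x.2.2)
      (c := fun x w => !decide (w.length = 0) &&
        !decide (w.length = (_root_.natDelta (x.1 - 1)).length)) snd.snd' (h₀.not.and hd.not)
  have hs : PolyTime fun x : (ℕ × ℕ × List (List ℕ)) × List ℕ =>
      _root_.spellNat (_root_.spellIndices x.1.1) x.2 := spellNat fst.fst'.spellIndices snd
  have h₃ : PolyTime fun x : (ℕ × ℕ × List (List ℕ)) × List ℕ =>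
      (_root_.spellNat (_root_.spellIndices x.1.1) x.2).map fun i => (i, true) :=
    hs.map (g := fun _ i => (i, true)) (snd.pair (const true))
  have h₄ := h₂.flatMap
    (g := fun x w => (_root_.spellNat (_root_.spellIndices x.1) w).map fun i => (i, true)) h₃
  have h₅ := natDeltaPower fst h₁.length snd.fst'
  exact h₅.append h₄

theorem assemble {f : α → ℕ} {g : α → ℕ} {h : α → List (List ℕ)} (hf : PolyTime f)
    (hg : PolyTime g) (hh : PolyTime h) : PolyTime fun a => _root_.assemble (f a) (g a) (h a) :=
  (assemble_aux.comp (hf.pair (hg.pair hh))).congr fun _ => rfl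

theorem garside_aux : PolyTime fun x : ℕ × List (ℕ × Bool) => _root_.garside x.1 x.2 := by
  unfold _root_.garside
  have h : PolyTime fun x : ℕ × List (ℕ × Bool) => x.2.filter fun y => !y.2 :=
    filter (f := fun x : ℕ × List (ℕ × Bool) => x.2) (c := fun _ y => !y.2) snd snd.snd'.not
  exact assemble fst ((const 2).mul h.length) (garsideWords fst snd)

theorem garside {f : α → ℕ} {g : α → List (ℕ × Bool)} (hf : PolyTime f) (hg : PolyTime g) :
    PolyTime fun a => _root_.garside (f a) (g a) :=
  (garside_aux.comp (hf.pair hg)).congr fun _ => rfl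

end PolyTime

/-! ### Input and output -/

/-- Read one symbol of the code of a circuit, from the right to the left. -/
def parseStep (s : ℕ × List (ℕ × Bool)) (x : CircuitSymbol) : ℕ × List (ℕ × Bool) :=
  -- The first component counts the ticks since the last sign. Read from the right, they are the
  -- index of the letter whose sign comes next, and finally the number of strands.
  match x with
  | .tick => (s.1 + 1, s.2)
  | .pos => (0, (s.1, true) :: s.2)
  | .neg => (0, (s.1, false) :: s.2)

/-- Read the code of a circuit. -/
def parse (l : List CircuitSymbol) : ℕ × List (ℕ × Bool) := l.reverse.foldl parseStep (0, [])

/-- Write the code of a circuit. -/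
def printCircuit (n : ℕ) (C : List (ℕ × Bool)) : List CircuitSymbol :=
  List.replicate n .tick ++ C.flatMap fun x =>
    (if x.2 then .pos else .neg) :: List.replicate x.1 .tick

theorem foldr_parseStep_replicate (k : ℕ) (s : ℕ × List (ℕ × Bool)) :
    (List.replicate k CircuitSymbol.tick).foldr (fun x s => parseStep s x) s = (s.1 + k, s.2) := by
  induction k with
  | zero => rfl
  | succ k ih => rw [List.replicate_succ, List.foldr_cons, ih]; simp [parseStep]; omega

theorem parse_encodeCircuit {n : ℕ} (C : BraidWord n) :
    parse (encodeCircuit ⟨n, C⟩) = (n, natCircuit C) := by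
  have key : (C.flatMap encodeLetter).foldr (fun x s => parseStep s x) (0, []) =
      (0, natCircuit C) := by
    induction C with
    | nil => rfl
    | cons x C ih =>
      obtain ⟨i, b⟩ := x
      rw [List.flatMap_cons, List.foldr_append, ih, encodeLetter, List.foldr_cons,
        foldr_parseStep_replicate]
      cases b <;> simp [parseStep, natCircuit]
  rw [parse, List.foldl_reverse, encodeCircuit, List.foldr_append, key, foldr_parseStep_replicate]
  simp

theorem printCircuit_natCircuit {n : ℕ} (C : BraidWord n) :
    printCircuit n (natCircuit C) = encodeCircuit ⟨n, C⟩ := by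
  rw [printCircuit, natCircuit, List.flatMap_map]
  rfl

namespace PolyTime

variable {α : Type} [Code α]

/-- A symbol, as a list of lists with the same code. -/
def symbolList : CircuitSymbol → List (List Unit)
  | .tick => []
  | .pos => [[]]
  | .neg => [[()]]

theorem parseStep_aux : PolyTime fun x : (ℕ × List (ℕ × Bool)) × CircuitSymbol =>
    _root_.parseStep x.1 x.2 := by
  have h : PolyTime symbolList := of_code_eq fun x => by cases x <;> rfl
  have hs : PolyTime fun x : (ℕ × List (ℕ × Bool)) × CircuitSymbol => symbolList x.2 := h.comp snd
  refine (ite hs.isEmpty (fst.fst'.succ.pair fst.snd') ((const 0).pair ((fst.fst'.pair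
    (hs.headD (const [])).isEmpty).cons fst.snd'))).congr ?_
  rintro ⟨s, x⟩
  cases x <;> rfl

theorem parseStep {f : α → ℕ × List (ℕ × Bool)} {g : α → CircuitSymbol} (hf : PolyTime f) (hg : PolyTime g) :
    PolyTime fun a => _root_.parseStep (f a) (g a) :=
  (parseStep_aux.comp (hf.pair hg)).congr fun _ => rfl

theorem parse : PolyTime _root_.parse := by
  refine foldl_of_growth (f := fun l : List CircuitSymbol => l.reverse)
    (g := fun _ => ((0 : ℕ), ([] : List (ℕ × Bool)))) (h := fun _ s x => _root_.parseStep s x)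
    id.reverse (const (0, [])) (parseStep fst.snd' snd) ⟨10, fun a s x _ => ?_⟩
  obtain ⟨k, C⟩ := s
  have h₁ := size_bool true
  have h₂ := size_bool false
  simp only [Polynomial.eval_ofNat]
  cases x <;> simp only [_root_.parseStep, size_pair, size_cons, size_nat] <;> omega

theorem printCircuit_aux : PolyTime fun x : ℕ × List (ℕ × Bool) => _root_.printCircuit x.1 x.2 := by
  unfold _root_.printCircuit
  have h : PolyTime fun x : (ℕ × List (ℕ × Bool)) × ℕ × Bool =>
      (if x.2.2 then CircuitSymbol.pos else .neg) :: List.replicate x.2.1 CircuitSymbol.tick :=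
    (ite snd.snd' (const CircuitSymbol.pos) (const CircuitSymbol.neg)).cons
      (snd.fst'.replicate (const CircuitSymbol.tick))
  exact (fst.replicate (const CircuitSymbol.tick)).append (snd.flatMap
    (g := fun _ (y : ℕ × Bool) =>
      (if y.2 then CircuitSymbol.pos else .neg) :: List.replicate y.1 CircuitSymbol.tick) h)

theorem printCircuit {f : α → ℕ} {g : α → List (ℕ × Bool)} (hf : PolyTime f) (hg : PolyTime g) :
    PolyTime fun a => _root_.printCircuit (f a) (g a) :=
  (printCircuit_aux.comp (hf.pair hg)).congr fun _ => rfl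

end PolyTime

/-- Every family of maps on braid words that is given by `garside` can be computed in polynomial
time. -/
theorem computableInPolyTime_of_garside {O : ∀ n : ℕ, BraidWord n → BraidWord n}
    (h : ∀ n C, garside n (natCircuit C) = natCircuit (O n C)) :
    Nonempty (Turing.TM2ComputableInPolyTime encodeCircuit encodeCircuit
      (fun C : Σ n : ℕ, BraidWord n => (⟨C.1, O C.1 C.2⟩ : Σ n : ℕ, BraidWord n))) := by
  refine PolyTime.computableInPolyTime _ _ _ (F := fun l =>
    printCircuit (parse l).1 (garside (parse l).1 (parse l).2)) ?_ ?_
  · exact PolyTime.printCircuit PolyTime.parse.fst'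
      (PolyTime.garside PolyTime.parse.fst' PolyTime.parse.snd')
  · rintro ⟨n, C⟩
    simp only [parse_encodeCircuit, h, printCircuit_natCircuit]

end

section

/-! ### Obfuscation by normal forms -/

theorem evalCircuit_eq_of_toBraid {n : ℕ} {H : Type*} [Group H] {g : Fin (n - 1) → H}
    (h : SatisfiesBraidRelations g) {C D : BraidWord n} (e : toBraid C = toBraid D) :
    evalCircuit g C = evalCircuit g D := by
  obtain ⟨φ, hφ⟩ := exists_braidGroup_hom h
  rw [← hφ, ← hφ, e]

/-- All properties but the slowdown reduce to braids: equal braids give equal transformations, and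
`O` chooses one word for each braid. Only a monoid with an inversion is assumed, so that square
matrices are covered. -/
theorem isIndistinguishabilityObfuscator_of_toBraid {n : ℕ} {M : Type*} [Monoid M] [Inv M]
    {g : Fin (n - 1) → M} {O : BraidWord n → BraidWord n}
    (hg : ∀ C D : BraidWord n, toBraid C = toBraid D → evalCircuit g C = evalCircuit g D)
    (hO : ∀ C, toBraid (O C) = toBraid C) (hO' : ∀ C D, toBraid C = toBraid D → O C = O D)
    (p : Polynomial ℕ) (hp : ∀ C, (O C).length ≤ p.eval C.length) :
    IsIndistinguishabilityObfuscator g (braidRelations n) Set.univ O where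
  relations_hold _ hr := hg _ _ (toBraid_eq_of_relation hr)
  functionality C _ := hg _ _ (hO C)
  polynomial_slowdown := ⟨p, fun C _ => hp C⟩
  indistinguishability C _ D _ h := hO' C D (toBraid_eq_of_differByRelations h)

/-! ### The classical gates -/

section Classical

variable {G : Type*} [Group G] {n : ℕ}

theorem classicalGate_apply (i : Fin (n - 1)) (x : Fin n → G) (k : Fin n) :
    classicalGate G n i x k = if k.val = i.val then x (hi i)
      else if k.val = i.val + 1 then (x (hi i))⁻¹ * x (lo i) * x (hi i) else x k := rfl

theorem classicalGate_lo (i : Fin (n - 1)) (x : Fin n → G) :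
    classicalGate G n i x (lo i) = x (hi i) := by simp [classicalGate_apply, lo]

theorem classicalGate_hi (i : Fin (n - 1)) (x : Fin n → G) :
    classicalGate G n i x (hi i) = (x (hi i))⁻¹ * x (lo i) * x (hi i) := by
  simp [classicalGate_apply, hi]

theorem classicalGate_of_ne {i : Fin (n - 1)} {k : Fin n} (h : k ≠ lo i) (h' : k ≠ hi i)
    (x : Fin n → G) : classicalGate G n i x k = x k := by
  rw [classicalGate_apply, if_neg (show ¬k.val = i.val from fun e => h (Fin.ext e)),
    if_neg (show ¬k.val = i.val + 1 from fun e => h' (Fin.ext e))]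

theorem classicalGate_comm {i j : Fin (n - 1)} (h : i.val + 2 ≤ j.val ∨ j.val + 2 ≤ i.val) :
    classicalGate G n i * classicalGate G n j = classicalGate G n j * classicalGate G n i := by
  have h₁ : lo i ≠ lo j := fun e => by have : i.val = j.val := congrArg (Fin.val (n := n)) e; omega
  have h₂ : lo i ≠ hi j := fun e => by have : i.val = j.val + 1 := congrArg Fin.val e; omega
  have h₃ : hi i ≠ lo j := fun e => by have : i.val + 1 = j.val := congrArg Fin.val e; omega
  have h₄ : hi i ≠ hi j := fun e => by have : i.val + 1 = j.val + 1 := congrArg Fin.val e; omega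
  ext x k
  rw [Equiv.Perm.mul_apply, Equiv.Perm.mul_apply]
  by_cases k₁ : k = lo i
  · subst k₁
    rw [classicalGate_lo, classicalGate_of_ne h₃ h₄, classicalGate_of_ne h₁ h₂, classicalGate_lo]
  by_cases k₂ : k = hi i
  · subst k₂
    rw [classicalGate_hi, classicalGate_of_ne h₃ h₄, classicalGate_of_ne h₁ h₂,
      classicalGate_of_ne h₃ h₄, classicalGate_hi]
  rw [classicalGate_of_ne k₁ k₂]
  by_cases k₃ : k = lo j
  · subst k₃
    rw [classicalGate_lo, classicalGate_lo, classicalGate_of_ne h₂.symm h₄.symm]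
  by_cases k₄ : k = hi j
  · subst k₄
    rw [classicalGate_hi, classicalGate_hi, classicalGate_of_ne h₂.symm h₄.symm,
      classicalGate_of_ne h₁.symm h₃.symm]
  rw [classicalGate_of_ne k₃ k₄, classicalGate_of_ne k₃ k₄, classicalGate_of_ne k₁ k₂]

/-- The sides are compared wire by wire; only on the last of the three wires is a computation in the
group needed. -/
theorem classicalGate_braid {i j : Fin (n - 1)} (h : j.val = i.val + 1) :
    classicalGate G n i * classicalGate G n j * classicalGate G n i =
      classicalGate G n j * classicalGate G n i * classicalGate G n j := by
  have e : lo j = hi i := lo_eq_hi h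
  have h₁ : lo i ≠ lo j := fun e => by have : i.val = j.val := congrArg (Fin.val (n := n)) e; omega
  have h₂ : lo i ≠ hi j := fun e => by have : i.val = j.val + 1 := congrArg Fin.val e; omega
  have h₄ : hi j ≠ hi i := fun e => by have : j.val + 1 = i.val + 1 := congrArg Fin.val e; omega
  have fj := fun x : Fin n → G => classicalGate_lo j x
  have gj := fun x : Fin n → G => classicalGate_hi j x
  have fi := fun x : Fin n → G => classicalGate_lo i x
  have gi := fun x : Fin n → G => classicalGate_hi i x
  have hj := fun x : Fin n → G => classicalGate_of_ne h₁ h₂ x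
  have hk := fun x : Fin n → G => classicalGate_of_ne h₂.symm h₄ x
  rw [e] at fj gj
  ext x k
  simp only [Equiv.Perm.mul_apply]
  by_cases k₁ : k = lo i
  · subst k₁
    simp only [fi, fj, hj, hk]
  by_cases k₂ : k = hi i
  · subst k₂
    simp only [fi, fj, gi, gj, hj, hk]
  by_cases k₃ : k = hi j
  · subst k₃
    simp only [fj, gi, gj, hj, hk]
    group
  have k₄ : k ≠ lo j := e ▸ k₂
  simp only [classicalGate_of_ne k₁ k₂, classicalGate_of_ne k₄ k₃]

theorem satisfiesBraidRelations_classicalGate (G : Type*) [Group G] (n : ℕ) :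
    SatisfiesBraidRelations (classicalGate G n) :=
  ⟨fun _ _ => classicalGate_comm, fun _ _ => classicalGate_braid⟩

end Classical

end

section

/-! ### The Fibonacci gates -/

section Constants

theorem fibTau_pos : 0 < fibTau := by unfold fibTau; positivity

theorem fibTau_eq : fibTau = (Real.sqrt 5 - 1) / 2 := by
  have h : Real.sqrt 5 * Real.sqrt 5 = 5 := Real.mul_self_sqrt (by norm_num)
  have h' : 1 + Real.sqrt 5 ≠ 0 := by positivity
  rw [fibTau, div_eq_iff h']
  linarith

theorem fibTau_sq : fibTau ^ 2 + fibTau = 1 := by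
  have h : Real.sqrt 5 * Real.sqrt 5 = 5 := Real.mul_self_sqrt (by norm_num)
  rw [fibTau_eq]
  linarith

theorem fibA_pow_four : fibA ^ 4 = Complex.exp ((-(12 * Real.pi / 5) : ℝ) * Complex.I) := by
  rw [fibA, ← Complex.exp_nat_mul]
  congr 1
  push_cast
  ring

theorem fibA_mul_conj : fibA ^ 4 * (starRingEnd ℂ) (fibA ^ 4) = 1 := by
  rw [Complex.mul_conj, Complex.normSq_eq_norm_sq, fibA_pow_four, Complex.norm_exp_ofReal_mul_I]
  simp

/-- For z = A⁴ one has z + z⁻¹ = 2 cos(12π/5) = τ, hence (z + 1)² = z(2 + τ), and τ² + τ = 1 gives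
(2 + τ)τ² = 1. -/
theorem fibA_relation : (fibA ^ 4 + 1) ^ 2 * (fibTau : ℂ) ^ 2 = fibA ^ 4 := by
  have h₁ : fibA ^ 4 * Complex.exp ((12 * Real.pi / 5 : ℝ) * Complex.I) = 1 := by
    rw [fibA_pow_four, ← Complex.exp_add, ← Complex.exp_zero]
    congr 1
    push_cast
    ring
  have h₂ : fibA ^ 4 + Complex.exp ((12 * Real.pi / 5 : ℝ) * Complex.I) = fibTau := by
    rw [fibA_pow_four, Complex.exp_mul_I, Complex.exp_mul_I, ← Complex.ofReal_cos,
      ← Complex.ofReal_cos, ← Complex.ofReal_sin, ← Complex.ofReal_sin, Real.cos_neg, Real.sin_neg]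
    have h₃ : Real.cos (12 * Real.pi / 5) = 2 * ((1 + Real.sqrt 5) / 4) ^ 2 - 1 := by
      rw [← Real.cos_pi_div_five, ← Real.cos_two_mul, ← Real.cos_add_two_pi (2 * (Real.pi / 5))]
      congr 1
      ring
    have h : Real.sqrt 5 * Real.sqrt 5 = 5 := Real.mul_self_sqrt (by norm_num)
    have h₄ : 2 * Real.cos (12 * Real.pi / 5) = fibTau := by
      rw [h₃, fibTau_eq]
      linarith
    rw [← h₄]
    push_cast
    ring
  have h₅ : (fibTau : ℂ) ^ 2 + fibTau = 1 := by exact_mod_cast fibTau_sq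
  generalize Complex.exp ((12 * Real.pi / 5 : ℝ) * Complex.I) = w at h₁ h₂
  generalize (fibTau : ℂ) = τ at h₂ h₅ ⊢
  generalize fibA ^ 4 = z at h₁ h₂ ⊢
  have h₆ : (z + 1) ^ 2 = z * (2 + τ) := by rw [← h₂]; linear_combination -h₁
  rw [h₆]
  linear_combination z * (τ + 1) * h₅

end Constants

section Operators

variable {n : ℕ}

/-- The vector on which a Fibonacci gate is not scalar: its component at `l x r`. -/
noncomputable def fibVec : FibSymbol → FibSymbol → FibSymbol → ℂ
  | .star, .p, .star => 1
  | .p, .star, .p => fibTau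
  | .p, .p, .p => (Real.sqrt fibTau : ℝ)
  | _, _, _ => 0

theorem sqrt_fibTau_sq : ((Real.sqrt fibTau : ℝ) : ℂ) * (Real.sqrt fibTau : ℝ) = fibTau := by
  rw [← Complex.ofReal_mul, Real.mul_self_sqrt fibTau_pos.le]

theorem fibTau_sq' : (fibTau : ℂ) ^ 2 + fibTau = 1 := by exact_mod_cast fibTau_sq

/-- The coefficients of a Fibonacci gate, as a combination of the identity and a projection. -/
theorem fibCoeff_eq (l x y r : FibSymbol) (h : ¬(l = .star ∧ x = .star))
    (h' : ¬(x = .star ∧ r = .star)) : fibCoeff l x y r =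
      -fibA ^ 4 * (if y = x then 1 else 0) +
        (fibA ^ 8 + fibA ^ 4) * (fibVec l y r * fibVec l x r) := by
  have e₁ := sqrt_fibTau_sq
  have e₂ := fibTau_sq'
  cases l <;> cases x <;> cases y <;> cases r <;> first
    | exact absurd ⟨rfl, rfl⟩ h
    | exact absurd ⟨rfl, rfl⟩ h'
    | (
      simp only [fibCoeff, fibVec, if_true, reduceCtorEq, if_false, Complex.ofReal_mul]
      generalize ((Real.sqrt fibTau : ℝ) : ℂ) = s at *
      generalize (fibTau : ℂ) = τ at *
      subst e₁
      first | ring1 | linear_combination -fibA ^ 4 * e₂)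

/-- For fixed outer symbols the vector has norm one or is zero; the factor in front covers the
second case. -/
theorem fibVec_norm (l x r : FibSymbol) :
    fibVec l x r * (fibVec l .star r * fibVec l .star r + fibVec l .p r * fibVec l .p r) =
      fibVec l x r := by
  have e₁ := sqrt_fibTau_sq
  have e₂ := fibTau_sq'
  cases l <;> cases x <;> cases r <;> simp only [fibVec]
  all_goals
    generalize ((Real.sqrt fibTau : ℝ) : ℂ) = s at *
    generalize (fibTau : ℂ) = τ at *
    subst e₁
    first | ring1 | linear_combination s * s * e₂ | linear_combination s * e₂

/-- The Temperley–Lieb relation, on four neighbouring symbols. -/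
theorem fibVec_temperleyLieb (a x c d : FibSymbol) (h : ¬(c = .star ∧ d = .star))
    (T : FibSymbol → ℂ) : fibVec a x c *
      (fibVec a .star c * (fibVec .star c d * (fibVec .star .star d * (fibVec a .star .star * T .star) +
        fibVec .star .p d * (fibVec a .star .p * T .p))) +
      fibVec a .p c * (fibVec .p c d * (fibVec .p .star d * (fibVec a .p .star * T .star) +
        fibVec .p .p d * (fibVec a .p .p * T .p)))) =
      fibTau ^ 2 * (fibVec a x c * T c) := by
  have e₁ := sqrt_fibTau_sq
  have e₂ := fibTau_sq'
  cases a <;> cases x <;> cases c <;> cases d <;> first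
  | exact absurd ⟨rfl, rfl⟩ h
  | (
    simp only [fibVec]
    generalize ((Real.sqrt fibTau : ℝ) : ℂ) = s at *
    generalize (fibTau : ℂ) = τ at *
    subst e₁
    ring1)

theorem fibVec_symm (l x r : FibSymbol) : fibVec l x r = fibVec r x l := by
  cases l <;> cases x <;> cases r <;> rfl

variable (i : Fin (n - 1))

/-- The position of the left symbol on which the gate `i` acts. -/
def leftPos : Fin (n + 1) := ⟨i.val, by omega⟩

/-- The position of the middle symbol on which the gate `i` acts. -/
def midPos : Fin (n + 1) := ⟨i.val + 1, by omega⟩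

/-- The position of the right symbol on which the gate `i` acts. -/
def rightPos : Fin (n + 1) := ⟨i.val + 2, by omega⟩

/-- The value of `fibVec` at the symbols on which the gate `i` acts. -/
noncomputable def fibVecAt (t : Fin (n + 1) → FibSymbol) : ℂ :=
  fibVec (t (leftPos i)) (t (midPos i)) (t (rightPos i))

/-- The projection of the gate `i`, on functions on all strings. -/
noncomputable def fibOp (φ : (Fin (n + 1) → FibSymbol) → ℂ) (t : Fin (n + 1) → FibSymbol) : ℂ :=
  fibVecAt i t * ∑ y, fibVecAt i (Function.update t (midPos i) y) *
    φ (Function.update t (midPos i) y)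

/-- The projection of the gate `i`, as a matrix. -/
noncomputable def fibProj : Matrix (FibString n) (FibString n) ℂ := fun t' t =>
  if ∀ k : Fin (n + 1), k.val ≠ i.val + 1 → t'.1 k = t.1 k then fibVecAt i t'.1 * fibVecAt i t.1
  else 0

/-- The conditions on the strings in the basis of the Fibonacci representation. -/
def IsFibString (t : Fin (n + 1) → FibSymbol) : Prop :=
  t 0 = FibSymbol.star ∧ t (Fin.last n) = FibSymbol.star ∧
    ∀ i : Fin n, ¬ (t i.castSucc = FibSymbol.star ∧ t i.succ = FibSymbol.star)

open Classical in
/-- Extension by zero to all strings. -/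
noncomputable def extendZero (φ : FibString n → ℂ) (t : Fin (n + 1) → FibSymbol) : ℂ :=
  if h : IsFibString t then φ ⟨t, h⟩ else 0

theorem extendZero_coe (φ : FibString n → ℂ) (t : FibString n) : extendZero φ t.1 = φ t := by
  have h : IsFibString t.1 := t.2
  rw [extendZero, dif_pos h]

theorem agree_iff_update {t s : Fin (n + 1) → FibSymbol} :
    (∀ k : Fin (n + 1), k.val ≠ i.val + 1 → t k = s k) ↔
      s = Function.update t (midPos i) (s (midPos i)) := by
  constructor
  · intro h
    funext k
    by_cases hk : k = midPos i
    · rw [hk, Function.update_self]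
    · rw [Function.update_of_ne hk, h k fun e => hk (Fin.ext e)]
  · intro h k hk
    have : k ≠ midPos i := fun e => hk (congrArg Fin.val e)
    rw [h, Function.update_of_ne this]

theorem fibProj_mulVec (φ : FibString n → ℂ) (t : FibString n) :
    (fibProj i).mulVec φ t = fibOp i (extendZero φ) t.1 := by
  have h₁ : ∀ s : FibString n, fibProj i t s = ∑ y, if s.1 = Function.update t.1 (midPos i) y then
      fibVecAt i t.1 * fibVecAt i (Function.update t.1 (midPos i) y) else 0 := by
    intro s
    rw [fibProj]
    split_ifs with h
    · rw [agree_iff_update] at h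
      rw [Finset.sum_eq_single (s.1 (midPos i)), if_pos h, ← h]
      · intro y _ hy
        refine if_neg fun e => hy ?_
        rw [e, Function.update_self]
      · simp
    · refine (Finset.sum_eq_zero fun y _ => if_neg fun e => h ?_).symm
      rw [agree_iff_update, e, Function.update_self]
  rw [Matrix.mulVec, dotProduct, fibOp, Finset.mul_sum]
  simp only [h₁, Finset.sum_mul]
  rw [Finset.sum_comm]
  refine Finset.sum_congr rfl fun y _ => ?_
  by_cases h : IsFibString (Function.update t.1 (midPos i) y)
  · rw [Finset.sum_eq_single ⟨_, h⟩, if_pos rfl, extendZero, dif_pos h, mul_assoc]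
    · intro s _ hs
      rw [if_neg fun e => hs (Subtype.ext e), zero_mul]
    · simp
  · rw [extendZero, dif_neg h, mul_zero, mul_zero]
    refine Finset.sum_eq_zero fun s _ => ?_
    have hs : IsFibString s.1 := s.2
    rw [if_neg (by rintro e; rw [e] at hs; exact h hs), zero_mul]

theorem leftPos_ne : leftPos i ≠ midPos i := fun e => by
  have : i.val = i.val + 1 := congrArg (Fin.val (n := n + 1)) e
  omega

theorem rightPos_ne : rightPos i ≠ midPos i := fun e => by
  have : i.val + 2 = i.val + 1 := congrArg (Fin.val (n := n + 1)) e
  omega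

theorem fibVecAt_update (t : Fin (n + 1) → FibSymbol) (y : FibSymbol) :
    fibVecAt i (Function.update t (midPos i) y) = fibVec (t (leftPos i)) y (t (rightPos i)) := by
  rw [fibVecAt, Function.update_of_ne (leftPos_ne i), Function.update_self,
    Function.update_of_ne (rightPos_ne i)]

variable {i}

/-- The update can only hide a pair ⋆⋆ that involves the middle position, and `fibVec` vanishes on
such triples. The ends are never middle positions. -/
theorem isFibString_of_update {t : Fin (n + 1) → FibSymbol} {y : FibSymbol}
    (h : IsFibString (Function.update t (midPos i) y)) (ht : fibVecAt i t ≠ 0) : IsFibString t := by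
  obtain ⟨h₁, h₂, h₃⟩ := h
  have h₀ : (0 : Fin (n + 1)) ≠ midPos i := fun e => by
    have : 0 = i.val + 1 := congrArg (Fin.val (n := n + 1)) e
    omega
  have hl : Fin.last n ≠ midPos i := fun e => by
    have : n = i.val + 1 := congrArg (Fin.val (n := n + 1)) e
    omega
  rw [Function.update_of_ne h₀] at h₁
  rw [Function.update_of_ne hl] at h₂
  refine ⟨h₁, h₂, fun k ⟨k₁, k₂⟩ => ?_⟩
  have key := h₃ k
  by_cases c₁ : k.castSucc = midPos i
  · have : k.succ = rightPos i := Fin.ext (by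
      have : k.val = i.val + 1 := congrArg (Fin.val (n := n + 1)) c₁
      simp [rightPos, this])
    rw [c₁] at k₁
    rw [this] at k₂
    refine ht ?_
    rw [fibVecAt, k₁, k₂]
    cases t (leftPos i) <;> rfl
  by_cases c₂ : k.succ = midPos i
  · have : k.castSucc = leftPos i := Fin.ext (by
      have : k.val + 1 = i.val + 1 := congrArg (Fin.val (n := n + 1)) c₂
      simpa [leftPos] using this)
    rw [c₂] at k₂
    rw [this] at k₁
    refine ht ?_
    rw [fibVecAt, k₁, k₂]
    cases t (rightPos i) <;> rfl
  rw [Function.update_of_ne c₁, Function.update_of_ne c₂] at key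
  exact key ⟨k₁, k₂⟩

/-- Changing one symbol may leave the basis. Extension by zero moves the calculations to all
strings, where updates are unrestricted, and intertwines the two operators. -/
theorem extendZero_mulVec (i : Fin (n - 1)) (φ : FibString n → ℂ) :
    extendZero ((fibProj i).mulVec φ) = fibOp i (extendZero φ) := by
  funext t
  by_cases h : IsFibString t
  · exact (extendZero_coe _ ⟨t, h⟩).trans (fibProj_mulVec i φ ⟨t, h⟩)
  · rw [extendZero, dif_neg h, fibOp]
    by_cases hv : fibVecAt i t = 0
    · rw [hv, zero_mul]
    · rw [Finset.sum_eq_zero, mul_zero]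
      intro y _
      rw [extendZero, dif_neg fun hy => h (isFibString_of_update hy hv), mul_zero]

theorem sum_fibSymbol (f : FibSymbol → ℂ) : ∑ y, f y = f .star + f .p := by
  have : (Finset.univ : Finset FibSymbol) = {.star, .p} := rfl
  rw [this, Finset.sum_insert (by simp), Finset.sum_singleton]

theorem fibOp_fibOp (i : Fin (n - 1)) (φ : (Fin (n + 1) → FibSymbol) → ℂ) :
    fibOp i (fibOp i φ) = fibOp i φ := by
  funext t
  simp only [fibOp, fibVecAt_update, Function.update_idem, sum_fibSymbol]
  rw [fibVecAt]
  linear_combination (fibVec (t (leftPos i)) .star (t (rightPos i)) *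
    φ (Function.update t (midPos i) .star) + fibVec (t (leftPos i)) .p (t (rightPos i)) *
    φ (Function.update t (midPos i) .p)) * fibVec_norm (t (leftPos i)) (t (midPos i)) (t (rightPos i))

theorem pos_ne_of_far {i j : Fin (n - 1)} (h : i.val + 2 ≤ j.val ∨ j.val + 2 ≤ i.val) :
    leftPos j ≠ midPos i ∧ midPos j ≠ midPos i ∧ rightPos j ≠ midPos i := by
  refine ⟨fun e => ?_, fun e => ?_, fun e => ?_⟩
  · have : j.val = i.val + 1 := congrArg (Fin.val (n := n + 1)) e
    omega
  · have : j.val + 1 = i.val + 1 := congrArg (Fin.val (n := n + 1)) e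
    omega
  · have : j.val + 2 = i.val + 1 := congrArg (Fin.val (n := n + 1)) e
    omega

theorem fibOp_comm {i j : Fin (n - 1)} (h : i.val + 2 ≤ j.val ∨ j.val + 2 ≤ i.val)
    (φ : (Fin (n + 1) → FibSymbol) → ℂ) : fibOp i (fibOp j φ) = fibOp j (fibOp i φ) := by
  obtain ⟨h₁, h₂, h₃⟩ := pos_ne_of_far h
  obtain ⟨h₁', h₂', h₃'⟩ := pos_ne_of_far h.symm
  funext t
  simp only [fibOp, fibVecAt, Function.update_self, Function.update_of_ne h₁,
    Function.update_of_ne h₂, Function.update_of_ne h₃, Function.update_of_ne h₁',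
    Function.update_of_ne h₂', Function.update_of_ne h₃', Function.update_of_ne (leftPos_ne _),
    Function.update_of_ne (rightPos_ne _), sum_fibSymbol, Function.update_comm h₂]
  ring

theorem fibOp_temperleyLieb {i j : Fin (n - 1)} (h : j.val = i.val + 1)
    (φ : (Fin (n + 1) → FibSymbol) → ℂ) {t : Fin (n + 1) → FibSymbol} (ht : IsFibString t) :
    fibOp i (fibOp j (fibOp i φ)) t = fibTau ^ 2 * fibOp i φ t := by
  have e₁ : leftPos j = midPos i := Fin.ext (by simpa [leftPos, midPos] using h)
  have e₂ : rightPos i = midPos j := Fin.ext (by simp [rightPos, midPos, h])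
  have n₁ := leftPos_ne i
  have n₂ := rightPos_ne i
  have n₃ : rightPos j ≠ midPos i := fun e => by
    have : j.val + 2 = i.val + 1 := congrArg (Fin.val (n := n + 1)) e
    omega
  have n₄ : leftPos i ≠ midPos j := fun e => by
    have : i.val = j.val + 1 := congrArg (Fin.val (n := n + 1)) e
    omega
  have n₅ := rightPos_ne j
  rw [e₂] at n₂
  have hcd : ¬(t (midPos j) = .star ∧ t (rightPos j) = .star) := by
    have := ht.2.2 ⟨j.val + 1, by omega⟩
    exact this
  -- `T z` is the inner product formed by the innermost `fibOp i` when the symbol at `midPos j` is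
  -- `z`.
  have key := fibVec_temperleyLieb (t (leftPos i)) (t (midPos i)) (t (midPos j)) (t (rightPos j)) hcd
    fun z => ∑ w, fibVec (t (leftPos i)) w z *
      φ (Function.update (Function.update t (midPos j) z) (midPos i) w)
  have hu : Function.update t (midPos j) (t (midPos j)) = t := Function.update_eq_self _ _
  simp only [hu] at key
  simp only [fibOp, fibVecAt, e₁, e₂, Function.update_self, Function.update_of_ne n₁,
    Function.update_of_ne n₂, Function.update_of_ne n₃, Function.update_of_ne n₄,
    Function.update_of_ne n₅, Function.update_of_ne n₂.symm, Function.update_idem,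
    Function.update_comm n₂.symm] at key ⊢
  rw [← key]
  simp only [sum_fibSymbol]

/-- The mirror image of `fibOp_temperleyLieb`, by the symmetry `fibVec_symm`. -/
theorem fibOp_temperleyLieb' {i j : Fin (n - 1)} (h : j.val = i.val + 1)
    (φ : (Fin (n + 1) → FibSymbol) → ℂ) {t : Fin (n + 1) → FibSymbol} (ht : IsFibString t) :
    fibOp j (fibOp i (fibOp j φ)) t = fibTau ^ 2 * fibOp j φ t := by
  have e₁ : rightPos i = midPos j := Fin.ext (by simp [rightPos, midPos, h])
  have e₂ : leftPos j = midPos i := Fin.ext (by simpa [leftPos, midPos] using h)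
  have n₁ := rightPos_ne j
  have n₂ := leftPos_ne j
  have n₃ : leftPos i ≠ midPos j := fun e => by
    have : i.val = j.val + 1 := congrArg (Fin.val (n := n + 1)) e
    omega
  have n₄ : rightPos j ≠ midPos i := fun e => by
    have : j.val + 2 = i.val + 1 := congrArg (Fin.val (n := n + 1)) e
    omega
  have n₅ := leftPos_ne i
  rw [e₂] at n₂
  have hcd : ¬(t (midPos i) = .star ∧ t (leftPos i) = .star) := fun h =>
    ht.2.2 ⟨i.val, by omega⟩ ⟨h.2, h.1⟩
  have key := fibVec_temperleyLieb (t (rightPos j)) (t (midPos j)) (t (midPos i)) (t (leftPos i)) hcd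
    fun z => ∑ w, fibVec (t (rightPos j)) w z *
      φ (Function.update (Function.update t (midPos i) z) (midPos j) w)
  have hu : Function.update t (midPos i) (t (midPos i)) = t := Function.update_eq_self _ _
  simp only [hu] at key
  simp only [fibVec_symm (t (rightPos j)), fibVec_symm _ _ (t (leftPos i))] at key
  simp only [fibOp, fibVecAt, e₁, e₂, Function.update_self, Function.update_of_ne n₁,
    Function.update_of_ne n₂, Function.update_of_ne n₃, Function.update_of_ne n₄,
    Function.update_of_ne n₅, Function.update_of_ne n₂.symm, Function.update_idem,
    Function.update_comm n₂.symm] at key ⊢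
  rw [← key]
  simp only [sum_fibSymbol]

theorem FibString.not_star_star (t : FibString n) (i : Fin (n - 1)) :
    ¬(t.1 (leftPos i) = .star ∧ t.1 (midPos i) = .star) ∧
      ¬(t.1 (midPos i) = .star ∧ t.1 (rightPos i) = .star) :=
  ⟨t.2.2.2 ⟨i.val, by omega⟩, t.2.2.2 ⟨i.val + 1, by omega⟩⟩

/-- The matrices of the gates, as combinations of the identity and a projection. -/
theorem fibGate_eq (i : Fin (n - 1)) :
    fibGate n i = (-fibA ^ 4) • (1 : Matrix (FibString n) (FibString n) ℂ) +
      (fibA ^ 8 + fibA ^ 4) • fibProj i := by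
  ext t' t
  rw [Matrix.add_apply, Matrix.smul_apply, Matrix.smul_apply, Matrix.one_apply, fibProj]
  by_cases h : ∀ k : Fin (n + 1), k.val ≠ i.val + 1 → t'.1 k = t.1 k
  · obtain ⟨k₁, k₂⟩ := t.not_star_star i
    have e : fibGate n i t' t = fibCoeff (t.1 (leftPos i)) (t.1 (midPos i)) (t'.1 (midPos i))
      (t.1 (rightPos i)) := if_pos h
    have h₁ : t'.1 (leftPos i) = t.1 (leftPos i) := h _ (by simp [leftPos])
    have h₂ : t'.1 (rightPos i) = t.1 (rightPos i) := h _ (by simp [rightPos])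
    have h₃ : t' = t ↔ t'.1 (midPos i) = t.1 (midPos i) := by
      refine ⟨fun e => e ▸ rfl, fun e => Subtype.ext (funext fun k => ?_)⟩
      by_cases hk : k = midPos i
      · rw [hk, e]
      · exact h k fun e => hk (Fin.ext e)
    rw [e, fibCoeff_eq _ _ _ _ k₁ k₂, if_pos h, fibVecAt, fibVecAt, h₁, h₂]
    simp only [h₃, smul_eq_mul]
  · have h' : t' ≠ t := by
      rintro rfl
      exact h fun _ _ => rfl
    rw [if_neg h, if_neg h', smul_zero, smul_zero, add_zero]
    exact if_neg h

theorem fibProj_mul_self (i : Fin (n - 1)) : fibProj i * fibProj i = fibProj i := by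
  refine Matrix.ext_iff_mulVec.2 fun φ => funext fun t => ?_
  rw [← Matrix.mulVec_mulVec, fibProj_mulVec, extendZero_mulVec, fibOp_fibOp, fibProj_mulVec]

theorem fibProj_comm {i j : Fin (n - 1)} (h : i.val + 2 ≤ j.val ∨ j.val + 2 ≤ i.val) :
    fibProj i * fibProj j = fibProj j * fibProj i := by
  refine Matrix.ext_iff_mulVec.2 fun φ => funext fun t => ?_
  rw [← Matrix.mulVec_mulVec, ← Matrix.mulVec_mulVec, fibProj_mulVec, fibProj_mulVec,
    extendZero_mulVec, extendZero_mulVec, fibOp_comm h]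

theorem fibProj_temperleyLieb {i j : Fin (n - 1)} (h : j.val = i.val + 1) :
    fibProj i * fibProj j * fibProj i = ((fibTau : ℂ) ^ 2) • fibProj i := by
  refine Matrix.ext_iff_mulVec.2 fun φ => funext fun t => ?_
  rw [← Matrix.mulVec_mulVec, ← Matrix.mulVec_mulVec, fibProj_mulVec, extendZero_mulVec,
    extendZero_mulVec, fibOp_temperleyLieb h _ t.2, Matrix.smul_mulVec, Pi.smul_apply,
    fibProj_mulVec, smul_eq_mul]

theorem fibProj_temperleyLieb' {i j : Fin (n - 1)} (h : j.val = i.val + 1) :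
    fibProj j * fibProj i * fibProj j = ((fibTau : ℂ) ^ 2) • fibProj j := by
  refine Matrix.ext_iff_mulVec.2 fun φ => funext fun t => ?_
  rw [← Matrix.mulVec_mulVec, ← Matrix.mulVec_mulVec, fibProj_mulVec, extendZero_mulVec,
    extendZero_mulVec, fibOp_temperleyLieb' h _ t.2, Matrix.smul_mulVec, Pi.smul_apply,
    fibProj_mulVec, smul_eq_mul]

theorem star_fibProj (i : Fin (n - 1)) : star (fibProj i) = fibProj i := by
  have hv : ∀ l x r, (starRingEnd ℂ) (fibVec l x r) = fibVec l x r := by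
    intro l x r
    cases l <;> cases x <;> cases r <;> simp [fibVec]
  ext t' t
  rw [Matrix.star_apply, fibProj, fibProj]
  have : (∀ k : Fin (n + 1), k.val ≠ i.val + 1 → t.1 k = t'.1 k) ↔
      ∀ k : Fin (n + 1), k.val ≠ i.val + 1 → t'.1 k = t.1 k :=
    forall₂_congr fun _ _ => eq_comm
  by_cases h : ∀ k : Fin (n + 1), k.val ≠ i.val + 1 → t'.1 k = t.1 k
  · rw [if_pos h, if_pos (this.2 h)]
    change (starRingEnd ℂ) _ = _
    rw [map_mul, fibVecAt, fibVecAt, hv, hv, mul_comm]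
  · rw [if_neg h, if_neg fun e => h (this.1 e), star_zero]

/-- The gate is A⁸ on the image of a self-adjoint projection and -A⁴ on its kernel, and both numbers
have modulus one. -/
theorem fibGate_unitary (i : Fin (n - 1)) : fibGate n i ∈ Matrix.unitaryGroup (FibString n) ℂ := by
  have h₁ := fibA_mul_conj
  have h₂ : (fibA ^ 8) * (starRingEnd ℂ) (fibA ^ 8) = 1 := by
    have : fibA ^ 8 = fibA ^ 4 * fibA ^ 4 := by ring
    rw [this, map_mul]
    linear_combination (fibA ^ 4 * (starRingEnd ℂ) (fibA ^ 4) + 1) * h₁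
  have hs : ∀ z : ℂ, star z = (starRingEnd ℂ) z := fun _ => rfl
  rw [Matrix.mem_unitaryGroup_iff, fibGate_eq, star_add, star_smul, star_smul, star_fibProj, star_one,
    hs, hs, map_neg, map_add, add_mul, mul_add, mul_add]
  simp only [Matrix.smul_mul, Matrix.mul_smul, one_mul, mul_one, fibProj_mul_self, smul_smul]
  generalize (starRingEnd ℂ) (fibA ^ 4) = z at *
  generalize (starRingEnd ℂ) (fibA ^ 8) = w at *
  generalize fibA ^ 4 = x at *
  generalize fibA ^ 8 = y at *
  calc _ = (x * z) • (1 : Matrix (FibString n) (FibString n) ℂ) + (y * w - x * z) • fibProj i := by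
        module
    _ = 1 := by rw [h₁, h₂, sub_self, one_smul, zero_smul, add_zero]

theorem satisfiesBraidRelations_fibGate (n : ℕ) : SatisfiesBraidRelations (fibGate n) := by
  constructor
  · intro i j h
    have e := fibProj_comm h
    rw [fibGate_eq, fibGate_eq]
    simp only [add_mul, mul_add, Matrix.smul_mul, Matrix.mul_smul, one_mul, mul_one, e, smul_smul]
    module
  · intro i j h
    have r := fibA_relation
    have e₁ := fibProj_temperleyLieb h
    have e₂ := fibProj_temperleyLieb' h
    rw [fibGate_eq, fibGate_eq]
    simp only [add_mul, mul_add, Matrix.smul_mul, Matrix.mul_smul, one_mul, mul_one, smul_smul,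
      fibProj_mul_self, e₁, e₂]
    have h₈ : fibA ^ 8 = (fibA ^ 4) ^ 2 := by ring
    rw [h₈]
    generalize fibA ^ 4 = x at *
    generalize (fibTau : ℂ) = τ at *
    -- By the Temperley–Lieb relations the two sides differ by a multiple of the difference of the
    -- projections; with x = A⁴ the factor is (x² + x)x²((x + 1)²τ² - x), which vanishes.
    linear_combination (norm := module) (((x ^ 2 + x) * x ^ 2) * r) • (fibProj i - fibProj j)

end Operators

end

/-! ### Evaluation of unitary circuits and conclusion -/

/-- The matrix inverse of a unitary gate is its inverse in the unitary group, so circuits can be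
evaluated in a group, where braid representations apply. -/
theorem evalCircuit_fibGate {n : ℕ} (C : BraidWord n) : evalCircuit (fibGate n) C =
    (evalCircuit (fun i => (⟨fibGate n i, fibGate_unitary i⟩ :
      Matrix.unitaryGroup (FibString n) ℂ)) C).1 := by
  induction C with
  | nil => rfl
  | cons x C ih =>
    rw [evalCircuit_cons, evalCircuit_cons, ih]
    split_ifs
    · rfl
    · rw [Matrix.inv_eq_left_inv (B := star (fibGate n x.1))
        (Matrix.mem_unitaryGroup_iff'.1 (fibGate_unitary x.1))]
      rfl

theorem evalCircuit_fibGate_eq {n : ℕ} {C D : BraidWord n} (h : toBraid C = toBraid D) :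
    evalCircuit (fibGate n) C = evalCircuit (fibGate n) D := by
  rw [evalCircuit_fibGate, evalCircuit_fibGate]
  obtain ⟨h₁, h₂⟩ := satisfiesBraidRelations_fibGate n
  exact congrArg Subtype.val (evalCircuit_eq_of_toBraid
    ⟨fun i j h => Subtype.ext (h₁ i j h), fun i j h => Subtype.ext (h₂ i j h)⟩ h)

theorem mainTheorem2 :
    ∃ (s : ∀ n : ℕ, Equiv.Perm (Fin n) → List (Fin (n - 1)))
      (O : ∀ n : ℕ, BraidWord n → BraidWord n),
      -- `O` is the reduction to Garside normal form, simple braids being spelled by `s`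
      (∀ n : ℕ, IsSimpleSpelling (s n)) ∧
      (∀ (n : ℕ) (C D : BraidWord n),
        D = O n C ↔ IsGarsideNormalForm (s n) D ∧ toBraid D = toBraid C) ∧
      -- one polynomial-time algorithm computes `O`, for all numbers of strands
      Nonempty (Turing.TM2ComputableInPolyTime encodeCircuit encodeCircuit
        (fun C : Σ n : ℕ, BraidWord n => (⟨C.1, O C.1 C.2⟩ : Σ n : ℕ, BraidWord n))) ∧
      -- the slowdown is polynomial also in the number of strands
      (∃ p : Polynomial ℕ, ∀ (n : ℕ) (C : BraidWord n), (O n C).length ≤ p.eval (n + C.length)) ∧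
      -- classical reversible circuits
      (∀ (G : Type*) [Group G] [Finite G] (n : ℕ),
        SatisfiesBraidRelations (classicalGate G n) ∧
        IsIndistinguishabilityObfuscator (classicalGate G n) (braidRelations n) Set.univ (O n)) ∧
      -- quantum circuits
      (∀ n : ℕ,
        (∀ i : Fin (n - 1), fibGate n i ∈ Matrix.unitaryGroup (FibString n) ℂ) ∧
        SatisfiesBraidRelations (fibGate n) ∧
        IsIndistinguishabilityObfuscator (fibGate n) (braidRelations n) Set.univ (O n)) := by
  choose O h₁ h₂ h₃ h₄ using @garside_spec
  have hO : ∀ (n : ℕ) (C D : BraidWord n), toBraid C = toBraid D → O C = O D := fun n C D h =>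
    normalForm_unique (h₂ C) (h₂ D) (by rw [h₃, h₃, h])
  have hp : ∀ (n : ℕ) (C : BraidWord n),
      (O C).length ≤ (Polynomial.C (6 * (n * n)) * Polynomial.X).eval C.length := fun n C => by
    simpa using h₄ C
  refine ⟨simpleWord, fun n => O, isSimpleSpelling_simpleWord, fun n C D => ⟨?_, ?_⟩,
    computableInPolyTime_of_garside fun n C => h₁ C, ⟨6 * .X ^ 3, fun n C => ?_⟩,
    fun G _ _ n => ⟨satisfiesBraidRelations_classicalGate G n, ?_⟩, fun n => ⟨fibGate_unitary,
      satisfiesBraidRelations_fibGate n, ?_⟩⟩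
  · rintro rfl
    exact ⟨h₂ C, h₃ C⟩
  · rintro ⟨hD, e⟩
    exact normalForm_unique hD (h₂ C) (by rw [h₃, e])
  · refine (h₄ C).trans ?_
    simp only [Polynomial.eval_mul, Polynomial.eval_pow, Polynomial.eval_X, Polynomial.eval_ofNat]
    calc 6 * (n * n) * C.length
        ≤ 6 * ((n + C.length) * (n + C.length)) * (n + C.length) := by gcongr <;> omega
      _ = 6 * (n + C.length) ^ 3 := by ring
  · exact isIndistinguishabilityObfuscator_of_toBraid
      (fun _ _ => evalCircuit_eq_of_toBraid (satisfiesBraidRelations_classicalGate G n)) h₃ (hO n) _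
      (hp n)
  · exact isIndistinguishabilityObfuscator_of_toBraid (fun _ _ => evalCircuit_fibGate_eq) h₃ (hO n) _
      (hp n)
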